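/- Let $G, G'$ be (discrete) groups and let $q:G'\to G$ be an epimorphism with finite kernel $\Gamma$. Let $W$ be a closed connected oriented surface of positive genus with fundamental group $\pi=\pi_1(W)$ and fundamental class $[W]\in H_2(W;\mathbb{Z})=H_2(\pi;\mathbb{Z})$. A representation of $\Gamma$ is a homomorphism $\rho:\Gamma\to GL_n(\mathbb{C})$ with $n\ge 1$; it is irreducible if the only $\Gamma$-invariant linear subspaces of $\mathbb{C}^n$ are $0$ and $\mathbb{C}^n$. For an irreducible $\rho$, let $G_\rho\subseteq G$ be the subgroup of all $\alpha\in G$ such that for some $\widetilde\alpha\in q^{-1}(\alpha)$ the representation $h\mapsto\rho(\widetilde\alpha^{-1}h\widetilde\alpha)$ is equivalent to $\rho$. For each $\alpha\in G_\rho$ choose such an $\widetilde\alpha$ and a matrix $M_\alpha\in GL_n(\mathbb{C})$ with $\rho(\widetilde\alpha^{-1}h\widetilde\alpha)=M_\alpha^{-1}\rho(h)M_\alpha$ for all $h\in\Gamma$. For $\alpha,\beta\in G_\rho$ there is a unique $\zeta_{\alpha,\beta}\in\mathbb{C}^*$ with $$\zeta_{\alpha,\beta}\,M_\alpha M_\beta=M_{\alpha\beta}\,\rho\bigl(\widetilde{\alpha\beta}^{\,-1}\,\widetilde\alpha\,\widetilde\beta\bigr),$$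 and $\{\zeta_{\alpha,\beta}\}$ is a 2-cocycle of $G_\rho$ with coefficients in the trivial module $\mathbb{C}^*$; let $\zeta_\rho\in H^2(G_\rho;\mathbb{C}^*)$ be its cohomology class. For a homomorphism $g:\pi\to G$, let $\mathrm{Hom}_g(\pi,G')$ be the set of homomorphisms $g':\pi\to G'$ with $qg'=g$. Then the sets $\mathrm{Hom}_g(\pi,G')$ and $\mathrm{Hom}(\pi,\Gamma)$ are finite and $$|\mathrm{Hom}_g(\pi,G')|\le|\mathrm{Hom}(\pi,\Gamma)|.$$ This inequality is an equality if and only if for every irreducible representation $\rho$ of $\Gamma$ one has $g(\pi)\subseteq G_\rho$ and $g^*(\zeta_\rho)([W])=1$, where $g^*(\zeta_\rho)([W])\in\mathbb{C}^*$ is the evaluation of $g^*(\zeta_\rho)\in H^2(\pi;\mathbb{C}^*)$ on $[W]$. -/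

import Mathlib

open CategoryTheory Limits AlgebraicTopology Matrix

namespace SurfaceLifts

noncomputable section

universe u v

/-! ### Irreducible representations, their stabilizers and their cohomology classes -/

section Representations

variable {G : Type u} {G' : Type v} [Group G] [Group G']

/-- A representation `Γ → GL_n(ℂ)` with `n ≥ 1` is irreducible if the only invariant linear
subspaces of `ℂⁿ` are `0` and `ℂⁿ`. -/
def IsIrreducible {Γ : Type v} [Group Γ] {n : ℕ} (ρ : Γ →* GL (Fin n) ℂ) : Prop :=
  0 < n ∧ ∀ V : Submodule ℂ (Fin n → ℂ),
    (∀ h : Γ, ∀ x ∈ V, (ρ h : Matrix (Fin n) (Fin n) ℂ) *ᵥ x ∈ V) → V = ⊥ ∨ V = ⊤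

/-- The group `G_ρ`: all `α ∈ G` such that for some lift `a ∈ G'` of `α` the representation
`h ↦ ρ (a⁻¹ h a)` of `Γ = ker q` is equivalent to `ρ`. -/
def stabilizer (q : G' →* G) {n : ℕ} (ρ : q.ker →* GL (Fin n) ℂ) : Subgroup G where
  carrier := {α | ∃ a : G', q a = α ∧ ∃ M : GL (Fin n) ℂ, ∀ h : q.ker,
    ρ (MulAut.conjNormal a⁻¹ h) = M⁻¹ * ρ h * M}
  one_mem' := ⟨1, by simp, 1, by simp⟩
  mul_mem' := by
    rintro _ _ ⟨a, rfl, M, hM⟩ ⟨b, rfl, N, hN⟩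
    refine ⟨a * b, by simp, M * N, fun h => ?_⟩
    rw [_root_.mul_inv_rev, map_mul, MulAut.mul_apply, hN, hM]
    group
  inv_mem' := by
    rintro _ ⟨a, rfl, M, hM⟩
    refine ⟨a⁻¹, by simp, M⁻¹, fun h => ?_⟩
    have := hM (MulAut.conjNormal a h)
    rw [← MulAut.mul_apply, ← map_mul] at this
    simp only [inv_mul_cancel, map_one, MulAut.one_apply] at this
    rw [this]
    simp only [inv_inv]
    group

variable (q : G' →* G) {n : ℕ} (ρ : q.ker →* GL (Fin n) ℂ)

/-- A chosen lift `α̃ ∈ q⁻¹(α)` of an element `α ∈ G_ρ`. -/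
def lift (α : stabilizer q ρ) : G' := α.2.choose

lemma q_lift (α : stabilizer q ρ) : q (lift q ρ α) = α := α.2.choose_spec.1

/-- A chosen matrix `M_α` with `ρ (α̃⁻¹ h α̃) = M_α⁻¹ ρ(h) M_α`. -/
def mat (α : stabilizer q ρ) : GL (Fin n) ℂ := α.2.choose_spec.2.choose

lemma mat_spec (α : stabilizer q ρ) (h : q.ker) :
    ρ (MulAut.conjNormal (lift q ρ α)⁻¹ h) = (mat q ρ α)⁻¹ * ρ h * mat q ρ α :=
  α.2.choose_spec.2.choose_spec h

/-- The element `(αβ)~⁻¹ α̃ β̃` of `Γ = ker q`. -/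
def defect (α β : stabilizer q ρ) : q.ker :=
  ⟨(lift q ρ (α * β))⁻¹ * lift q ρ α * lift q ρ β, by
    simp [MonoidHom.mem_ker, q_lift]⟩

variable {q ρ}

/-- The scalar matrix `z · 1`. -/
def scalarGL (n : ℕ) : ℂˣ →* GL (Fin n) ℂ :=
  Units.map (algebraMap ℂ (Matrix (Fin n) (Fin n) ℂ)).toMonoidHom

lemma scalarGL_comm (z : ℂˣ) (M : GL (Fin n) ℂ) : M * scalarGL n z = scalarGL n z * M :=
  Units.ext (Algebra.commutes (z : ℂ) (M : Matrix (Fin n) (Fin n) ℂ)).symm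

lemma scalarGL_injective (hn : 0 < n) : Function.Injective (scalarGL n) := by
  have : Nonempty (Fin n) := ⟨⟨0, hn⟩⟩
  intro z w h
  exact Units.ext ((algebraMap ℂ (Matrix (Fin n) (Fin n) ℂ)).injective (congrArg Units.val h))

/-- Schur's lemma in matrix form. -/
lemma schur (hρ : IsIrreducible ρ) (N : GL (Fin n) ℂ)
    (hN : ∀ h, N * ρ h = ρ h * N) : ∃ z : ℂˣ, scalarGL n z = N := by
  have : Nonempty (Fin n) := ⟨⟨0, hρ.1⟩⟩
  let f : Module.End ℂ (Fin n → ℂ) := Matrix.toLin' (N : Matrix (Fin n) (Fin n) ℂ)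
  obtain ⟨μ, hμ⟩ := Module.End.exists_eigenvalue f
  have htop : Module.End.eigenspace f μ = ⊤ := by
    refine (hρ.2 (Module.End.eigenspace f μ) ?_).resolve_left hμ
    intro h x hx
    rw [Module.End.mem_eigenspace_iff] at hx ⊢
    have hc : (N : Matrix (Fin n) (Fin n) ℂ) * (ρ h : Matrix (Fin n) (Fin n) ℂ)
        = (ρ h : Matrix (Fin n) (Fin n) ℂ) * (N : Matrix (Fin n) (Fin n) ℂ) := by
      simpa using congrArg Units.val (hN h)
    simp only [f, Matrix.toLin'_apply] at hx ⊢
    rw [Matrix.mulVec_mulVec, hc, ← Matrix.mulVec_mulVec, hx, Matrix.mulVec_smul]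
  have hfx : ∀ x : Fin n → ℂ, (N : Matrix (Fin n) (Fin n) ℂ) *ᵥ x = μ • x := by
    intro x
    have : x ∈ Module.End.eigenspace f μ := by rw [htop]; trivial
    simpa [f, Module.End.mem_eigenspace_iff] using this
  have hNμ : (N : Matrix (Fin n) (Fin n) ℂ) = algebraMap ℂ _ μ := by
    rw [Algebra.algebraMap_eq_smul_one]
    apply Matrix.toLin'.injective
    refine LinearMap.ext fun x => ?_
    simp [hfx]
  have hμ0 : μ ≠ 0 := by
    rintro rfl
    rw [map_zero] at hNμ
    exact N.ne_zero hNμ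
  exact ⟨Units.mk0 μ hμ0, Units.ext hNμ.symm⟩

/-- `ρ(h) M_α = M_α ρ(α̃⁻¹ h α̃)`. -/
lemma rho_mul_mat (α : stabilizer q ρ) (h : q.ker) :
    ρ h * mat q ρ α = mat q ρ α * ρ (MulAut.conjNormal (lift q ρ α)⁻¹ h) := by
  rw [mat_spec]; group

lemma exists_zeta (hρ : IsIrreducible ρ) (α β : stabilizer q ρ) :
    ∃ z : ℂˣ, scalarGL n z * mat q ρ α * mat q ρ β =
      mat q ρ (α * β) * ρ (defect q ρ α β) := by
  obtain ⟨z, hz⟩ := schur hρ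
    (mat q ρ (α * β) * ρ (defect q ρ α β) * (mat q ρ α * mat q ρ β)⁻¹) (fun h => by
      have e : ρ h * (mat q ρ α * mat q ρ β) = (mat q ρ α * mat q ρ β) *
          ρ (MulAut.conjNormal (lift q ρ β)⁻¹ (MulAut.conjNormal (lift q ρ α)⁻¹ h)) := by
        rw [← mul_assoc, rho_mul_mat, mul_assoc, rho_mul_mat, mul_assoc]
      have e2 : ρ (MulAut.conjNormal (lift q ρ β)⁻¹ (MulAut.conjNormal (lift q ρ α)⁻¹ h)) *
          (mat q ρ α * mat q ρ β)⁻¹ = (mat q ρ α * mat q ρ β)⁻¹ * ρ h := by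
        rw [mul_inv_eq_iff_eq_mul, mul_assoc, e, inv_mul_cancel_left]
      rw [mul_assoc, ← e2, ← mul_assoc, ← mul_assoc (ρ h), ← mul_assoc (ρ h), rho_mul_mat]
      congr 1
      rw [mul_assoc, mul_assoc, ← map_mul, ← map_mul]
      congr 2
      ext
      simp [defect, mul_assoc])
  exact ⟨z, by rw [mul_assoc, hz, inv_mul_cancel_right]⟩

/-- The number `ζ_{α,β} ∈ ℂ*` with `ζ_{α,β} M_α M_β = M_{αβ} ρ((αβ)~⁻¹ α̃ β̃)`. -/
def zeta (hρ : IsIrreducible ρ) (p : stabilizer q ρ × stabilizer q ρ) : ℂˣ :=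
  (exists_zeta hρ p.1 p.2).choose

lemma zeta_spec (hρ : IsIrreducible ρ) (α β : stabilizer q ρ) :
    scalarGL n (zeta hρ (α, β)) * mat q ρ α * mat q ρ β =
      mat q ρ (α * β) * ρ (defect q ρ α β) :=
  (exists_zeta hρ α β).choose_spec

lemma zeta_cocycle (hρ : IsIrreducible ρ) (α β γ : stabilizer q ρ) :
    zeta hρ (α * β, γ) * zeta hρ (α, β) = zeta hρ (β, γ) * zeta hρ (α, β * γ) := by
  apply scalarGL_injective hρ.1
  have h1 : scalarGL n (zeta hρ (α * β, γ) * zeta hρ (α, β)) *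
      (mat q ρ α * mat q ρ β * mat q ρ γ) = mat q ρ (α * β * γ) *
        ρ (defect q ρ (α * β) γ * MulAut.conjNormal (lift q ρ γ)⁻¹ (defect q ρ α β)) := by
    rw [map_mul, map_mul ρ, ← mul_assoc (mat q ρ (α * β * γ)), ← zeta_spec hρ,
      mul_assoc _ (mat q ρ γ), ← rho_mul_mat, mul_assoc _ (mat q ρ (α * β)),
      ← mul_assoc (mat q ρ (α * β)), ← zeta_spec hρ]
    simp only [mul_assoc]
  have h2 : scalarGL n (zeta hρ (β, γ) * zeta hρ (α, β * γ)) *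
      (mat q ρ α * mat q ρ β * mat q ρ γ) = mat q ρ (α * (β * γ)) *
        ρ (defect q ρ α (β * γ) * defect q ρ β γ) := by
    rw [mul_comm (zeta hρ (β, γ)), map_mul, map_mul ρ, ← mul_assoc (mat q ρ (α * (β * γ))),
      ← zeta_spec hρ, mul_assoc _ _ (ρ (defect q ρ β γ)), ← zeta_spec hρ]
    simp only [mul_assoc]
    congr 1
    simp only [← mul_assoc]
    rw [scalarGL_comm]
  have h3 : defect q ρ (α * β) γ * MulAut.conjNormal (lift q ρ γ)⁻¹ (defect q ρ α β) =
      defect q ρ α (β * γ) * defect q ρ β γ := by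
    ext
    simp [defect, mul_assoc]
  rw [h3, mul_assoc α, ← h2] at h1
  exact mul_right_cancel h1

end Representations

/-! ### Second cohomology of a group with coefficients in `ℂ*` (trivial action) -/

section Cohomology

/-- The group of 2-cocycles `G × G → ℂ*` for the trivial action of `G` on `ℂ*`. -/
def Z2 (G : Type u) [Group G] : Subgroup (G × G → ℂˣ) where
  carrier := {f | ∀ a b c : G, f (a * b, c) * f (a, b) = f (b, c) * f (a, b * c)}
  one_mem' := by intro a b c; simp
  mul_mem' := by
    intro f g hf hg a b c
    simp only [Pi.mul_apply]
    rw [mul_mul_mul_comm, hf, hg, mul_mul_mul_comm]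
  inv_mem' := by
    intro f hf a b c
    simp only [Pi.inv_apply]
    rw [← mul_inv, hf, mul_inv]

/-- The coboundary `(δx)(a, b) = x(b) x(ab)⁻¹ x(a)` of a 1-cochain `x`. -/
def cobound (G : Type u) [Group G] : (G → ℂˣ) →* (G × G → ℂˣ) where
  toFun x p := x p.2 * (x (p.1 * p.2))⁻¹ * x p.1
  map_one' := by ext; simp
  map_mul' x y := by
    funext p
    simp only [Pi.mul_apply, mul_inv]
    rw [mul_mul_mul_comm (x p.2), mul_mul_mul_comm]

/-- The cohomology group `H²(G; ℂ*)`: 2-cocycles modulo coboundaries. -/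
abbrev H2 (G : Type u) [Group G] : Type u := Z2 G ⧸ (cobound G).range.subgroupOf (Z2 G)

/-- The pull-back of cocycles along a group homomorphism. -/
def Z2.pullback {G : Type u} {H : Type v} [Group G] [Group H] (f : H →* G) : Z2 G →* Z2 H where
  toFun c := ⟨fun p => c.1 (f p.1, f p.2), fun a b d => by
    simpa using c.2 (f a) (f b) (f d)⟩
  map_one' := rfl
  map_mul' _ _ := rfl

/-- The homomorphism `f^* : H²(G; ℂ*) → H²(H; ℂ*)` induced by `f : H → G`. -/
def H2.pullback {G : Type u} {H : Type v} [Group G] [Group H] (f : H →* G) : H2 G →* H2 H :=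
  QuotientGroup.map _ _ (Z2.pullback f) (by
    rintro ⟨c, hc⟩ ⟨x, hx⟩
    refine ⟨fun h => x (f h), ?_⟩
    funext p
    have := congrFun hx (f p.1, f p.2)
    simpa [cobound, Z2.pullback] using this)

/-- The cohomology class `ζ_ρ ∈ H²(G_ρ; ℂ*)` of an irreducible representation `ρ`. -/
def zetaClass {G : Type u} {G' : Type v} [Group G] [Group G'] {q : G' →* G} {n : ℕ}
    {ρ : q.ker →* GL (Fin n) ℂ} (hρ : IsIrreducible ρ) : H2 (stabilizer q ρ) :=
  QuotientGroup.mk (⟨zeta hρ, zeta_cocycle hρ⟩ : Z2 (stabilizer q ρ))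

end Cohomology

/-! ### Evaluation of classes in `H²(π₁(W); ℂ*)` on classes in `H₂(W)` -/

section Evaluation

/-- The singular simplicial set of `W`. -/
abbrev singularSet (W : Type) [TopologicalSpace W] : SSet.{0} :=
  TopCat.toSSet.obj (TopCat.of W)

/-- The singular chain complex of `W` with integer coefficients. -/
abbrev singularChains (W : Type) [TopologicalSpace W] : ChainComplex (ModuleCat.{0} ℤ) ℕ :=
  (singularSet W).chainComplex (ModuleCat.of ℤ ℤ)

/-- The singular homology group `H₂(W; ℤ)`. -/
abbrev singularH2 (W : Type) [TopologicalSpace W] : ModuleCat.{0} ℤ :=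
  (singularChains W).homology 2

/-- `singularH2` is the value of Mathlib's singular homology functor. -/
lemma singularH2_eq (W : Type) [TopologicalSpace W] : singularH2 W =
    ((singularHomologyFunctor (ModuleCat.{0} ℤ) 2).obj (ModuleCat.of ℤ ℤ)).obj (TopCat.of W) :=
  rfl

/-- The singular `n`-simplices of `W`. -/
abbrev Simp (W : Type) [TopologicalSpace W] (n : ℕ) : Type :=
  (singularSet W).obj (.op (SimplexCategory.mk n))

variable {W : Type} [TopologicalSpace W]

/-- The continuous map `Δⁿ → W` underlying a singular simplex. -/
def Simp.toMap {n : ℕ} (s : Simp W n) : C(stdSimplex ℝ (Fin (n + 1)), W) :=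
  TopCat.toSSetObjEquiv (TopCat.of W) (.op (SimplexCategory.mk n)) s

lemma Simp.toMap_δ {n : ℕ} (s : Simp W (n + 1)) (i : Fin (n + 2)) :
    Simp.toMap ((singularSet W).δ i s) =
      (Simp.toMap s).comp ⟨_, stdSimplex.continuous_map i.succAbove⟩ := by
  rfl

instance (n : ℕ) : SimplyConnectedSpace (stdSimplex ℝ (Fin (n + 1))) := by
  have := (convex_stdSimplex ℝ (Fin (n + 1))).contractibleSpace ⟨_, single_mem_stdSimplex ℝ 0⟩
  infer_instance

/-- A chosen path class from the base point `x₀` to a point `y`. -/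
def tail [PathConnectedSpace W] (x₀ y : W) :
    FundamentalGroupoid.mk x₀ ⟶ FundamentalGroupoid.mk y :=
  FundamentalGroupoid.fromPath (Path.Homotopic.Quotient.mk (PathConnectedSpace.somePath x₀ y))

/-- The homotopy class of paths from `a` to `b` in the simplex `Δⁿ` (any two such paths are
homotopic). -/
def simplexPath {n : ℕ} (a b : stdSimplex ℝ (Fin (n + 1))) :
    FundamentalGroupoid.mk a ⟶ FundamentalGroupoid.mk b :=
  FundamentalGroupoid.fromPath (Path.Homotopic.Quotient.mk (PathConnectedSpace.somePath a b))

/-- The image under `f : Δⁿ → W` of the path class from `a` to `b` in `Δⁿ`. -/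
def imagePath {n : ℕ} (f : C(stdSimplex ℝ (Fin (n + 1)), W)) (a b : stdSimplex ℝ (Fin (n + 1))) :
    FundamentalGroupoid.mk (f a) ⟶ FundamentalGroupoid.mk (f b) :=
  (FundamentalGroupoid.map f).map (simplexPath a b)

lemma imagePath_trans {n : ℕ} (f : C(stdSimplex ℝ (Fin (n + 1)), W))
    (a b c : stdSimplex ℝ (Fin (n + 1))) :
    imagePath f a b ≫ imagePath f b c = imagePath f a c := by
  have h : simplexPath a c = simplexPath a b ≫ simplexPath b c :=
    Subsingleton.elim (α := Path.Homotopic.Quotient a c) _ _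
  rw [imagePath, imagePath, imagePath, h]
  exact ((FundamentalGroupoid.map f).map_comp _ _).symm

lemma imagePath_comp {m n : ℕ} (f : C(stdSimplex ℝ (Fin (n + 1)), W))
    (g : C(stdSimplex ℝ (Fin (m + 1)), stdSimplex ℝ (Fin (n + 1))))
    (a b : stdSimplex ℝ (Fin (m + 1))) :
    imagePath (f.comp g) a b = imagePath f (g a) (g b) := by
  have h : simplexPath (g a) (g b) = (FundamentalGroupoid.map g).map (simplexPath a b) :=
    Subsingleton.elim (α := Path.Homotopic.Quotient (g a) (g b)) _ _
  rw [imagePath, imagePath, h]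
  rfl

/-- For a map `f : Δⁿ → W` and points `a, b ∈ Δⁿ`, the class in `π₁(W, x₀)` of the loop that
runs from `x₀` to `f b` along the chosen path, then to `f a` inside the simplex, and then back to
`x₀`. In `FundamentalGroup`, the product `x * y` stands for `y` followed by `x`; with the direction
from `b` to `a`, one has `loop a b * loop b c = loop a c`. -/
def loop [PathConnectedSpace W] (x₀ : W) {n : ℕ} (f : C(stdSimplex ℝ (Fin (n + 1)), W))
    (a b : stdSimplex ℝ (Fin (n + 1))) : FundamentalGroup W x₀ :=
  tail x₀ (f b) ≫ imagePath f b a ≫ Groupoid.inv (tail x₀ (f a))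

lemma loop_mul [PathConnectedSpace W] (x₀ : W) {n : ℕ} (f : C(stdSimplex ℝ (Fin (n + 1)), W))
    (a b c : stdSimplex ℝ (Fin (n + 1))) :
    loop x₀ f a b * loop x₀ f b c = loop x₀ f a c := by
  rw [End.mul_def, loop, loop, loop, ← imagePath_trans f c b a]
  simp

lemma loop_comp [PathConnectedSpace W] (x₀ : W) {m n : ℕ}
    (f : C(stdSimplex ℝ (Fin (n + 1)), W))
    (g : C(stdSimplex ℝ (Fin (m + 1)), stdSimplex ℝ (Fin (n + 1))))
    (a b : stdSimplex ℝ (Fin (m + 1))) :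
    loop x₀ (f.comp g) a b = loop x₀ f (g a) (g b) := by
  rw [loop, loop, imagePath_comp]
  rfl

/-- The element of `π₁(W, x₀)` given by the edge between the `i`-th and the `j`-th vertex of a
singular simplex. -/
def Simp.loop [PathConnectedSpace W] (x₀ : W) {n : ℕ} (s : Simp W n) (i j : Fin (n + 1)) :
    FundamentalGroup W x₀ :=
  SurfaceLifts.loop x₀ s.toMap (stdSimplex.vertex i) (stdSimplex.vertex j)

lemma Simp.loop_δ [PathConnectedSpace W] (x₀ : W) {n : ℕ} (s : Simp W (n + 1)) (k : Fin (n + 2))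
    (i j : Fin (n + 1)) :
    Simp.loop x₀ ((singularSet W).δ k s) i j =
      s.loop x₀ (k.succAbove i) (k.succAbove j) := by
  rw [Simp.loop, Simp.toMap_δ, loop_comp, Simp.loop]
  simp only [ContinuousMap.coe_mk, stdSimplex.map_vertex]

lemma Simp.loop_mul [PathConnectedSpace W] (x₀ : W) {n : ℕ} (s : Simp W n)
    (i j k : Fin (n + 1)) : s.loop x₀ i j * s.loop x₀ j k = s.loop x₀ i k :=
  SurfaceLifts.loop_mul x₀ s.toMap _ _ _

/-- The homomorphism `Cₙ(W) → ℂ*` (with `ℂ*` written additively) determined by its values on the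
singular simplices. -/
def cochain {n : ℕ} (φ : Simp W n → Additive ℂˣ) :
    (singularChains W).X n ⟶ ModuleCat.of ℤ (Additive ℂˣ) :=
  Sigma.desc (f := fun _ : Simp W n => ModuleCat.of ℤ ℤ)
    fun s => ModuleCat.ofHom (LinearMap.toSpanSingleton ℤ (Additive ℂˣ) (φ s))

lemma ι_cochain {n : ℕ} (φ : Simp W n → Additive ℂˣ) (s : Simp W n) :
    (singularSet W).ιChainComplex (R := ModuleCat.of ℤ ℤ) s ≫ cochain φ =
      ModuleCat.ofHom (LinearMap.toSpanSingleton ℤ (Additive ℂˣ) (φ s)) :=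
  Sigma.ι_desc _ _

lemma cochain_ext {n : ℕ} {A : ModuleCat.{0} ℤ} {f g : (singularChains W).X n ⟶ A}
    (h : ∀ s : Simp W n,
      (singularSet W).ιChainComplex (R := ModuleCat.of ℤ ℤ) s ≫ f =
      (singularSet W).ιChainComplex (R := ModuleCat.of ℤ ℤ) s ≫ g) : f = g :=
  SSet.chainComplex_hom_ext (X := singularSet W) (R := ModuleCat.of ℤ ℤ) h

/-- The coboundary of a singular cochain. -/
lemma d_cochain {n : ℕ} (φ : Simp W n → Additive ℂˣ) :
    (singularChains W).d (n + 1) n ≫ cochain φ = cochain fun s : Simp W (n + 1) =>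
      ∑ i : Fin (n + 2), (-1 : ℤ) ^ (i : ℕ) • φ ((singularSet W).δ i s) := by
  refine cochain_ext fun s => ?_
  rw [ι_cochain]
  rw [SSet.ιChainComplex_d_assoc, Preadditive.sum_comp]
  simp only [Preadditive.zsmul_comp, ι_cochain]
  ext
  simp [ModuleCat.hom_sum]

/-- The singular cochain of `W` that is the pull-back of a 2-cocycle of `π₁(W, x₀)`: its value on
a singular 2-simplex is the value of the cocycle on the elements of `π₁(W, x₀)` given by the edges
`01` and `12`. This realizes the canonical map `H₂(W) → H₂(π₁(W))`. -/
def pullCochain [PathConnectedSpace W] (x₀ : W) (c : Z2 (FundamentalGroup W x₀)) :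
    (singularChains W).X 2 ⟶ ModuleCat.of ℤ (Additive ℂˣ) :=
  cochain fun s => Additive.ofMul (c.1 (s.loop x₀ 0 1, s.loop x₀ 1 2))

lemma d_pullCochain [PathConnectedSpace W] (x₀ : W) (c : Z2 (FundamentalGroup W x₀)) :
    (singularChains W).d 3 2 ≫ pullCochain x₀ c = 0 := by
  rw [pullCochain, d_cochain]
  refine cochain_ext fun s => ?_
  rw [ι_cochain, comp_zero]
  have h := congrArg Additive.ofMul (c.2 (s.loop x₀ 0 1) (s.loop x₀ 1 2) (s.loop x₀ 2 3))
  rw [Simp.loop_mul, Simp.loop_mul, ofMul_mul, ofMul_mul] at h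
  have h0 : ∑ i : Fin 4, (-1 : ℤ) ^ (i : ℕ) • Additive.ofMul
      (c.1 (Simp.loop x₀ ((singularSet W).δ i s) 0 1,
        Simp.loop x₀ ((singularSet W).δ i s) 1 2)) = 0 := by
    simp only [Simp.loop_δ]
    rw [Fin.sum_univ_four]
    change (-1 : ℤ) ^ 0 • Additive.ofMul (c.1 (s.loop x₀ 1 2, s.loop x₀ 2 3)) +
      (-1 : ℤ) ^ 1 • Additive.ofMul (c.1 (s.loop x₀ 0 2, s.loop x₀ 2 3)) +
      (-1 : ℤ) ^ 2 • Additive.ofMul (c.1 (s.loop x₀ 0 1, s.loop x₀ 1 3)) +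
      (-1 : ℤ) ^ 3 • Additive.ofMul (c.1 (s.loop x₀ 0 1, s.loop x₀ 1 2)) = 0
    generalize Additive.ofMul (c.1 (s.loop x₀ 1 2, s.loop x₀ 2 3)) = A at *
    generalize Additive.ofMul (c.1 (s.loop x₀ 0 2, s.loop x₀ 2 3)) = B at *
    generalize Additive.ofMul (c.1 (s.loop x₀ 0 1, s.loop x₀ 1 3)) = C at *
    generalize Additive.ofMul (c.1 (s.loop x₀ 0 1, s.loop x₀ 1 2)) = D at *
    have e : (-1 : ℤ) ^ 0 • A + (-1 : ℤ) ^ 1 • B + (-1 : ℤ) ^ 2 • C + (-1 : ℤ) ^ 3 • D =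
        (A + C) - (B + D) := by
      norm_num
      abel
    rw [e, h, sub_self]
  rw [h0, LinearMap.toSpanSingleton_zero]
  rfl

lemma pullCochain_cobound [PathConnectedSpace W] (x₀ : W) (c : Z2 (FundamentalGroup W x₀))
    (x : FundamentalGroup W x₀ → ℂˣ) (hx : cobound _ x = c.1) :
    pullCochain x₀ c = (singularChains W).d 2 1 ≫
      cochain fun s => Additive.ofMul (x (s.loop x₀ 0 1)) := by
  rw [pullCochain, d_cochain]
  congr 1
  funext s
  simp only [Simp.loop_δ, ← hx]
  rw [Fin.sum_univ_three]
  change Additive.ofMul (x (s.loop x₀ 1 2) * (x (s.loop x₀ 0 1 * s.loop x₀ 1 2))⁻¹ *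
      x (s.loop x₀ 0 1)) = (-1 : ℤ) ^ 0 • Additive.ofMul (x (s.loop x₀ 1 2)) +
      (-1 : ℤ) ^ 1 • Additive.ofMul (x (s.loop x₀ 0 2)) +
      (-1 : ℤ) ^ 2 • Additive.ofMul (x (s.loop x₀ 0 1))
  rw [Simp.loop_mul, ofMul_mul, ofMul_mul, ofMul_inv]
  norm_num

/-- The homomorphism `H₂(W) → ℂ*` given by evaluating a 2-cocycle of `π₁(W, x₀)`. -/
def evalCocycle [PathConnectedSpace W] (x₀ : W) (c : Z2 (FundamentalGroup W x₀)) :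
    singularH2 W ⟶ ModuleCat.of ℤ (Additive ℂˣ) :=
  (singularChains W).homologyι 2 ≫
    (singularChains W).descOpcycles (pullCochain x₀ c) 3 (by simp) (d_pullCochain x₀ c)

lemma evalCocycle_mul [PathConnectedSpace W] (x₀ : W) (c c' : Z2 (FundamentalGroup W x₀)) :
    evalCocycle x₀ (c * c') = evalCocycle x₀ c + evalCocycle x₀ c' := by
  have h : pullCochain x₀ (c * c') = pullCochain x₀ c + pullCochain x₀ c' := by
    refine cochain_ext fun s => ?_
    rw [Preadditive.comp_add]
    simp only [pullCochain, ι_cochain]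
    ext
    simp
  rw [evalCocycle, evalCocycle, evalCocycle, ← Preadditive.comp_add]
  congr 1
  rw [← cancel_epi ((singularChains W).pOpcycles 2)]
  simp [h]

lemma evalCocycle_cobound [PathConnectedSpace W] (x₀ : W) (c : Z2 (FundamentalGroup W x₀))
    (x : FundamentalGroup W x₀ → ℂˣ) (hx : cobound _ x = c.1) : evalCocycle x₀ c = 0 := by
  have h : (singularChains W).descOpcycles (pullCochain x₀ c) 3 (by simp) (d_pullCochain x₀ c) =
      (singularChains W).fromOpcycles 2 1 ≫
        cochain fun s => Additive.ofMul (x (s.loop x₀ 0 1)) := by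
    rw [← cancel_epi ((singularChains W).pOpcycles 2)]
    simp [pullCochain_cobound x₀ c x hx]
  rw [evalCocycle, h]
  simp

/-- The evaluation `c ↦ c(w) ∈ ℂ*` of cohomology classes `c ∈ H²(π₁(W, x₀); ℂ*)` on a homology
class `w ∈ H₂(W)`. -/
def evaluate [PathConnectedSpace W] (x₀ : W) (w : singularH2 W) :
    H2 (FundamentalGroup W x₀) →* ℂˣ :=
  QuotientGroup.lift _
    { toFun := fun c => Additive.toMul (α := ℂˣ) ((evalCocycle x₀ c).hom w)
      map_one' := by
        rw [evalCocycle_cobound x₀ 1 1 (map_one _)]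
        rfl
      map_mul' := fun c c' => by
        rw [evalCocycle_mul]
        rfl }
    (by
      rintro c ⟨x, hx⟩
      change Additive.toMul (α := ℂˣ) ((evalCocycle x₀ c).hom w) = 1
      rw [evalCocycle_cobound x₀ c x hx]
      rfl)

end Evaluation

/-! ### Closed oriented surfaces of genus `d ≥ 1` -/

section Surfaces

/-- The point `exp(2πi t / 4d)` of the boundary of the closed unit disk, which is regarded as a
polygon with `4d` sides, the `k`-th side being given by `k ≤ t ≤ k + 1`. -/
def boundaryPoint (d : ℕ) (t : ℝ) : Metric.closedBall (0 : ℂ) 1 :=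
  ⟨Complex.exp ((2 * Real.pi * t / (4 * d) : ℝ) * Complex.I), by
    rw [mem_closedBall_zero_iff, Complex.norm_exp_ofReal_mul_I]⟩

/-- The gluing of the sides of the polygon with `4d` sides according to the word
`a₁ b₁ a₁⁻¹ b₁⁻¹ ⋯ a_d b_d a_d⁻¹ b_d⁻¹`: for each `k < d` the side `4k` is glued to the side
`4k + 2`, and the side `4k + 1` to the side `4k + 3`, in both cases with reversed direction. -/
inductive Gluing (d : ℕ) : Metric.closedBall (0 : ℂ) 1 → Metric.closedBall (0 : ℂ) 1 → Prop
  | sideA (k : ℕ) (hk : k < d) (s : ℝ) (hs : s ∈ Set.Icc (0 : ℝ) 1) :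
      Gluing d (boundaryPoint d (4 * k + s)) (boundaryPoint d (4 * k + 3 - s))
  | sideB (k : ℕ) (hk : k < d) (s : ℝ) (hs : s ∈ Set.Icc (0 : ℝ) 1) :
      Gluing d (boundaryPoint d (4 * k + 1 + s)) (boundaryPoint d (4 * k + 4 - s))

/-- The standard closed orientable surface of genus `d ≥ 1`: the polygon with `4d` sides with its
sides glued in pairs, with the quotient topology. -/
def StandardSurface (d : ℕ) : Type := Quot (Gluing d)

instance (d : ℕ) : TopologicalSpace (StandardSurface d) :=
  inferInstanceAs (TopologicalSpace (Quot (Gluing d)))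

/-- `W` is a closed connected orientable surface of genus `d` (for `d ≥ 1`). -/
def IsClosedSurfaceOfGenus (W : Type) [TopologicalSpace W] (d : ℕ) : Prop :=
  Nonempty (W ≃ₜ StandardSurface d)

/-- An orientation of a closed connected orientable surface `W`, given by its fundamental class:
a generator `[W]` of the group `H₂(W) ≅ ℤ`. -/
def IsFundamentalClass (W : Type) [TopologicalSpace W] (w : singularH2 W) : Prop :=
  ∀ c : singularH2 W, ∃ m : ℤ, c = m • w

end Surfaces

/-- The set `Hom_g(π, G')` of lifts of `g : π → G` to `G'`, i.e. of homomorphisms `g' : π → G'`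
with `q g' = g`. -/
def Lifts {G : Type u} {G' : Type v} {P : Type*} [Group G] [Group G'] [Group P]
    (q : G' →* G) (g : P →* G) : Set (P →* G') :=
  {g' | q.comp g' = g}

end

end SurfaceLifts

namespace SurfaceLifts

noncomputable section

universe u v

/-! ### Loops from paths in simply connected spaces -/

section PathLoop

/-! Cut `W` open into a polygon with `4d` sides. Its fundamental group `π` is generated by the sides
`a_k, b_k` with the single relation that the product of the commutators of `a_k` and `b_k` is `1`.
Choose lifts `α_k, β_k` of the images of the sides under `g`. A lift of `g` is then a choice of
`h_k, l_k ∈ Γ` for which the commutators of `h_k α_k` and `l_k β_k` multiply to `1`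
(`IsPolar.exists_equiv_lifts`). Detecting `1 ∈ Γ` by the regular character, a positive combination
of irreducible characters, gives `|Γ| · |Hom_g| = ∑ m_i S_i`, where `S_i` is the sum of the `i`-th
irreducible character over all these products (`card_word_eq_one`, `surfaceSum`).

Each `S_i` is computed by Schur's lemma. If some `α_k` or `β_k` lies outside the stabilizer of
`ρ_i`, then `S_i = 0` (`IsIrreducible.mem_stabilizer_of_surfaceSum_ne_zero`). Otherwise matrices of
intertwiners replace the lifts, and the identity `IsIrreducible.sum_commutator` gives `S_i = z⁻¹ ·
m_i (|Γ|/m_i)^(2d)`, where the scalar `z` of modulus `1` is the value of the surface relation in the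
central extension of the stabilizer by `ℂ*` (`IsIrreducible.exists_surfaceSum_eq`). For trivial `g`
one has `z = 1`. Hence `|S_i|` is at most its value for the trivial homomorphism, which is the
inequality, and equality of the totals forces equality in every term.

It remains to identify `z = 1` with the vanishing of the cocycle on the fundamental class
(`IsPolar.evaluate_eq_one_iff`). An explicit cycle on the polygon evaluates to the surface relation
in the extension, and its class is a multiple of the fundamental class. Conversely, if the relation
holds, the presentation of `π` yields a homomorphism to the extension, the cocycle is a coboundary,
and it vanishes on every class. So it is never needed that the polygon generates `H₂`.

The presentation is proved by hand: generation by deforming paths onto the polygon, and existence of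
homomorphisms by constructing a covering with prescribed holonomy and taking its monodromy. -/

instance : ContractibleSpace unitInterval :=
  (convex_Icc (0 : ℝ) 1).contractibleSpace ⟨0, by simp⟩

variable {W : Type} [TopologicalSpace W]

/-- A family of path classes from the base point to all points. -/
abbrev Tails (x₀ : W) : Type :=
  ∀ y : W, FundamentalGroupoid.mk x₀ ⟶ FundamentalGroupoid.mk y


/-- The loop class obtained from an arrow of the fundamental groupoid by adding the chosen paths
from the base point to its ends. -/
def closeArrow {x₀ : W} (τ : Tails x₀) {x y : W} (γ : FundamentalGroupoid.mk x ⟶ FundamentalGroupoid.mk y) :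
    FundamentalGroup W x₀ :=
  τ x ≫ γ ≫ Groupoid.inv (τ y)

lemma closeArrow_mul {x₀ : W} (τ : Tails x₀) {x y z : W}
    (γ : FundamentalGroupoid.mk x ⟶ FundamentalGroupoid.mk y)
    (γ' : FundamentalGroupoid.mk y ⟶ FundamentalGroupoid.mk z) :
    closeArrow τ γ' * closeArrow τ γ = closeArrow τ (γ ≫ γ') := by
  rw [End.mul_def, closeArrow, closeArrow, closeArrow]
  simp

/-- The only arrow between two points of a simply connected space. -/
def uniqueArrow {Y : Type*} [TopologicalSpace Y] [SimplyConnectedSpace Y] (a b : Y) :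
    FundamentalGroupoid.mk a ⟶ FundamentalGroupoid.mk b :=
  FundamentalGroupoid.fromPath (Path.Homotopic.Quotient.mk (PathConnectedSpace.somePath a b))

lemma arrow_eq_uniqueArrow {Y : Type*} [TopologicalSpace Y] [SimplyConnectedSpace Y] {a b : Y}
    (γ : FundamentalGroupoid.mk a ⟶ FundamentalGroupoid.mk b) : γ = uniqueArrow a b :=
  Subsingleton.elim (α := Path.Homotopic.Quotient a b) _ _

/-- The image under `f` of the only arrow between two points of a simply connected space. -/
def imageArrow {Y : Type*} [TopologicalSpace Y] [SimplyConnectedSpace Y] (f : C(Y, W)) (a b : Y) :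
    FundamentalGroupoid.mk (f a) ⟶ FundamentalGroupoid.mk (f b) :=
  (FundamentalGroupoid.map f).map (uniqueArrow a b)

/-- For `f : Y → W` with `Y` simply connected, the loop class in `W` obtained from the image of the
path class from `b` to `a`. -/
def pathLoop {x₀ : W} (τ : Tails x₀) {Y : Type*} [TopologicalSpace Y] [SimplyConnectedSpace Y] (f : C(Y, W))
    (a b : Y) : FundamentalGroup W x₀ :=
  closeArrow τ (imageArrow f b a)

lemma loop_eq_pathLoop [PathConnectedSpace W] (x₀ : W) {n : ℕ} (f : C(stdSimplex ℝ (Fin (n + 1)), W))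
    (a b : stdSimplex ℝ (Fin (n + 1))) : loop x₀ f a b = pathLoop (tail x₀) f a b := rfl

variable {Y Z : Type*} [TopologicalSpace Y] [SimplyConnectedSpace Y]
  [TopologicalSpace Z] [SimplyConnectedSpace Z]

lemma pathLoop_mul {x₀ : W} (τ : Tails x₀) (f : C(Y, W)) (a b c : Y) :
    pathLoop τ f a b * pathLoop τ f b c = pathLoop τ f a c := by
  have h : imageArrow f c b ≫ imageArrow f b a = imageArrow f c a := by
    rw [imageArrow, imageArrow, imageArrow,
      ← arrow_eq_uniqueArrow (uniqueArrow c b ≫ uniqueArrow b a)]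
    exact ((FundamentalGroupoid.map f).map_comp _ _).symm
  rw [pathLoop, pathLoop, closeArrow_mul, h, pathLoop]

@[simp] lemma pathLoop_self {x₀ : W} (τ : Tails x₀) (f : C(Y, W)) (a : Y) : pathLoop τ f a a = 1 := by
  have := pathLoop_mul τ f a a a
  exact mul_eq_left.mp this

lemma pathLoop_inv {x₀ : W} (τ : Tails x₀) (f : C(Y, W)) (a b : Y) :
    (pathLoop τ f a b)⁻¹ = pathLoop τ f b a := by
  rw [inv_eq_iff_mul_eq_one, pathLoop_mul, pathLoop_self]

lemma pathLoop_comp {x₀ : W} (τ : Tails x₀) (f : C(Y, W)) (g : C(Z, Y)) (a b : Z) :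
    pathLoop τ (f.comp g) a b = pathLoop τ f (g a) (g b) := by
  have h : uniqueArrow (g b) (g a) = (FundamentalGroupoid.map g).map (uniqueArrow b a) :=
    (arrow_eq_uniqueArrow _).symm
  rw [pathLoop, pathLoop, imageArrow, imageArrow, h]
  rfl

/-- This is how gluings enter: two paths of the strip that become the same path in the surface have
the same class. -/
lemma pathLoop_eq_of_comp_eq {x₀ : W} (τ : Tails x₀) (f : C(Y, W)) {g h : C(Z, Y)} (e : f.comp g = f.comp h)
    (a b : Z) : pathLoop τ f (g a) (g b) = pathLoop τ f (h a) (h b) := by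
  rw [← pathLoop_comp, e, pathLoop_comp]

/-- Two homotopic ways around a square. -/
lemma pathLoop_mem_of_square {x₀ : W} (τ : Tails x₀) (S : Subgroup (FundamentalGroup W x₀))
    (F : C(unitInterval × unitInterval, W))
    (h0 : pathLoop τ F (0, 0) (0, 1) ∈ S) (h1 : pathLoop τ F (1, 0) (1, 1) ∈ S)
    (h : pathLoop τ F (0, 1) (1, 1) ∈ S) : pathLoop τ F (0, 0) (1, 0) ∈ S := by
  rw [← pathLoop_mul τ F _ (0, 1), ← pathLoop_mul τ F (0, 1) (1, 1) (1, 0),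
    ← pathLoop_inv τ F (1, 0) (1, 1)]
  exact S.mul_mem h0 (S.mul_mem h (S.inv_mem h1))

/-- A subgroup of the fundamental group that contains the classes of all paths is everything. -/
lemma eq_top_of_pathLoop_mem {x₀ : W} (τ : Tails x₀) (S : Subgroup (FundamentalGroup W x₀))
    (hS : ∀ f : C(unitInterval, W), pathLoop τ f 0 1 ∈ S) : S = ⊤ := by
  have key : ∀ γ : FundamentalGroup W x₀, closeArrow τ γ ∈ S := by
    intro γ
    obtain ⟨p, hp⟩ := Quotient.exists_rep (γ : Path.Homotopic.Quotient x₀ x₀)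
    have h := hS p.toContinuousMap
    rw [← inv_mem_iff, pathLoop_inv] at h
    -- The ends of the map underlying `p` equal `x₀` only up to a proof, so the end points are
    -- generalized before the equalities are eliminated.
    have e : ∀ x y : W, ∀ hx : x = x₀, ∀ hy : y = x₀, ∀ q : Path x y,
        q = p.cast hx hy →
        closeArrow τ (FundamentalGroupoid.fromPath (Path.Homotopic.Quotient.mk q)) =
          closeArrow τ γ := by
      rintro x y rfl rfl q rfl
      rw [← hp]
      rfl
    convert h
    rw [pathLoop, imageArrow, ← arrow_eq_uniqueArrow (FundamentalGroupoid.fromPath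
      (Path.Homotopic.Quotient.mk
        (⟨ContinuousMap.id _, rfl, rfl⟩ : Path (0 : unitInterval) 1)))]
    exact (e _ _ p.source p.target ((⟨ContinuousMap.id _, rfl, rfl⟩ :
      Path (0 : unitInterval) 1).map p.continuous) (by ext; rfl)).symm
  rw [eq_top_iff]
  intro g _
  -- Closing up adds `τ x₀` at both ends, since it need not be the constant path; conjugating
  -- beforehand cancels it.
  have h := key (Groupoid.inv (τ x₀) ≫ g ≫ τ x₀)
  simpa [closeArrow] using h

/-- Changing the paths from the base point by a family of loops. -/
def Tails.twist {x₀ : W} (τ : Tails x₀) (c : W → FundamentalGroup W x₀) : Tails x₀ :=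
  fun y => Groupoid.inv (c y) ≫ τ y

/-- A gauge transformation. A suitable `c` moves all classes of paths of the strip into a given
subgroup. -/
lemma pathLoop_twist {x₀ : W} (τ : Tails x₀) (c : W → FundamentalGroup W x₀) (f : C(Y, W))
    (a b : Y) : pathLoop (τ.twist c) f a b = c (f a) * pathLoop τ f a b * (c (f b))⁻¹ := by
  have h : (c (f b))⁻¹ = Groupoid.inv (c (f b)) := rfl
  rw [End.mul_def, End.mul_def, pathLoop, pathLoop, closeArrow, closeArrow, Tails.twist,
    Tails.twist, h]
  simp only [Groupoid.inv_eq_inv, IsIso.inv_comp, IsIso.inv_inv, Category.assoc]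

end PathLoop

/-! ### Polar coordinates on a surface -/

section Polar

/-- The strip of polar coordinates `(r, t)`; the angle is `2πt / 4d`. -/
abbrev Strip : Type := unitInterval × ℝ

/-- The identifications of polar coordinates in the standard surface of genus `d`. -/
inductive PolarRel (d : ℕ) : Strip → Strip → Prop
  | center (t t' : ℝ) : PolarRel d (0, t) (0, t')
  | turn (r : unitInterval) (t : ℝ) (n : ℤ) : PolarRel d (r, t) (r, t + n * (4 * d))
  | sideA (k : ℤ) (s : ℝ) (hs : s ∈ Set.Icc (0 : ℝ) 1) :
      PolarRel d (1, 4 * k + s) (1, 4 * k + 3 - s)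
  | sideB (k : ℤ) (s : ℝ) (hs : s ∈ Set.Icc (0 : ℝ) 1) :
      PolarRel d (1, 4 * k + 1 + s) (1, 4 * k + 4 - s)

/-- The point of the unit disk with given polar coordinates. -/
def diskPoint (d : ℕ) (x : Strip) : Metric.closedBall (0 : ℂ) 1 :=
  ⟨(x.1 : ℝ) * Complex.exp ((2 * Real.pi * x.2 / (4 * d) : ℝ) * Complex.I), by
    rw [mem_closedBall_zero_iff, norm_mul, Complex.norm_exp_ofReal_mul_I, mul_one,
      Complex.norm_real, Real.norm_of_nonneg x.1.2.1]
    exact x.1.2.2⟩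

lemma diskPoint_one (d : ℕ) (t : ℝ) : diskPoint d (1, t) = boundaryPoint d t :=
  Subtype.ext (by simp [diskPoint, boundaryPoint])

lemma continuous_diskPoint (d : ℕ) : Continuous (diskPoint d) := by
  refine Continuous.subtype_mk ?_ _
  fun_prop

variable {d : ℕ}

lemma exists_diskPoint_eq (hd : 1 ≤ d) (z : Metric.closedBall (0 : ℂ) 1) :
    ∃ x : unitInterval × Set.Icc (0 : ℝ) (4 * d), diskPoint d (x.1, x.2) = z := by
  have hd0 : (0 : ℝ) < 4 * d := by positivity
  have hz := mem_closedBall_zero_iff.mp z.2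
  have hpi := Real.pi_pos
  have hp : 0 < 2 * Real.pi := by positivity
  obtain ⟨θ, hθ, hzθ⟩ : ∃ θ ∈ Set.Icc (0 : ℝ) (2 * Real.pi),
      (‖(z : ℂ)‖ : ℂ) * Complex.exp (θ * Complex.I) = z := by
    refine ⟨toIcoMod hp 0 (Complex.arg z), ?_, ?_⟩
    · have := toIcoMod_mem_Ico hp 0 (Complex.arg z)
      exact ⟨this.1, by linarith [this.2]⟩
    · rw [toIcoMod]
      conv_rhs => rw [← Complex.norm_mul_exp_arg_mul_I (z : ℂ)]
      congr 1
      rw [Complex.exp_eq_exp_iff_exists_int]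
      refine ⟨-toIcoDiv hp 0 (Complex.arg z), ?_⟩
      push_cast [zsmul_eq_mul]
      ring
  refine ⟨(⟨‖(z : ℂ)‖, norm_nonneg _, hz⟩, ⟨4 * d * (θ / (2 * Real.pi)), ?_, ?_⟩), ?_⟩
  · have := hθ.1
    positivity
  · have : θ / (2 * Real.pi) ≤ 1 := (div_le_one hp).mpr hθ.2
    nlinarith
  · refine Subtype.ext ?_
    rw [diskPoint]
    dsimp only
    rw [← hzθ, hzθ]
    conv_rhs => rw [← hzθ]
    congr 3
    norm_cast
    field_simp

/-- Over one full turn the parameter space is compact, so the surjection onto the Hausdorff disk is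
closed and hence a quotient map; the whole strip inherits this. -/
lemma isQuotientMap_diskPoint (hd : 1 ≤ d) : Topology.IsQuotientMap (diskPoint d) := by
  let j : unitInterval × Set.Icc (0 : ℝ) (4 * d) → Strip := fun x => (x.1, x.2)
  have hj : Continuous j := by fun_prop
  have hc := (continuous_diskPoint d).comp hj
  have : Topology.IsQuotientMap (diskPoint d ∘ j) :=
    hc.isClosedMap.isQuotientMap hc (exists_diskPoint_eq hd)
  exact this.of_comp hj (continuous_diskPoint d)

lemma polarRel_of_diskPoint_eq (hd : 1 ≤ d) {x y : Strip} (h : diskPoint d x = diskPoint d y) :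
    Relation.EqvGen (PolarRel d) x y := by
  obtain ⟨r, t⟩ := x
  obtain ⟨r', t'⟩ := y
  have hd0 : (d : ℝ) ≠ 0 := by positivity
  have h' := congrArg Subtype.val h
  simp only [diskPoint] at h'
  have hr : r = r' := by
    have := congrArg norm h'
    rw [norm_mul, norm_mul, Complex.norm_exp_ofReal_mul_I, Complex.norm_exp_ofReal_mul_I,
      Complex.norm_real, Complex.norm_real, Real.norm_of_nonneg r.2.1,
      Real.norm_of_nonneg r'.2.1, mul_one, mul_one] at this
    exact Subtype.ext this
  subst hr
  by_cases h0 : r = 0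
  · subst h0
    exact .rel _ _ (.center _ _)
  · have hr0 : ((r : ℝ) : ℂ) ≠ 0 := by
      norm_cast
      exact fun h => h0 (Subtype.ext h)
    obtain ⟨n, hn⟩ := Complex.exp_eq_exp_iff_exists_int.mp (mul_left_cancel₀ hr0 h')
    have e : t = t' + n * (4 * d) := by
      have hI : (((2 * Real.pi * t / (4 * d) : ℝ) : ℂ)) * Complex.I =
          ((2 * Real.pi * t' / (4 * d) + n * (2 * Real.pi) : ℝ) : ℂ) * Complex.I := by
        rw [hn]; push_cast; ring
      have := Complex.ofReal_injective (mul_right_cancel₀ Complex.I_ne_zero hI)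
      have hpi := Real.pi_ne_zero
      field_simp at this
      linarith
    rw [e]
    exact .symm _ _ (.rel _ _ (.turn _ _ _))

lemma diskPoint_eq_of_turn (hd : 1 ≤ d) (r : unitInterval) (t : ℝ) (n : ℤ) :
    diskPoint d (r, t) = diskPoint d (r, t + n * (4 * d)) := by
  have hd0 : (d : ℂ) ≠ 0 := by norm_cast; omega
  refine Subtype.ext ?_
  simp only [diskPoint]
  congr 1
  rw [Complex.exp_eq_exp_iff_exists_int]
  refine ⟨-n, ?_⟩
  push_cast
  field_simp
  ring

/-- The point of the standard surface with given polar coordinates. -/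
def polar (d : ℕ) : C(Strip, StandardSurface d) :=
  ⟨fun x => Quot.mk _ (diskPoint d x), continuous_quot_mk.comp (continuous_diskPoint d)⟩

lemma isQuotientMap_polar (hd : 1 ≤ d) : Topology.IsQuotientMap (polar d) :=
  (isQuotientMap_quot_mk (r := Gluing d)).comp (isQuotientMap_diskPoint hd)

lemma polar_eq_of_rel (hd : 1 ≤ d) {x y : Strip} (h : PolarRel d x y) :
    polar d x = polar d y := by
  have turn : ∀ (t : ℝ) (n : ℤ), polar d (1, t) = polar d (1, t + n * (4 * d)) := fun t n =>
    congrArg (Quot.mk _) (diskPoint_eq_of_turn hd 1 t n)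
  -- Sides of the strip are numbered by all integers, sides of the polygon only by `k < d`; full
  -- turns bridge the gap.
  have norm : ∀ k : ℤ, ∃ (m : ℕ) (n : ℤ), m < d ∧ (m : ℝ) = k + n * d := by
    intro k
    have hd' : (0 : ℤ) < d := by omega
    refine ⟨(k % d).toNat, -(k / d), ?_, ?_⟩
    · have := Int.emod_lt_of_pos k hd'
      have := Int.emod_nonneg k hd'.ne'
      omega
    · have h1 : (((k % d).toNat : ℕ) : ℤ) = k % d := Int.toNat_of_nonneg (Int.emod_nonneg k hd'.ne')
      have h2 : (((k % d).toNat : ℕ) : ℤ) = k + -(k / d) * d := by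
        rw [h1, Int.emod_def]; ring
      exact_mod_cast h2
  cases h with
  | center t t' => exact congrArg (Quot.mk _) (Subtype.ext (by simp [diskPoint]))
  | turn r t n => exact congrArg (Quot.mk _) (diskPoint_eq_of_turn hd r t n)
  | sideA k s hs =>
    obtain ⟨m, n, hm, e⟩ := norm k
    have := Quot.sound (Gluing.sideA m hm s hs)
    rw [← diskPoint_one, ← diskPoint_one] at this
    have e1 : 4 * k + s + n * (4 * d) = 4 * m + s := by rw [e]; ring
    have e2 : 4 * k + 3 - s + n * (4 * d) = 4 * m + 3 - s := by rw [e]; ring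
    rw [turn (4 * k + s) n, turn (4 * k + 3 - s) n, e1, e2]
    exact this
  | sideB k s hs =>
    obtain ⟨m, n, hm, e⟩ := norm k
    have := Quot.sound (Gluing.sideB m hm s hs)
    rw [← diskPoint_one, ← diskPoint_one] at this
    have e1 : 4 * k + 1 + s + n * (4 * d) = 4 * m + 1 + s := by rw [e]; ring
    have e2 : 4 * k + 4 - s + n * (4 * d) = 4 * m + 4 - s := by rw [e]; ring
    rw [turn (4 * k + 1 + s) n, turn (4 * k + 4 - s) n, e1, e2]
    exact this

lemma polarRel_of_polar_eq (hd : 1 ≤ d) {x y : Strip} (h : polar d x = polar d y) :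
    Relation.EqvGen (PolarRel d) x y := by
  have key : ∀ a b, Relation.EqvGen (Gluing d) a b → ∀ x y, diskPoint d x = a →
      diskPoint d y = b → Relation.EqvGen (PolarRel d) x y := by
    intro a b hab
    induction hab with
    | rel a b hab =>
      intro x y hx hy
      cases hab with
      | sideA k hk s hs =>
        rw [← diskPoint_one] at hx hy
        have h1 := PolarRel.sideA (d := d) k s hs
        push_cast at h1
        exact .trans _ _ _ (polarRel_of_diskPoint_eq hd hx)
          (.trans _ _ _ (.rel _ _ h1) (.symm _ _ (polarRel_of_diskPoint_eq hd hy)))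
      | sideB k hk s hs =>
        rw [← diskPoint_one] at hx hy
        have h1 := PolarRel.sideB (d := d) k s hs
        push_cast at h1
        exact .trans _ _ _ (polarRel_of_diskPoint_eq hd hx)
          (.trans _ _ _ (.rel _ _ h1) (.symm _ _ (polarRel_of_diskPoint_eq hd hy)))
    | refl a => exact fun x y hx hy => polarRel_of_diskPoint_eq hd (hx.trans hy.symm)
    | symm a b _ ih => exact fun x y hx hy => .symm _ _ (ih y x hy hx)
    | trans a b c _ _ ih ih' =>
      intro x y hx hy
      -- Transitivity passes through an intermediate point of the disk, which needs polar
      -- coordinates of its own.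
      obtain ⟨z, hz⟩ := exists_diskPoint_eq hd b
      exact .trans _ _ _ (ih x _ hx hz) (ih' _ y hz hy)
  exact key _ _ (Quot.eqvGen_exact h) x y rfl rfl

/-- A continuous map from the strip to `W` is a polar parametrization if it makes `W` the quotient
of the strip by the identifications of polar coordinates. -/
structure IsPolar {W : Type} [TopologicalSpace W] (d : ℕ) (P : C(Strip, W)) : Prop where
  isQuotientMap : Topology.IsQuotientMap P
  eq_of_rel : ∀ {x y}, PolarRel d x y → P x = P y
  rel_of_eq : ∀ {x y}, P x = P y → Relation.EqvGen (PolarRel d) x y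

lemma exists_isPolar {W : Type} [TopologicalSpace W] (hd : 1 ≤ d)
    (hW : IsClosedSurfaceOfGenus W d) : ∃ P : C(Strip, W), IsPolar d P := by
  obtain ⟨e⟩ := hW
  exact ⟨(⟨e.symm, e.symm.continuous⟩ : C(StandardSurface d, W)).comp (polar d),
    e.symm.isQuotientMap.comp (isQuotientMap_polar hd),
    fun h => congrArg e.symm (polar_eq_of_rel hd h),
    fun h => polarRel_of_polar_eq hd (e.symm.injective h)⟩

/-- Functions on the strip that respect the identifications descend along a polar
parametrization. -/
lemma IsPolar.congr {W : Type} [TopologicalSpace W] {P : C(Strip, W)} (hP : IsPolar d P)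
    {α : Sort*} (f : Strip → α) (hf : ∀ x y, PolarRel d x y → f x = f y) {x y : Strip}
    (h : P x = P y) : f x = f y := by
  have h' := hP.rel_of_eq h
  clear h
  induction h' with
  | rel x y h => exact hf x y h
  | refl => rfl
  | symm x y h ih => exact ih.symm
  | trans x y z h h' ih ih' => exact ih.trans ih'

end Polar

/-! ### Generators of the fundamental group of a surface -/

section Generation

variable {W : Type} [TopologicalSpace W] {d : ℕ} {P : C(Strip, W)}

lemma IsPolar.preimage_image (hP : IsPolar d P) {U : Set Strip}
    (hU : ∀ x y, PolarRel d x y → (x ∈ U ↔ y ∈ U)) : P ⁻¹' (P '' U) = U := by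
  refine Set.Subset.antisymm ?_ (Set.subset_preimage_image _ _)
  rintro x ⟨y, hy, h⟩
  exact (hP.congr (· ∈ U) (fun x y h => propext (hU x y h)) h).mp hy

/-- If an open subset of the strip that is compatible with the identifications has a compatible
deformation whose final map is locally constant, then paths in its image are homotopic to images
of paths of the strip. -/
lemma IsPolar.pathLoop_mem_of_deformation (hP : IsPolar d P) {x₀ : W} (τ : Tails x₀)
    {S : Subgroup (FundamentalGroup W x₀)} (hS : ∀ x y, pathLoop τ P x y ∈ S)
    {U : Set Strip} (hUo : IsOpen U) (hU : ∀ x y, PolarRel d x y → (x ∈ U ↔ y ∈ U))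
    (K : Strip → unitInterval → Strip)
    (hK : ContinuousOn (Function.uncurry K) (U ×ˢ Set.univ)) (hK0 : ∀ x, K x 0 = x)
    (hKR : ∀ x y, PolarRel d x y → x ∈ U → ∀ σ, P (K x σ) = P (K y σ))
    (hK1 : ∀ x ∈ U, ∀ᶠ y in nhds x, P (K y 1) = P (K x 1))
    (f : C(unitInterval, W)) (hf : ∀ t, f t ∈ P '' U) : pathLoop τ f 0 1 ∈ S := by
  have hPU := hP.preimage_image hU
  have hVo : IsOpen (P '' U) := by rw [← hP.isQuotientMap.isOpen_preimage, hPU]; exact hUo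
  have hq := hP.isQuotientMap.restrictPreimage_isOpen hVo
  have hmem : ∀ x : P ⁻¹' (P '' U), (x : Strip) ∈ U := fun x =>
    hPU.subset x.2
  have hc : Continuous (Function.uncurry fun (x : P ⁻¹' (P '' U)) (σ : unitInterval) =>
      P (K x σ)) := by
    refine P.continuous.comp ?_
    exact hK.comp_continuous (f := fun p : (P ⁻¹' (P '' U)) × unitInterval => ((p.1 : Strip), p.2))
      (by fun_prop) (fun p => ⟨hmem p.1, trivial⟩)
  -- Currying turns the deformation into a map to a path space, which descends along the restricted
  -- quotient map without asking whether the product with the interval is still a quotient.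
  let k : C(P ⁻¹' (P '' U), C(unitInterval, W)) :=
    ContinuousMap.curry ⟨_, hc⟩
  have hk : ∀ x σ, k x σ = P (K x σ) := fun _ _ => rfl
  have hKe : ∀ x y : Strip, x ∈ U → P x = P y → ∀ σ, P (K x σ) = P (K y σ) := by
    intro x y hx hxy σ
    have := hP.congr (fun z => z ∈ U → P (K z σ) = P (K x σ)) (fun a b hab => by
      have h1 := hU a b hab
      by_cases ha : a ∈ U
      · simp [ha, h1.mp ha, hKR a b hab ha σ]
      · simp [ha, mt h1.mpr ha]) hxy
    have hy : y ∈ U := by rw [← hPU]; exact ⟨x, hx, hxy⟩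
    exact ((this.mp fun _ => rfl) hy).symm
  let κ : C(P '' U, C(unitInterval, W)) := hq.lift (f := ⟨_, hq.continuous⟩) k (by
    intro x y hxy
    ext σ
    exact hKe x y (hmem x) (congrArg Subtype.val hxy) σ)
  have hκ : ∀ (x : Strip) (hx : x ∈ U) (σ), κ ⟨P x, x, hx, rfl⟩ σ = P (K x σ) := by
    intro x hx σ
    have := hq.lift_comp (f := ⟨_, hq.continuous⟩) k (by
      intro x y hxy
      ext σ
      exact hKe x y (hmem x) (congrArg Subtype.val hxy) σ)
    exact congrArg (fun φ : C(P ⁻¹' (P '' U), C(unitInterval, W)) => φ ⟨x, ⟨x, hx, rfl⟩⟩ σ) this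
  let F : C(unitInterval × unitInterval, W) :=
    ⟨fun p => κ ⟨f p.1, hf p.1⟩ p.2, by fun_prop⟩
  have hF : ∀ t (x : Strip), x ∈ U → P x = f t → ∀ σ, F (t, σ) = P (K x σ) := by
    intro t x hx hxt σ
    rw [← hκ x hx σ]
    simp only [hxt]
    rfl
  -- A locally constant end map is constant along the connected path `f`, so the top side of the
  -- homotopy square does not move.
  have hlc : IsLocallyConstant fun w : P '' U => κ w 1 := by
    rw [IsLocallyConstant]
    intro s
    rw [← hq.isOpen_preimage, isOpen_iff_mem_nhds]
    intro x hx
    have h1 := continuous_subtype_val.continuousAt (x := x) |>.eventually (hK1 x (hmem x))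
    have e : ∀ y : P ⁻¹' (P '' U), κ ((P '' U).restrictPreimage P y) 1 = P (K y 1) :=
      fun y => hκ y (hmem y) 1
    filter_upwards [h1] with y hy
    simp only [Set.mem_preimage, e] at hx ⊢
    rwa [hy]
  have hF1 : ∀ t, F (t, 1) = F (0, 1) := by
    intro t
    exact (hlc.comp_continuous (f := fun t : unitInterval => (⟨f t, hf t⟩ : P '' U))
      (by fun_prop)).apply_eq_of_preconnectedSpace t 0
  have hF0 : F.comp ⟨fun t => (t, 0), by fun_prop⟩ = f := by
    ext t
    obtain ⟨x, hx, hxt⟩ := hf t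
    simp only [ContinuousMap.comp_apply, ContinuousMap.coe_mk]
    rw [hF t x hx hxt, hK0, hxt]
  -- The vertical sides of the square are tracks of single points under `K`, hence images of paths
  -- of the strip.
  have side : ∀ t, pathLoop τ F (t, 0) (t, 1) ∈ S := by
    intro t
    obtain ⟨x, hx, hxt⟩ := hf t
    have hg : Continuous fun σ => K x σ := hK.comp_continuous
      (f := fun σ : unitInterval => (x, σ)) (by fun_prop) (fun σ => ⟨hx, trivial⟩)
    have e : F.comp ⟨fun σ => (t, σ), by fun_prop⟩ = P.comp ⟨fun σ => K x σ, hg⟩ := by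
      ext σ
      exact hF t x hx hxt σ
    have h1 := pathLoop_comp τ F ⟨fun σ : unitInterval => (t, σ), by fun_prop⟩ 0 1
    rw [e, pathLoop_comp] at h1
    exact h1 ▸ hS _ _
  have bottom := pathLoop_comp τ F ⟨fun t : unitInterval => (t, (0 : unitInterval)), by fun_prop⟩ 0 1
  rw [hF0] at bottom
  rw [bottom]
  refine pathLoop_mem_of_square τ S F (side 0) (side 1) ?_
  obtain ⟨x, hx, hxt⟩ := hf 0
  have e : F.comp ⟨fun t => (t, 1), by fun_prop⟩ =
      P.comp ⟨fun _ : unitInterval => K x 1, continuous_const⟩ := by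
    ext t
    exact (hF1 t).trans (hF 0 x hx hxt 1)
  have h1 := pathLoop_comp τ F ⟨fun t : unitInterval => (t, (1 : unitInterval)), by fun_prop⟩ 0 1
  rw [e, pathLoop_comp] at h1
  exact h1 ▸ hS _ _

/-- By the Lebesgue number lemma the path is a finite concatenation of paths that each stay in one
member of the cover, and `pathLoop` is multiplicative. -/
lemma pathLoop_mem_of_openCover {x₀ : W} (τ : Tails x₀)
    {S : Subgroup (FundamentalGroup W x₀)} {ι : Type*} {V : ι → Set W}
    (hV : ∀ i, IsOpen (V i)) (hcov : ∀ w, ∃ i, w ∈ V i)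
    (hS : ∀ (i : ι) (f : C(unitInterval, W)), (∀ t, f t ∈ V i) → pathLoop τ f 0 1 ∈ S)
    (f : C(unitInterval, W)) : pathLoop τ f 0 1 ∈ S := by
  obtain ⟨t, ht0, hmono, ⟨N, hN⟩, hsub⟩ :=
    exists_monotone_Icc_subset_open_cover_unitInterval (c := fun i => f ⁻¹' V i)
      (fun i => (hV i).preimage f.continuous) (fun s _ => by
        obtain ⟨i, hi⟩ := hcov (f s)
        exact Set.mem_iUnion.mpr ⟨i, hi⟩)
  have step : ∀ n, pathLoop τ f 0 (t n) ∈ S := by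
    intro n
    induction n with
    | zero => rw [ht0, pathLoop_self]; exact S.one_mem
    | succ n ih =>
      rw [← pathLoop_mul τ f 0 (t n)]
      refine S.mul_mem ih ?_
      obtain ⟨i, hi⟩ := hsub n
      -- The affine parametrization of the `n`-th piece; the clamping by `projIcc` never acts and
      -- only supplies membership in the interval.
      let g : C(unitInterval, unitInterval) :=
        ⟨fun s => Set.projIcc 0 1 zero_le_one ((t n : ℝ) + s * (t (n + 1) - t n)),
          by fun_prop⟩
      have hle : (t n : ℝ) ≤ t (n + 1) := hmono (Nat.le_succ n)
      have hmem : ∀ s : unitInterval,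
          (t n : ℝ) + s * (t (n + 1) - t n) ∈ Set.Icc (t n : ℝ) (t (n + 1)) := by
        intro s
        have h0 := s.2.1
        have h1 := s.2.2
        constructor <;> nlinarith
      have hg : ∀ s, (g s : ℝ) = (t n : ℝ) + s * (t (n + 1) - t n) := fun s => by
        have := Set.projIcc_of_mem zero_le_one (x := (t n : ℝ) + s * (t (n + 1) - t n))
          (a := (0 : ℝ)) (b := 1)
          ⟨(t n).2.1.trans (hmem s).1, (hmem s).2.trans (t (n + 1)).2.2⟩
        exact congrArg Subtype.val this
      have h1 := hS i (f.comp g) (fun s => hi (by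
        have := hmem s
        rw [← hg] at this
        exact this))
      rw [pathLoop_comp] at h1
      have e0 : g 0 = t n := Subtype.ext (by rw [hg]; simp)
      have e1 : g 1 = t (n + 1) := Subtype.ext (by rw [hg]; simp)
      rwa [e0, e1] at h1
  rw [← hN N le_rfl]
  exact step N

end Generation

/-! ### Deformations onto the boundary of the polygon -/

section Charts

open unitInterval

lemma eventually_floor_eq {t : ℝ} (ht : Int.fract t ≠ 0) : ∀ᶠ t' in nhds t, ⌊t'⌋ = ⌊t⌋ := by
  have h1 : (⌊t⌋ : ℝ) < t :=
    lt_of_le_of_ne (Int.floor_le t) fun h => ht (by rw [Int.fract]; linarith)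
  filter_upwards [Ioo_mem_nhds h1 (Int.lt_floor_add_one t)] with t' ht'
  exact Int.floor_eq_iff.mpr ⟨ht'.1.le, ht'.2⟩

lemma floor_neg_of_fract_ne_zero {t : ℝ} (ht : Int.fract t ≠ 0) : ⌊-t⌋ = -⌊t⌋ - 1 := by
  have h1 : (⌊t⌋ : ℝ) < t :=
    lt_of_le_of_ne (Int.floor_le t) fun h => ht (by rw [Int.fract]; linarith)
  have h2 := Int.lt_floor_add_one t
  rw [Int.floor_eq_iff]
  push_cast
  constructor <;> linarith

lemma fract_neg_ne_zero {t : ℝ} (ht : Int.fract t ≠ 0) : Int.fract (-t) ≠ 0 := by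
  rwa [Ne, Int.fract_neg_eq_zero]

/-- A locally constant retraction `c`, defined on an open set `N` of angular parameters, that is
compatible with the symmetries of the strip. -/
structure IsAngularRetraction (N : Set ℝ) (c : ℝ → ℝ) : Prop where
  eventually : ∀ t ∈ N, ∀ᶠ t' in nhds t, t' ∈ N ∧ c t' = c t
  add_int_mem : ∀ (t : ℝ) (n : ℤ), t + n ∈ N ↔ t ∈ N
  add_int : ∀ (t : ℝ) (n : ℤ), c (t + n) = c t + n
  neg_mem : ∀ t ∈ N, -t ∈ N
  neg : ∀ t ∈ N, c (-t) = -c t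
  mem_Icc : ∀ t ∈ N, t ∈ Set.Icc (0 : ℝ) 1 → c t ∈ Set.Icc (0 : ℝ) 1

/-- Away from the vertices, every angular parameter is pushed to the midpoint of its side. -/
lemma isAngularRetraction_floor :
    IsAngularRetraction {t | Int.fract t ≠ 0} fun t => ⌊t⌋ + 1 / 2 where
  eventually t ht := by
    have h : ∀ᶠ t' in nhds t, Int.fract t' ≠ 0 := by
      have hc : ContinuousAt (Int.fract : ℝ → ℝ) t := by
        have : (fun t' : ℝ => t' - ⌊t⌋) =ᶠ[nhds t] Int.fract := by
          filter_upwards [eventually_floor_eq ht] with t' h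
          rw [Int.fract, h]
        exact (continuousAt_id.sub continuousAt_const).congr this
      exact hc.eventually_ne ht
    filter_upwards [h, eventually_floor_eq ht] with t' h1 h2
    exact ⟨h1, by rw [h2]⟩
  add_int_mem t n := by simp
  add_int t n := by simp; ring
  neg_mem t ht := fract_neg_ne_zero ht
  neg t ht := by rw [floor_neg_of_fract_ne_zero ht]; push_cast; ring
  mem_Icc t ht h := by
    have h0 : ⌊t⌋ = 0 := by
      rw [Int.floor_eq_zero_iff]
      refine ⟨h.1, lt_of_le_of_ne h.2 ?_⟩
      rintro rfl
      simp at ht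
    rw [h0]
    norm_num

/-- Away from the midpoints of the sides, every angular parameter is pushed to the nearest vertex.
-/
lemma isAngularRetraction_round :
    IsAngularRetraction {t | Int.fract (t + 1 / 2) ≠ 0} fun t => ⌊t + 1 / 2⌋ where
  eventually t ht := by
    have h := (continuous_id.add (continuous_const (y := (1 / 2 : ℝ)))).continuousAt (x := t)
      |>.eventually (isAngularRetraction_floor.eventually (t + 1 / 2) ht)
    filter_upwards [h] with t' h1
    exact ⟨h1.1, by simpa using h1.2⟩
  add_int_mem t n := by simp [add_right_comm _ (n : ℝ)]
  add_int t n := by simp [add_right_comm _ (n : ℝ)]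
  neg_mem t ht := by
    have h := fract_neg_ne_zero ht
    rw [Set.mem_ofPred, show -t + 1 / 2 = -(t + 1 / 2) + (1 : ℤ) by push_cast; ring,
      Int.fract_add_intCast]
    exact h
  neg t ht := by
    have h := floor_neg_of_fract_ne_zero ht
    rw [show -t + 1 / 2 = -(t + 1 / 2) + (1 : ℤ) by push_cast; ring, Int.floor_add_intCast, h]
    push_cast
    ring
  mem_Icc t ht h := by
    have h0 : 0 ≤ ⌊t + 1 / 2⌋ := Int.floor_nonneg.mpr (by linarith [h.1])
    have h1 : ⌊t + 1 / 2⌋ < 2 := Int.floor_lt.mpr (by push_cast; linarith [h.2])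
    have h2 : ⌊t + 1 / 2⌋ ≤ 1 := by omega
    exact ⟨by exact_mod_cast h0, by exact_mod_cast h2⟩

variable {N : Set ℝ} {c : ℝ → ℝ} (hc : IsAngularRetraction N c) (d : ℕ)

include hc

lemma IsAngularRetraction.isOpen : IsOpen N :=
  isOpen_iff_mem_nhds.mpr fun t ht => (hc.eventually t ht).mono fun _ h => h.1

lemma IsAngularRetraction.int_sub_mem (n : ℤ) (t : ℝ) : n - t ∈ N ↔ t ∈ N := by
  have h : ∀ s, -s ∈ N ↔ s ∈ N :=
    fun s => ⟨fun hs => by simpa using hc.neg_mem _ hs, hc.neg_mem s⟩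
  rw [sub_eq_neg_add, hc.add_int_mem, h]

lemma IsAngularRetraction.int_sub (n : ℤ) {t : ℝ} (ht : t ∈ N) : c (n - t) = n - c t := by
  rw [sub_eq_neg_add, hc.add_int, hc.neg t ht, sub_eq_neg_add]

lemma IsAngularRetraction.mem_iff {x y : Strip} (h : PolarRel d x y) :
    (x.1 ≠ 0 ∧ x.2 ∈ N) ↔ (y.1 ≠ 0 ∧ y.2 ∈ N) := by
  cases h with
  | center t t' => simp
  | turn r t n =>
    have := hc.add_int_mem t (n * (4 * d))
    push_cast at this
    simp [this]
  | sideA k s hs =>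
    have h1 := hc.add_int_mem s (4 * k)
    have h2 := hc.int_sub_mem (4 * k + 3) s
    push_cast at h1 h2
    simp [add_comm _ s, h1, h2]
  | sideB k s hs =>
    have h1 := hc.add_int_mem s (4 * k + 1)
    have h2 := hc.int_sub_mem (4 * k + 4) s
    push_cast at h1 h2
    simp [add_comm _ s, h1, h2]

omit hc

/-- The deformation that pushes a point of the strip to the boundary and its angular parameter `t`
to `c t`. -/
def radialDeform (c : ℝ → ℝ) (x : Strip) (u : unitInterval) : Strip :=
  (σ (σ x.1 * σ u), (1 - u) * x.2 + u * c x.2)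

include hc

/-- Turns and gluings act on the angle by integral translations and reflections, with which `c`
commutes. Since `c` preserves the unit interval, a point of a side stays on that side, so the
deformed points are glued by the same rule. -/
lemma IsAngularRetraction.polar_radialDeform {W : Type} [TopologicalSpace W] {P : C(Strip, W)}
    (hP : IsPolar d P) {x y : Strip} (h : PolarRel d x y) (hx : x.1 ≠ 0 ∧ x.2 ∈ N)
    (u : unitInterval) : P (radialDeform c x u) = P (radialDeform c y u) := by
  have mem : ∀ s ∈ N, s ∈ Set.Icc (0 : ℝ) 1 →
      (1 - u) * s + u * c s ∈ Set.Icc (0 : ℝ) 1 := by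
    intro s hs h
    have h1 := hc.mem_Icc s hs h
    have := u.2.1
    have := u.2.2
    exact (convex_Icc (0 : ℝ) 1) h h1 (a := (1 - u : ℝ)) (b := (u : ℝ)) (by linarith) (by linarith) (by ring)
  cases h with
  | center t t' => simp at hx
  | turn r t n =>
    have h1 := hc.add_int t (n * (4 * d))
    push_cast at h1
    convert hP.eq_of_rel (PolarRel.turn (d := d) (σ (σ r * σ u)) ((1 - u) * t + u * c t) n) using 2
    · simp only [radialDeform]
    · simp only [radialDeform, h1]
      ext
      · simp
      · simp; ring
  | sideA k s hs =>
    have h1 := hc.add_int_mem s (4 * k)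
    have h3 := hc.add_int s (4 * k)
    push_cast at h1 h3
    rw [add_comm] at h1 h3
    have hsN := h1.mp hx.2
    have h2 := hc.int_sub (4 * k + 3) hsN
    push_cast at h2
    convert hP.eq_of_rel (PolarRel.sideA (d := d) k _ (mem s hsN hs)) using 2
    · simp only [radialDeform, h3]
      ext
      · simp
      · simp; ring
    · simp only [radialDeform, h2]
      ext
      · simp
      · simp; ring
  | sideB k s hs =>
    have h1 := hc.add_int_mem s (4 * k + 1)
    have h3 := hc.add_int s (4 * k + 1)
    push_cast at h1 h3
    rw [add_comm] at h1 h3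
    have hsN := h1.mp hx.2
    have h2 := hc.int_sub (4 * k + 4) hsN
    push_cast at h2
    convert hP.eq_of_rel (PolarRel.sideB (d := d) k _ (mem s hsN hs)) using 2
    · simp only [radialDeform, h3]
      ext
      · simp
      · simp; ring
    · simp only [radialDeform, h2]
      ext
      · simp
      · simp; ring

lemma IsAngularRetraction.isOpen_strip : IsOpen {x : Strip | x.1 ≠ 0 ∧ x.2 ∈ N} :=
  (isOpen_ne.preimage continuous_fst).inter (hc.isOpen.preimage continuous_snd)

lemma IsAngularRetraction.pathLoop_mem {W : Type} [TopologicalSpace W] {P : C(Strip, W)}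
    (hP : IsPolar d P) {x₀ : W} (τ : Tails x₀) {S : Subgroup (FundamentalGroup W x₀)}
    (hS : ∀ x y, pathLoop τ P x y ∈ S) (f : C(unitInterval, W))
    (hf : ∀ t, f t ∈ P '' {x : Strip | x.1 ≠ 0 ∧ x.2 ∈ N}) : pathLoop τ f 0 1 ∈ S := by
  refine hP.pathLoop_mem_of_deformation τ hS hc.isOpen_strip
    (fun x y h => hc.mem_iff d h) (radialDeform c) ?_ ?_
    (fun x y h hx u => hc.polar_radialDeform d hP h hx u) ?_ f hf
  · intro p hp
    have h1 : ContinuousAt (fun p : Strip × unitInterval => c p.1.2) p := by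
      have h2 := (continuous_snd.comp continuous_fst).continuousAt (x := p)
        |>.eventually (hc.eventually p.1.2 hp.1.2)
      refine (continuousAt_const (y := c p.1.2)).congr ?_
      filter_upwards [h2] with p' h
      exact h.2.symm
    refine ContinuousAt.continuousWithinAt ?_
    change ContinuousAt (fun p : Strip × unitInterval =>
      ((σ (σ p.1.1 * σ p.2), (1 - (p.2 : ℝ)) * p.1.2 + p.2 * c p.1.2) : Strip)) p
    refine ContinuousAt.prodMk (Continuous.continuousAt (by fun_prop)) ?_
    exact ContinuousAt.add (Continuous.continuousAt (by fun_prop))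
      (ContinuousAt.mul (Continuous.continuousAt (by fun_prop)) h1)
  · intro x
    simp [radialDeform]
  · intro x hx
    have h2 := continuous_snd.continuousAt (x := x) |>.eventually (hc.eventually x.2 hx.2)
    filter_upwards [h2] with y h
    simp [radialDeform, h.2]

end Charts

/-! ### Covering a surface by an open disk and neighbourhoods of sides and vertices -/

section Generation

open unitInterval

variable {W : Type} [TopologicalSpace W] {d : ℕ} {P : C(Strip, W)} {x₀ : W} (τ : Tails x₀)

lemma isOpen_ne_one_strip : IsOpen {x : Strip | x.1 ≠ 1} := isOpen_ne.preimage continuous_fst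

lemma ne_one_iff_of_polarRel {x y : Strip} (h : PolarRel d x y) : x.1 ≠ 1 ↔ y.1 ≠ 1 := by
  cases h <;> simp

/-- The open disk contracts radially to its centre, and all angles are identified there. -/
lemma IsPolar.pathLoop_mem_of_interior (hP : IsPolar d P) {S : Subgroup (FundamentalGroup W x₀)}
    (hS : ∀ x y, pathLoop τ P x y ∈ S) (f : C(unitInterval, W))
    (hf : ∀ t, f t ∈ P '' {x : Strip | x.1 ≠ 1}) : pathLoop τ f 0 1 ∈ S := by
  refine hP.pathLoop_mem_of_deformation τ hS isOpen_ne_one_strip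
    (fun x y h => ne_one_iff_of_polarRel h) (fun x u => (x.1 * σ u, x.2)) ?_ ?_ ?_ ?_ f hf
  · refine Continuous.continuousOn ?_
    change Continuous fun p : Strip × unitInterval => ((p.1.1 * σ p.2, p.1.2) : Strip)
    fun_prop
  · intro x
    simp
  · intro x y h hx u
    cases h with
    | center t t' => simpa using hP.eq_of_rel (.center t t')
    | turn r t n => exact hP.eq_of_rel (.turn _ t n)
    | sideA k s hs => simp at hx
    | sideB k s hs => simp at hx
  · intro x hx
    refine .of_forall fun y => ?_
    simpa using hP.eq_of_rel (.center y.2 x.2)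

/-- The fundamental group of a surface is generated by the classes of paths of the strip. -/
lemma IsPolar.eq_top_of_pathLoop_mem (hP : IsPolar d P) {S : Subgroup (FundamentalGroup W x₀)}
    (hS : ∀ x y, pathLoop τ P x y ∈ S) : S = ⊤ := by
  have hop : ∀ U : Set Strip, IsOpen U → (∀ x y, PolarRel d x y → (x ∈ U ↔ y ∈ U)) →
      IsOpen (P '' U) := fun U hU h => by
    rw [← hP.isQuotientMap.isOpen_preimage, hP.preimage_image h]
    exact hU
  refine SurfaceLifts.eq_top_of_pathLoop_mem τ S fun f => pathLoop_mem_of_openCover τ (ι := Fin 3)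
    (V := fun i => P '' (![{x : Strip | x.1 ≠ 1}, {x : Strip | x.1 ≠ 0 ∧ Int.fract x.2 ≠ 0},
      {x : Strip | x.1 ≠ 0 ∧ Int.fract (x.2 + 1 / 2) ≠ 0}] i)) ?_ ?_ ?_ f
  · intro i
    fin_cases i
    · exact hop _ isOpen_ne_one_strip fun x y h => ne_one_iff_of_polarRel h
    · exact hop _ isAngularRetraction_floor.isOpen_strip
        fun x y h => isAngularRetraction_floor.mem_iff d h
    · exact hop _ isAngularRetraction_round.isOpen_strip
        fun x y h => isAngularRetraction_round.mem_iff d h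
  · intro w
    obtain ⟨x, rfl⟩ := hP.isQuotientMap.surjective w
    by_cases h1 : x.1 = 1
    · have h0 : x.1 ≠ 0 := by rw [h1]; exact one_ne_zero
      -- On the boundary, integral angles are the vertices and belong to the rounding chart; all
      -- other points belong to the chart of the open sides.
      by_cases h2 : Int.fract x.2 = 0
      · refine ⟨2, x, ⟨h0, ?_⟩, rfl⟩
        rw [Int.fract_eq_zero_iff] at h2
        obtain ⟨n, hn⟩ := h2
        rw [← hn, Int.fract_intCast_add]
        norm_num
      · exact ⟨1, x, ⟨h0, h2⟩, rfl⟩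
    · exact ⟨0, x, h1, rfl⟩
  · intro i f hf
    fin_cases i
    · exact hP.pathLoop_mem_of_interior τ hS f hf
    · exact isAngularRetraction_floor.pathLoop_mem d hP τ hS f hf
    · exact isAngularRetraction_round.pathLoop_mem d hP τ hS f hf

end Generation

/-! ### The sides of the polygon: their relation and generation by them -/

section Sides

open unitInterval
open scoped commutatorElement

lemma prod_ofFn_telescope {H : Type*} [Group H] (F U : ℕ → H)
    (h : ∀ k, F k = U k * (U (k + 1))⁻¹) (d : ℕ) :
    (List.ofFn fun k : Fin d => F k).prod = U 0 * (U d)⁻¹ := by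
  induction d with
  | zero => simp
  | succ d ih =>
    rw [List.ofFn_succ', List.concat_eq_append, List.prod_append, List.prod_singleton]
    simp only [Fin.val_castSucc, Fin.val_last]
    rw [ih, h]
    group

lemma mul_inv_mem_symm {H : Type*} [Group H] {S : Subgroup H} {x y : H} (h : x * y⁻¹ ∈ S) :
    y * x⁻¹ ∈ S := by
  simpa using S.inv_mem h

lemma mul_inv_mem_trans {H : Type*} [Group H] {S : Subgroup H} {x y z : H} (h : x * y⁻¹ ∈ S)
    (h' : y * z⁻¹ ∈ S) : x * z⁻¹ ∈ S := by
  simpa [mul_assoc] using S.mul_mem h h'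

lemma mul_mul_inv_mul_mem {H : Type*} [Group H] {S : Subgroup H} {x y a : H} (h : x ∈ S)
    (h' : y ∈ S) : x * a * (y * a)⁻¹ ∈ S := by
  simpa using S.mul_mem h (S.inv_mem h')

lemma mul_mul_inv_mem {H : Type*} [Group H] {S : Subgroup H} {x y a b : H} (h : a * x⁻¹ ∈ S)
    (h' : y * b⁻¹ ∈ S) : a * (x⁻¹ * y) * b⁻¹ ∈ S := by
  simpa [mul_assoc] using S.mul_mem h h'

variable {W : Type} [TopologicalSpace W] {d : ℕ} {P : C(Strip, W)} {x₀ : W} (τ : Tails x₀)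

/-- The class of the side `a_k` of the polygon. -/
def sideA (P : C(Strip, W)) (k : ℤ) : FundamentalGroup W x₀ :=
  pathLoop τ P (1, 4 * k) (1, 4 * k + 1)

/-- The class of the side `b_k` of the polygon. -/
def sideB (P : C(Strip, W)) (k : ℤ) : FundamentalGroup W x₀ :=
  pathLoop τ P (1, 4 * k + 1) (1, 4 * k + 2)

lemma IsPolar.pathLoop_turn (hP : IsPolar d P) (x y : Strip) (n : ℤ) :
    pathLoop τ P (x.1, x.2 + n * (4 * d)) (y.1, y.2 + n * (4 * d)) = pathLoop τ P x y := by
  refine pathLoop_eq_of_comp_eq τ P (g := ⟨fun x : Strip => (x.1, x.2 + n * (4 * d)), by fun_prop⟩)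
    (h := ContinuousMap.id _) ?_ x y
  ext x
  exact (hP.eq_of_rel (.turn x.1 x.2 n)).symm

lemma IsPolar.pathLoop_center (hP : IsPolar d P) (t t' : ℝ) :
    pathLoop τ P (0, t) (0, t') = 1 := by
  have h := pathLoop_eq_of_comp_eq τ P (g := (⟨fun t : ℝ => (0, t), by fun_prop⟩ : C(ℝ, Strip)))
    (h := ⟨fun _ => (0, t), by fun_prop⟩) (by
      ext s
      exact hP.eq_of_rel (.center _ _)) t t'
  exact h.trans (pathLoop_self _ _ _)

lemma IsPolar.pathLoop_sideA (hP : IsPolar d P) (k : ℤ) (s s' : unitInterval) :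
    pathLoop τ P (1, 4 * k + s) (1, 4 * k + s') =
      pathLoop τ P (1, 4 * k + 3 - s) (1, 4 * k + 3 - s') := by
  refine pathLoop_eq_of_comp_eq τ P
    (g := ⟨fun s : unitInterval => (1, 4 * k + (s : ℝ)), by fun_prop⟩)
    (h := ⟨fun s : unitInterval => (1, 4 * k + 3 - (s : ℝ)), by fun_prop⟩) ?_ s s'
  ext s
  exact hP.eq_of_rel (.sideA k s s.2)

lemma IsPolar.pathLoop_sideB (hP : IsPolar d P) (k : ℤ) (s s' : unitInterval) :
    pathLoop τ P (1, 4 * k + 1 + s) (1, 4 * k + 1 + s') =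
      pathLoop τ P (1, 4 * k + 4 - s) (1, 4 * k + 4 - s') := by
  refine pathLoop_eq_of_comp_eq τ P
    (g := ⟨fun s : unitInterval => (1, 4 * k + 1 + (s : ℝ)), by fun_prop⟩)
    (h := ⟨fun s : unitInterval => (1, 4 * k + 4 - (s : ℝ)), by fun_prop⟩) ?_ s s'
  ext s
  exact hP.eq_of_rel (.sideB k s s.2)

lemma IsPolar.sideA_eq (hP : IsPolar d P) (k : ℤ) :
    pathLoop τ P (1, 4 * k + 3) (1, 4 * k + 2) = sideA τ P k := by
  have := hP.pathLoop_sideA τ k 0 1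
  simp only [Set.Icc.coe_zero, Set.Icc.coe_one, add_zero, sub_zero] at this
  rw [sideA, this]
  congr 2
  ring

lemma IsPolar.sideB_eq (hP : IsPolar d P) (k : ℤ) :
    pathLoop τ P (1, 4 * k + 4) (1, 4 * k + 3) = sideB τ P k := by
  have := hP.pathLoop_sideB τ k 0 1
  simp only [Set.Icc.coe_zero, Set.Icc.coe_one, add_zero, sub_zero] at this
  rw [sideB, show (4 * k + 2 : ℝ) = 4 * k + 1 + 1 by ring, this]
  congr 2
  ring

/-- Four consecutive sides read `a b a⁻¹ b⁻¹`, because the third and the fourth are glued to the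
first and the second with reversed direction. -/
lemma IsPolar.commutator_sides (hP : IsPolar d P) (k : ℤ) :
    ⁅sideA τ P k, sideB τ P k⁆ = pathLoop τ P (1, 4 * k) (1, 4 * k + 4) := by
  rw [commutatorElement_def]
  nth_rw 2 [← hP.sideA_eq, ← hP.sideB_eq]
  rw [sideA, sideB, pathLoop_inv, pathLoop_inv, pathLoop_mul, pathLoop_mul, pathLoop_mul]

/-- The relation between the sides of the polygon. -/
lemma IsPolar.prod_commutator_sides (hP : IsPolar d P) :
    (List.ofFn fun k : Fin d => ⁅sideA τ P (k : ℕ), sideB τ P (k : ℕ)⁆).prod = 1 := by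
  rw [prod_ofFn_telescope (fun k : ℕ => ⁅sideA τ P k, sideB τ P k⁆)
    (fun k : ℕ => pathLoop τ P (1, 4 * k) (1, 0)) ?_ d]
  · have h1 := hP.pathLoop_turn τ (0, 0) (1, 0) 1
    have h2 := hP.pathLoop_center τ 0 (4 * d)
    -- The boundary circle is replaced by the way through the centre: in along the spoke at angle
    -- `0` and out along the spoke at angle `4d`, which is the same spoke after a full turn.
    have h3 : pathLoop τ P (1, 0) (1, 4 * d) = 1 := by
      rw [← pathLoop_mul τ P _ (0, 0), ← pathLoop_mul τ P (0, 0) (0, 4 * d), h2]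
      simp only [Int.cast_one, one_mul, zero_add] at h1
      rw [h1, one_mul, pathLoop_mul, pathLoop_self]
    rw [pathLoop_inv, h3]
    simp
  · intro k
    rw [hP.commutator_sides, pathLoop_inv, pathLoop_mul]
    push_cast
    congr 2
    ring

/-- The fundamental group of a surface is generated by the sides of the polygon. -/
lemma IsPolar.eq_top_of_sides_mem (hd : 1 ≤ d) (hP : IsPolar d P)
    {S : Subgroup (FundamentalGroup W x₀)}
    (hA : ∀ k : Fin d, sideA τ P (k : ℕ) ∈ S) (hB : ∀ k : Fin d, sideB τ P (k : ℕ) ∈ S) :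
    S = ⊤ := by
  have hred : ∀ k : ℤ, ∃ (m : Fin d) (n : ℤ), (k : ℝ) = (m : ℕ) + n * d := by
    intro k
    have hd' : (0 : ℤ) < d := by omega
    have h1 := Int.emod_lt_of_pos k hd'
    have h0 := Int.emod_nonneg k hd'.ne'
    refine ⟨⟨(k % d).toNat, by omega⟩, k / d, ?_⟩
    have h2 : (k : ℤ) = ((k % d).toNat : ℕ) + k / d * d := by
      rw [Int.toNat_of_nonneg h0, Int.emod_def]; ring
    exact_mod_cast h2
  have hA' : ∀ k : ℤ, sideA τ P k ∈ S := by
    intro k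
    obtain ⟨m, n, h⟩ := hred k
    have := hA m
    rw [sideA, ← hP.pathLoop_turn τ _ _ n] at this
    rw [sideA, h]
    convert this using 3 <;> (push_cast; ring)
  have hB' : ∀ k : ℤ, sideB τ P k ∈ S := by
    intro k
    obtain ⟨m, n, h⟩ := hred k
    have := hB m
    rw [sideB, ← hP.pathLoop_turn τ _ _ n] at this
    rw [sideB, h]
    convert this using 3 <;> (push_cast; ring)
  have hv4 : ∀ (k : ℤ) (j : ℕ), j ≤ 4 → pathLoop τ P (1, 4 * k) (1, 4 * k + j) ∈ S := by
    intro k j hj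
    have e1 : pathLoop τ P (1, 4 * k) (1, 4 * k + 1) ∈ S := hA' k
    have e2 : pathLoop τ P (1, 4 * k) (1, 4 * k + 2) ∈ S := by
      rw [← pathLoop_mul τ P _ (1, 4 * k + 1)]
      exact S.mul_mem e1 (hB' k)
    have e3 : pathLoop τ P (1, 4 * k) (1, 4 * k + 3) ∈ S := by
      rw [← pathLoop_mul τ P _ (1, 4 * k + 2), ← pathLoop_inv τ P (1, 4 * k + 3), hP.sideA_eq]
      exact S.mul_mem e2 (S.inv_mem (hA' k))
    have e4 : pathLoop τ P (1, 4 * k) (1, 4 * k + 4) ∈ S := by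
      rw [← pathLoop_mul τ P _ (1, 4 * k + 3), ← pathLoop_inv τ P (1, 4 * k + 4), hP.sideB_eq]
      exact S.mul_mem e3 (S.inv_mem (hB' k))
    interval_cases j
    · simp only [Nat.cast_zero, add_zero, pathLoop_self, S.one_mem]
    · simpa using e1
    · simpa using e2
    · simpa using e3
    · simpa using e4
  have hv : ∀ k : ℤ, pathLoop τ P (1, 0) (1, 4 * k) ∈ S := by
    intro k
    induction k using Int.induction_on with
    | zero => simp only [Int.cast_zero, mul_zero, pathLoop_self, S.one_mem]
    | succ k ih =>
      rw [← pathLoop_mul τ P _ (1, 4 * (k : ℤ))]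
      refine S.mul_mem ih ?_
      convert hv4 k 4 le_rfl using 3
      push_cast; ring
    | pred k ih =>
      rw [← pathLoop_mul τ P _ (1, 4 * (-(k : ℤ) : ℤ))]
      refine S.mul_mem ih ?_
      rw [← pathLoop_inv, inv_mem_iff]
      convert hv4 (-k - 1) 4 le_rfl using 3
      push_cast; ring
  have hv' : ∀ (k : ℤ) (j : ℕ), j ≤ 4 → pathLoop τ P (1, 0) (1, 4 * k + j) ∈ S := fun k j hj => by
    rw [← pathLoop_mul τ P _ (1, 4 * k)]
    exact S.mul_mem (hv k) (hv4 k j hj)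
  -- Identified points are reached from the corner `(1, 0)` by classes that differ by an element of
  -- `S`. It suffices to test this at a vertex, since corresponding paths along glued sides have
  -- equal classes.
  have hrel : ∀ x y, PolarRel d x y →
      pathLoop τ P (1, 0) x * (pathLoop τ P (1, 0) y)⁻¹ ∈ S := by
    have aux : ∀ x y p q : Strip, pathLoop τ P p x = pathLoop τ P q y →
        pathLoop τ P (1, 0) p ∈ S → pathLoop τ P (1, 0) q ∈ S →
        pathLoop τ P (1, 0) x * (pathLoop τ P (1, 0) y)⁻¹ ∈ S := by
      intro x y p q h hp hq
      rw [← pathLoop_mul τ P _ p x, ← pathLoop_mul τ P _ q y, h]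
      exact mul_mul_inv_mul_mem hp hq
    intro x y h
    cases h with
    | center t t' =>
      rw [pathLoop_inv, ← pathLoop_mul τ P (0, t') (0, t), hP.pathLoop_center, one_mul,
        pathLoop_mul, pathLoop_self]
      exact S.one_mem
    | turn r t n =>
      refine aux _ _ (1, 0) (1, 0 + n * (4 * d)) (hP.pathLoop_turn τ (1, 0) (r, t) n).symm ?_ ?_
      · rw [pathLoop_self]; exact S.one_mem
      · convert hv (n * d) using 3
        push_cast; ring
    | sideA k s hs =>
      have := hP.pathLoop_sideA τ k 0 ⟨s, hs⟩
      refine aux _ _ _ _ this ?_ ?_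
      · simpa using hv k
      · simpa using hv' k 3 (by norm_num)
    | sideB k s hs =>
      have := hP.pathLoop_sideB τ k 0 ⟨s, hs⟩
      refine aux _ _ _ _ this ?_ ?_
      · simpa using hv' k 1 (by norm_num)
      · simpa using hv' k 4 (by norm_num)
  have hrel' : ∀ x y, P x = P y → pathLoop τ P (1, 0) x * (pathLoop τ P (1, 0) y)⁻¹ ∈ S := by
    intro x y h
    have h' := hP.rel_of_eq h
    clear h
    induction h' with
    | rel x y h => exact hrel x y h
    | refl => rw [mul_inv_cancel]; exact S.one_mem
    | symm x y h ih => exact mul_inv_mem_symm ih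
    | trans x y z h h' ih ih' => exact mul_inv_mem_trans ih ih'
  let p : W → Strip := Function.surjInv hP.isQuotientMap.surjective
  have hp : ∀ w, P (p w) = w := Function.surjInv_eq _
  -- With paths from the base point twisted by the class from a chosen preimage to the corner, every
  -- path of the strip has its class in `S`: both end corrections are covered by `hrel'`.
  refine hP.eq_top_of_pathLoop_mem (τ.twist fun w => pathLoop τ P (1, 0) (p w)) fun x y => ?_
  rw [pathLoop_twist]
  have h1 := hrel' (p (P x)) x (hp _)
  have h2 := hrel' y (p (P y)) (hp _).symm
  have h4 : (pathLoop τ P (1, 0) x)⁻¹ * pathLoop τ P (1, 0) y = pathLoop τ P x y := by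
    rw [pathLoop_inv, pathLoop_mul]
  rw [← h4]
  exact mul_mul_inv_mem h1 h2

end Sides

/-! ### Coverings of a surface and homomorphisms from its fundamental group -/

section Cover

open Topology

/-- Values `V n ∈ H` at the vertices of the polygon such that the holonomies along glued sides
agree. -/
structure IsHolonomy {H : Type*} [Group H] (d : ℕ) (V : ℤ → H) : Prop where
  periodic : ∀ n m : ℤ, V (n + m * (4 * d)) = V n
  sideA : ∀ k : ℤ, (V (4 * k))⁻¹ * V (4 * k + 3) = (V (4 * k + 1))⁻¹ * V (4 * k + 2)
  sideB : ∀ k : ℤ, (V (4 * k + 1))⁻¹ * V (4 * k + 4) = (V (4 * k + 2))⁻¹ * V (4 * k + 3)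

/-- The identifications in the covering of the surface with prescribed holonomy. -/
inductive CoverRel {H : Type*} [Group H] (d : ℕ) (V : ℤ → H) : Strip × H → Strip × H → Prop
  | center (t t' : ℝ) (h : H) : CoverRel d V ((0, t), h) ((0, t'), h)
  | turn (r : unitInterval) (t : ℝ) (n : ℤ) (h : H) :
      CoverRel d V ((r, t), h) ((r, t + n * (4 * d)), h)
  | sideA (k : ℤ) (s : ℝ) (hs : s ∈ Set.Icc (0 : ℝ) 1) (h : H) :
      CoverRel d V ((1, 4 * k + s), h) ((1, 4 * k + 3 - s), h * ((V (4 * k))⁻¹ * V (4 * k + 3)))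
  | sideB (k : ℤ) (s : ℝ) (hs : s ∈ Set.Icc (0 : ℝ) 1) (h : H) :
      CoverRel d V ((1, 4 * k + 1 + s), h)
        ((1, 4 * k + 4 - s), h * ((V (4 * k + 1))⁻¹ * V (4 * k + 4)))

/-- The covering of the surface with prescribed holonomy. -/
def Cover {H : Type*} [Group H] (d : ℕ) (V : ℤ → H) : Type _ := Quot (CoverRel d V)

variable {H : Type*} [Group H] {d : ℕ} {V : ℤ → H}

lemma CoverRel.polarRel {a b : Strip × H} (h : CoverRel d V a b) : PolarRel d a.1 b.1 := by
  cases h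
  · exact .center _ _
  · exact .turn _ _ _
  · exact .sideA _ _ ‹_›
  · exact .sideB _ _ ‹_›

lemma exists_coverRel {x y : Strip} (h : PolarRel d x y) :
    ∃ A : H, ∀ k : H, CoverRel d V (x, k) (y, k * A) := by
  cases h with
  | center t t' => exact ⟨1, fun k => by simpa using CoverRel.center t t' k⟩
  | turn r t n => exact ⟨1, fun k => by simpa using CoverRel.turn r t n k⟩
  | sideA k s hs => exact ⟨_, fun h => .sideA k s hs h⟩
  | sideB k s hs => exact ⟨_, fun h => .sideB k s hs h⟩

lemma CoverRel.mul_left {a b : Strip × H} (h : CoverRel d V a b) (g : H) :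
    CoverRel d V (a.1, g * a.2) (b.1, g * b.2) := by
  cases h with
  | center t t' => exact .center _ _ _
  | turn r t n => exact .turn _ _ _ _
  | sideA k s hs h => simpa [mul_assoc] using CoverRel.sideA (d := d) (V := V) k s hs (g * h)
  | sideB k s hs h => simpa [mul_assoc] using CoverRel.sideB (d := d) (V := V) k s hs (g * h)

instance : MulAction H (Cover d V) where
  smul g := Quot.map (fun a => (a.1, g * a.2)) fun _ _ h => h.mul_left g
  one_smul := by
    rintro ⟨x, h⟩
    exact congrArg (Quot.mk _) (by simp)
  mul_smul g g' := by
    rintro ⟨x, h⟩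
    exact congrArg (Quot.mk _) (by simp [mul_assoc])

/-- The point of the covering given by a point of the strip and an element of the group. -/
def Cover.mk (d : ℕ) (V : ℤ → H) (x : Strip) (h : H) : Cover d V := Quot.mk _ (x, h)

lemma Cover.smul_mk (g : H) (x : Strip) (h : H) : g • Cover.mk d V x h = Cover.mk d V x (g * h) :=
  rfl

lemma Cover.exists_mk (e : Cover d V) : ∃ x h, e = Cover.mk d V x h := by
  obtain ⟨x, h⟩ := e
  exact ⟨x, h, rfl⟩

instance [TopologicalSpace H] : TopologicalSpace (Cover d V) :=
  inferInstanceAs (TopologicalSpace (Quot (CoverRel d V)))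

lemma Cover.isQuotientMap_mk [TopologicalSpace H] :
    IsQuotientMap fun a : Strip × H => Cover.mk d V a.1 a.2 := isQuotientMap_quot_mk

lemma Cover.continuous_mk [TopologicalSpace H] :
    Continuous fun a : Strip × H => Cover.mk d V a.1 a.2 := Cover.isQuotientMap_mk.continuous

variable {W : Type} [TopologicalSpace W] {P : C(Strip, W)} (hP : IsPolar d P)

/-- The projection of the covering. -/
def IsPolar.proj (hP : IsPolar d P) (V : ℤ → H) : Cover d V → W :=
  Quot.lift (fun a => P a.1) fun _ _ h => hP.eq_of_rel h.polarRel

include hP in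
lemma IsPolar.exists_mk_eq {x y : Strip} (h : P x = P y) :
    ∃ A : H, ∀ k : H, Cover.mk d V x k = Cover.mk d V y (k * A) := by
  have h' := hP.rel_of_eq h
  clear h
  induction h' with
  | rel x y h =>
    obtain ⟨A, hA⟩ := exists_coverRel (V := V) h
    exact ⟨A, fun k => Quot.sound (hA k)⟩
  | refl x => exact ⟨1, by simp⟩
  | symm x y h ih =>
    obtain ⟨A, hA⟩ := ih
    exact ⟨A⁻¹, fun k => by rw [hA, inv_mul_cancel_right]⟩
  | trans x y z h h' ih ih' =>
    obtain ⟨A, hA⟩ := ih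
    obtain ⟨B, hB⟩ := ih'
    exact ⟨A * B, fun k => by rw [hA, hB, mul_assoc]⟩

/-- A function `s` on an open part `U` of the strip that trivializes the covering over `U`. -/
structure IsSection (d : ℕ) (V : ℤ → H) (U : Set Strip) (s : Strip → H) : Prop where
  isOpen : IsOpen U
  eventually : ∀ x ∈ U, ∀ᶠ y in 𝓝 x, s y = s x
  mem_iff : ∀ x y, PolarRel d x y → (x ∈ U ↔ y ∈ U)
  eq : ∀ a b, CoverRel d V a b → a.1 ∈ U → a.2 * (s a.1)⁻¹ = b.2 * (s b.1)⁻¹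

/-- The quantity `h (s x)⁻¹` is unchanged by the generating relation over `U`, so it is a
well-defined sheet label there. -/
lemma IsSection.eq_of_mk_eq {U : Set Strip} {s : Strip → H} (hs : IsSection d V U s) {x y : Strip}
    {h k : H} (e : Cover.mk d V x h = Cover.mk d V y k) (hx : x ∈ U) :
    y ∈ U ∧ h * (s x)⁻¹ = k * (s y)⁻¹ := by
  let f : Cover d V → Prop := Quot.lift
    (fun a : Strip × H => a.1 ∈ U ∧ h * (s x)⁻¹ = a.2 * (s a.1)⁻¹) fun a b hab => by
      have h1 := hs.mem_iff _ _ hab.polarRel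
      by_cases ha : a.1 ∈ U
      · simp [ha, h1.mp ha, hs.eq a b hab ha]
      · simp [ha, mt h1.mpr ha]
  have : f (Cover.mk d V x h) = f (Cover.mk d V y k) := congrArg f e
  exact this.mp ⟨hx, rfl⟩

/-- The neighbourhood is the sheet through the given point, the set of constant label `k (s y)⁻¹`; a
group element multiplies the label and so cannot map the sheet to itself unless it is `1`. -/
lemma IsSection.exists_nhds [TopologicalSpace H] [DiscreteTopology H] {U : Set Strip}
    {s : Strip → H} (hs : IsSection d V U s) {x : Strip} (hx : x ∈ U) (h : H) :
    ∃ N ∈ 𝓝 (Cover.mk d V x h), ∀ g : H, ((g • ·) '' N ∩ N).Nonempty → g = 1 := by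
  refine ⟨{e | ∃ y k, e = Cover.mk d V y k ∧ y ∈ U ∧ k * (s y)⁻¹ = h * (s x)⁻¹}, ?_, ?_⟩
  · refine IsOpen.mem_nhds ?_ ⟨x, h, rfl, hx, rfl⟩
    rw [← Cover.isQuotientMap_mk.isOpen_preimage]
    have : (fun a : Strip × H => Cover.mk d V a.1 a.2) ⁻¹'
        {e | ∃ y k, e = Cover.mk d V y k ∧ y ∈ U ∧ k * (s y)⁻¹ = h * (s x)⁻¹} =
        {a : Strip × H | a.1 ∈ U ∧ a.2 * (s a.1)⁻¹ = h * (s x)⁻¹} := by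
      ext ⟨z, l⟩
      constructor
      · rintro ⟨y, k, e, hy, hk⟩
        have := hs.eq_of_mk_eq (V := V) e.symm hy
        exact ⟨this.1, this.2.symm.trans hk⟩
      · rintro ⟨hz, hl⟩
        exact ⟨z, l, rfl, hz, hl⟩
    rw [this, isOpen_iff_mem_nhds]
    rintro ⟨z, l⟩ ⟨hz, hl⟩
    have h1 := continuous_fst.continuousAt (x := (z, l)) |>.eventually (hs.eventually z hz)
    have h2 := continuous_fst.continuousAt (x := (z, l)) |>.eventually (hs.isOpen.mem_nhds hz)
    have h3 := continuous_snd.continuousAt (x := (z, l)) |>.eventually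
      ((isOpen_discrete {l}).mem_nhds rfl)
    filter_upwards [h1, h2, h3] with a h1 h2 h3
    exact ⟨h2, by rw [h1, Set.mem_singleton_iff.mp h3]; exact hl⟩
  · rintro g ⟨_, ⟨_, ⟨y, k, rfl, hy, hk⟩, rfl⟩, y', k', e, hy', hk'⟩
    simp only [Cover.smul_mk] at e
    have h1 := (hs.eq_of_mk_eq e hy).2
    rw [hk', ← hk] at h1
    simpa using h1

lemma isSection_interior : IsSection d V {x | x.1 ≠ 1} fun _ => 1 where
  isOpen := isOpen_ne_one_strip
  eventually x _ := .of_forall fun _ => rfl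
  mem_iff x y h := ne_one_iff_of_polarRel h
  eq a b h ha := by
    cases h with
    | center t t' => rfl
    | turn r t n => rfl
    | sideA k s hs h => simp at ha
    | sideB k s hs h => simp at ha

/-- Near the vertex `n` the label is `V n`. The first half of a side meets the second half of its
partner at the initial vertex, where the transition is the defining one; for the other halves it is
the transition at the terminal vertex, equal by the holonomy condition. -/
lemma isSection_vertices (hV : IsHolonomy d V) :
    IsSection d V {x | x.1 ≠ 0 ∧ Int.fract (x.2 + 1 / 2) ≠ 0} fun x => V ⌊x.2 + 1 / 2⌋ where
  isOpen := isAngularRetraction_round.isOpen_strip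
  eventually x hx := by
    have h := (continuous_snd.add continuous_const).continuousAt (x := x) |>.eventually
      (eventually_floor_eq hx.2)
    filter_upwards [h] with y hy
    exact congrArg V hy
  mem_iff x y h := isAngularRetraction_round.mem_iff d h
  eq a b h ha := by
    cases h with
    | center t t' => simp at ha
    | turn r t n =>
      have : t + n * (4 * d) + 1 / 2 = t + 1 / 2 + (n * (4 * d) : ℤ) := by push_cast; ring
      simp only [this, Int.floor_add_intCast, hV.periodic]
    | sideA k s hs h =>
      have hne : s ≠ 1 / 2 := by
        rintro rfl
        refine ha.2 ?_
        rw [show 4 * (k : ℝ) + 1 / 2 + 1 / 2 = (4 * k + 1 : ℤ) by push_cast; ring]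
        exact Int.fract_intCast _
      obtain ⟨hs0, hs1⟩ := hs
      dsimp only
      rcases lt_or_gt_of_ne hne with h1 | h1
      · have e1 : ⌊4 * (k : ℝ) + s + 1 / 2⌋ = 4 * k := by
          rw [Int.floor_eq_iff]; push_cast; constructor <;> linarith
        have e2 : ⌊4 * (k : ℝ) + 3 - s + 1 / 2⌋ = 4 * k + 3 := by
          rw [Int.floor_eq_iff]; push_cast; constructor <;> linarith
        rw [e1, e2]
        group
      · have e1 : ⌊4 * (k : ℝ) + s + 1 / 2⌋ = 4 * k + 1 := by
          rw [Int.floor_eq_iff]; push_cast; constructor <;> linarith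
        have e2 : ⌊4 * (k : ℝ) + 3 - s + 1 / 2⌋ = 4 * k + 2 := by
          rw [Int.floor_eq_iff]; push_cast; constructor <;> linarith
        rw [e1, e2, hV.sideA]
        group
    | sideB k s hs h =>
      have hne : s ≠ 1 / 2 := by
        rintro rfl
        refine ha.2 ?_
        rw [show 4 * (k : ℝ) + 1 + 1 / 2 + 1 / 2 = (4 * k + 2 : ℤ) by push_cast; ring]
        exact Int.fract_intCast _
      obtain ⟨hs0, hs1⟩ := hs
      dsimp only
      rcases lt_or_gt_of_ne hne with h1 | h1
      · have e1 : ⌊4 * (k : ℝ) + 1 + s + 1 / 2⌋ = 4 * k + 1 := by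
          rw [Int.floor_eq_iff]; push_cast; constructor <;> linarith
        have e2 : ⌊4 * (k : ℝ) + 4 - s + 1 / 2⌋ = 4 * k + 4 := by
          rw [Int.floor_eq_iff]; push_cast; constructor <;> linarith
        rw [e1, e2]
        group
      · have e1 : ⌊4 * (k : ℝ) + 1 + s + 1 / 2⌋ = 4 * k + 2 := by
          rw [Int.floor_eq_iff]; push_cast; constructor <;> linarith
        have e2 : ⌊4 * (k : ℝ) + 4 - s + 1 / 2⌋ = 4 * k + 3 := by
          rw [Int.floor_eq_iff]; push_cast; constructor <;> linarith
        rw [e1, e2, hV.sideB]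
        group

/-- One value per open side. The first two of four sides use their initial vertex and the last two
their terminal vertex, since gluing reverses direction and these are the vertices that correspond.
-/
lemma isSection_edges (hV : IsHolonomy d V) :
    IsSection d V {x | x.1 ≠ 0 ∧ Int.fract x.2 ≠ 0}
      fun x => if ⌊x.2⌋ % 4 < 2 then V ⌊x.2⌋ else V (⌊x.2⌋ + 1) where
  isOpen := isAngularRetraction_floor.isOpen_strip
  eventually x hx := by
    have h := continuous_snd.continuousAt (x := x) |>.eventually (eventually_floor_eq hx.2)
    filter_upwards [h] with y hy
    rw [hy]
  mem_iff x y h := isAngularRetraction_floor.mem_iff d h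
  eq a b h ha := by
    have side : ∀ (m : ℤ) (s : ℝ), s ∈ Set.Icc (0 : ℝ) 1 → Int.fract (m + s) ≠ 0 →
        0 < s ∧ s < 1 := by
      intro m s hs h
      constructor
      · refine lt_of_le_of_ne hs.1 ?_
        rintro rfl
        simp at h
      · refine lt_of_le_of_ne hs.2 ?_
        rintro rfl
        simp at h
    cases h with
    | center t t' => simp at ha
    | turn r t n =>
      have : t + n * (4 * d) = t + (n * (4 * d) : ℤ) := by push_cast; ring
      have h2 : (⌊t⌋ + n * (4 * d)) % 4 = ⌊t⌋ % 4 := by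
        rw [show (⌊t⌋ + n * (4 * d) : ℤ) = ⌊t⌋ + 4 * (n * d) by ring]
        exact Int.add_mul_emod_self_left _ _ _
      simp only [this, Int.floor_add_intCast, h2, hV.periodic, add_right_comm _ _ (1 : ℤ)]
    | sideA k s hs h =>
      obtain ⟨h0, h1⟩ := side (4 * k) s hs (by push_cast; exact ha.2)
      have e1 : ⌊4 * (k : ℝ) + s⌋ = 4 * k := by
        rw [Int.floor_eq_iff]; push_cast; constructor <;> linarith
      have e2 : ⌊4 * (k : ℝ) + 3 - s⌋ = 4 * k + 2 := by
        rw [Int.floor_eq_iff]; push_cast; constructor <;> linarith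
      dsimp only
      rw [e1, e2, if_pos (by omega), if_neg (by omega), add_assoc (4 * k)]
      norm_num [mul_assoc]
    | sideB k s hs h =>
      obtain ⟨h0, h1⟩ := side (4 * k + 1) s hs (by push_cast; exact ha.2)
      have e1 : ⌊4 * (k : ℝ) + 1 + s⌋ = 4 * k + 1 := by
        rw [Int.floor_eq_iff]; push_cast; constructor <;> linarith
      have e2 : ⌊4 * (k : ℝ) + 4 - s⌋ = 4 * k + 3 := by
        rw [Int.floor_eq_iff]; push_cast; constructor <;> linarith
      dsimp only
      rw [e1, e2, if_pos (by omega), if_neg (by omega), add_assoc (4 * k)]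
      norm_num [mul_assoc]

lemma IsPolar.isQuotientCoveringMap_proj [TopologicalSpace H] [DiscreteTopology H]
    (hV : IsHolonomy d V) : IsQuotientCoveringMap (hP.proj V) H where
  toIsQuotientMap := by
    have h1 : IsQuotientMap fun a : Strip × H => P a.1 :=
      hP.isQuotientMap.comp (isOpenMap_fst.isQuotientMap continuous_fst Prod.fst_surjective)
    exact IsQuotientMap.of_comp (f := fun a : Strip × H => Cover.mk d V a.1 a.2)
      Cover.continuous_mk
      (continuous_quot_lift _ (P.continuous.comp continuous_fst)) h1
  toContinuousConstSMul := ⟨fun g => continuous_quot_lift _ <| by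
    exact Cover.continuous_mk.comp
      (f := fun a : Strip × H => (a.1, g * a.2)) (by
        exact Continuous.prodMk continuous_fst (continuous_of_discreteTopology.comp continuous_snd))⟩
  apply_eq_iff_mem_orbit := by
    intro e₁ e₂
    obtain ⟨x, h, rfl⟩ := e₁.exists_mk
    obtain ⟨y, k, rfl⟩ := e₂.exists_mk
    constructor
    · intro e
      obtain ⟨A, hA⟩ := hP.exists_mk_eq (V := V) e
      exact ⟨h * A * k⁻¹, by simp [hA, Cover.smul_mk]⟩
    · rintro ⟨g, hg⟩
      have := congrArg (hP.proj V) hg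
      exact this.symm
  disjoint e := by
    obtain ⟨x, h, rfl⟩ := e.exists_mk
    by_cases h1 : x.1 = 1
    · have h0 : x.1 ≠ 0 := by rw [h1]; exact one_ne_zero
      by_cases h2 : Int.fract x.2 = 0
      · refine (isSection_vertices hV).exists_nhds ⟨h0, ?_⟩ h
        rw [Int.fract_eq_zero_iff] at h2
        obtain ⟨n, hn⟩ := h2
        rw [← hn, Int.fract_intCast_add]
        norm_num
      · exact (isSection_edges hV).exists_nhds ⟨h0, h2⟩ h
    · exact isSection_interior.exists_nhds h1 h

/-- A homomorphism from the fundamental group of a surface with prescribed holonomy. -/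
lemma IsPolar.exists_hom_of_isHolonomy (hP : IsPolar d P) {x₀ : W} (τ : Tails x₀) (hV : IsHolonomy d V) :
    ∃ φ : FundamentalGroup W x₀ →* H, ∀ m n : ℤ,
      φ (pathLoop τ P (1, m) (1, n)) = V m * (V n)⁻¹ := by
  let : TopologicalSpace H := ⊥
  have : DiscreteTopology H := ⟨rfl⟩
  have hp := hP.isQuotientCoveringMap_proj (V := V) hV
  let M {x y : W} (γ : FundamentalGroupoid.mk x ⟶ FundamentalGroupoid.mk y) :
      hP.proj V ⁻¹' {x} → hP.proj V ⁻¹' {y} := hp.isCoveringMap.monodromy γ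
  have M_comp : ∀ {x y z : W} (γ : FundamentalGroupoid.mk x ⟶ FundamentalGroupoid.mk y)
      (γ' : FundamentalGroupoid.mk y ⟶ FundamentalGroupoid.mk z) (e), M (γ ≫ γ') e = M γ' (M γ e) :=
    fun γ γ' e => hp.isCoveringMap.monodromy_trans_apply γ γ' e
  have M_inv : ∀ {x y : W} (γ : FundamentalGroupoid.mk x ⟶ FundamentalGroupoid.mk y) (e),
      M (Groupoid.inv γ) (M γ e) = e := fun γ e => by
    rw [← M_comp, Groupoid.comp_inv]
    exact congrFun hp.isCoveringMap.monodromy_refl e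
  have M_smul : ∀ {x y : W} (γ : FundamentalGroupoid.mk x ⟶ FundamentalGroupoid.mk y) (g : H)
      (e e' : hP.proj V ⁻¹' {x}), e'.1 = g • e.1 → (M γ e').1 = g • (M γ e).1 := by
    intro x y γ g e e' h
    have h1 : e' = hp.toPermFiber x g e := Subtype.ext h
    have h2 : M γ e' = hp.toPermFiber y g (M γ e) := by
      rw [h1]
      exact hp.monodromy_toPermFiber
    rw [h2]
    rfl
  have M_image : ∀ (p q : Strip) (h : H), M (imageArrow P q p) ⟨Cover.mk d V q h, rfl⟩ =
      ⟨Cover.mk d V p h, rfl⟩ := by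
    intro p q h
    let ψ : C(Strip, Cover d V) :=
      ⟨fun x => Cover.mk d V x h, Cover.continuous_mk.comp (f := fun x => (x, h)) (by fun_prop)⟩
    exact hp.isCoveringMap.monodromy_map (Path.Homotopic.Quotient.map
      (uniqueArrow q p : Path.Homotopic.Quotient q p) ψ)
  obtain ⟨e, he⟩ := hp.surjective x₀
  let e₀ : hP.proj V ⁻¹' {x₀} := ⟨e, he⟩
  -- Transport of the base point of the covering to the fibre over `P p` defines a potential `f p ∈
  -- H`; monodromy along paths of the strip is expressed by its differences.
  have hex : ∀ p : Strip, ∃ h : H, (M (τ (P p)) e₀).1 = Cover.mk d V p h := by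
    intro p
    obtain ⟨y, k, hy⟩ := (M (τ (P p)) e₀).1.exists_mk
    have h1 : hP.proj V (M (τ (P p)) e₀).1 = P p := (M (τ (P p)) e₀).2
    rw [hy] at h1
    obtain ⟨A, hA⟩ := hP.exists_mk_eq (V := V) (h1 : P y = P p)
    exact ⟨k * A, by rw [hy, hA]⟩
  choose f hf using hex
  let φ₀ := hp.fundamentalGroupToMulOpposite e₀
  have hφ₀ : ∀ p q, (φ₀ (pathLoop τ P p q)).unop = f q * (f p)⁻¹ := by
    intro p q
    have h1 : φ₀ (pathLoop τ P p q) = MulOpposite.op (f q * (f p)⁻¹) := by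
      rw [hp.fundamentalGroupToMulOpposite_apply_eq_Iff]
      change _ = (M (τ (P q) ≫ imageArrow P q p ≫ Groupoid.inv (τ (P p))) e₀).1
      rw [M_comp, M_comp]
      have h2 : M (τ (P q)) e₀ = ⟨Cover.mk d V q (f q), rfl⟩ := Subtype.ext (hf q)
      rw [h2, M_image, M_smul _ (f q * (f p)⁻¹) (M (τ (P p)) e₀), M_inv]
      · rfl
      · rw [hf p, Cover.smul_mk, inv_mul_cancel_right]
    rw [h1, MulOpposite.unop_op]
  -- Monodromy is a homomorphism to the opposite group; inversion turns it into one to `H`.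
  let φ₁ : FundamentalGroup W x₀ →* H :=
    { toFun := fun γ => (φ₀ γ).unop⁻¹
      map_one' := by rw [map_one, MulOpposite.unop_one, inv_one]
      map_mul' := fun γ γ' => by rw [map_mul, MulOpposite.unop_mul, _root_.mul_inv_rev] }
  have hφ₁ : ∀ p q, φ₁ (pathLoop τ P p q) = f p * (f q)⁻¹ := fun p q => by
    change (φ₀ (pathLoop τ P p q)).unop⁻¹ = _
    rw [hφ₀]
    group
  have hmem : ∀ n : ℤ, ((1, (n : ℝ)) : Strip) ∈
      {x : Strip | x.1 ≠ 0 ∧ Int.fract (x.2 + 1 / 2) ≠ 0} := fun n => by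
    refine ⟨one_ne_zero, ?_⟩
    rw [Int.fract_intCast_add]
    norm_num
  have hvert : ∀ x y : Strip, P x = P y →
      x ∈ {x : Strip | x.1 ≠ 0 ∧ Int.fract (x.2 + 1 / 2) ≠ 0} →
      f x * (V ⌊x.2 + 1 / 2⌋)⁻¹ = f y * (V ⌊y.2 + 1 / 2⌋)⁻¹ := by
    intro x y h hx
    have h1 : Cover.mk d V x (f x) = Cover.mk d V y (f y) := by
      rw [← hf, ← hf, h]
    exact ((isSection_vertices hV).eq_of_mk_eq h1 hx).2
  have hfl : ∀ n : ℤ, ⌊(n : ℝ) + 1 / 2⌋ = n := fun n => by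
    rw [Int.floor_eq_iff]
    constructor <;> linarith
  -- The sheet label of the transported base point depends only on the point of the surface. All
  -- vertices are one point, so `f` and `V` differ on vertices by one constant on the left, which
  -- the final conjugation removes.
  have hV' : ∀ m n : ℤ, P (1, m) = P (1, n) → f (1, m) * (V m)⁻¹ = f (1, n) * (V n)⁻¹ := by
    intro m n h
    simpa only [hfl] using hvert _ _ h (hmem m)
  have hA : ∀ (k : ℤ) (s : ℝ), s ∈ Set.Icc (0 : ℝ) 1 →
      P (1, 4 * k + s) = P (1, 4 * k + 3 - s) := fun k s hs => hP.eq_of_rel (.sideA k s hs)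
  have hB : ∀ (k : ℤ) (s : ℝ), s ∈ Set.Icc (0 : ℝ) 1 →
      P (1, 4 * k + 1 + s) = P (1, 4 * k + 4 - s) := fun k s hs => hP.eq_of_rel (.sideB k s hs)
  have v03 : ∀ k : ℤ, P (1, ((4 * k : ℤ) : ℝ)) = P (1, ((4 * k + 3 : ℤ) : ℝ)) := fun k => by
    simpa using hA k 0 (by simp)
  have v12 : ∀ k : ℤ, P (1, ((4 * k + 1 : ℤ) : ℝ)) = P (1, ((4 * k + 2 : ℤ) : ℝ)) := fun k => by
    have := hA k 1 (by simp)
    push_cast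
    rw [this]
    congr 2
    ring
  have v14 : ∀ k : ℤ, P (1, ((4 * k + 1 : ℤ) : ℝ)) = P (1, ((4 * k + 4 : ℤ) : ℝ)) := fun k => by
    simpa using hB k 0 (by simp)
  have v23 : ∀ k : ℤ, P (1, ((4 * k + 2 : ℤ) : ℝ)) = P (1, ((4 * k + 3 : ℤ) : ℝ)) := fun k => by
    have := hB k 1 (by simp)
    push_cast
    rw [show (4 * k + 2 : ℝ) = 4 * k + 1 + 1 by ring, this]
    congr 2
    ring
  have v4 : ∀ k : ℤ, P (1, ((4 * k : ℤ) : ℝ)) = P (1, 0) := by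
    have step : ∀ k : ℤ, P (1, ((4 * k : ℤ) : ℝ)) = P (1, ((4 * (k + 1) : ℤ) : ℝ)) := fun k => by
      rw [v03, ← v23, ← v12, v14, mul_add, mul_one]
    intro k
    induction k using Int.induction_on with
    | zero => simp
    | succ k ih => rw [← step, ih]
    | pred k ih => rw [step, sub_add_cancel, ih]
  have v : ∀ n : ℤ, P (1, (n : ℝ)) = P (1, 0) := by
    intro n
    obtain ⟨k, h⟩ : ∃ k : ℤ, n = 4 * k ∨ n = 4 * k + 1 ∨ n = 4 * k + 2 ∨ n = 4 * k + 3 :=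
      ⟨n / 4, by omega⟩
    rcases h with rfl | rfl | rfl | rfl
    · exact v4 k
    · rw [v12, v23, ← v03, v4]
    · rw [v23, ← v03, v4]
    · rw [← v03, v4]
  refine ⟨(MulAut.conj (f (1, 0) * (V 0)⁻¹)⁻¹).toMonoidHom.comp φ₁, fun m n => ?_⟩
  have hm := hV' m 0 (by rw [v, v])
  have hn := hV' n 0 (by rw [v, v])
  rw [Int.cast_zero] at hm hn
  simp only [MonoidHom.comp_apply, hφ₁, MulEquiv.coe_toMonoidHom, MulAut.conj_apply, inv_inv]
  rw [eq_mul_of_mul_inv_eq hm, eq_mul_of_mul_inv_eq hn]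
  group

end Cover

/-! ### The one-relator presentation of the fundamental group -/

section Presentation

open scoped commutatorElement

variable {H : Type*} [Group H]

/-- The values at the vertices of a polygon whose sides have the given holonomies. -/
def vertexValue (x y : ℕ → H) (m : ℕ) : H :=
  (![1, (x (m / 4))⁻¹, (y (m / 4))⁻¹ * (x (m / 4))⁻¹,
    x (m / 4) * (y (m / 4))⁻¹ * (x (m / 4))⁻¹] : Fin 4 → H) (Fin.ofNat 4 m) *
    ((List.ofFn fun j : Fin (m / 4) => ⁅x j, y j⁆).prod)⁻¹

lemma vertexValue_zero (x y : ℕ → H) (k : ℕ) :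
    vertexValue x y (4 * k) = ((List.ofFn fun j : Fin k => ⁅x j, y j⁆).prod)⁻¹ := by
  have h1 : 4 * k / 4 = k := by omega
  have h2 : Fin.ofNat 4 (4 * k) = 0 := by ext; simp
  rw [vertexValue, h1, h2]
  simp

lemma vertexValue_one (x y : ℕ → H) (k : ℕ) :
    vertexValue x y (4 * k + 1) = (x k)⁻¹ * vertexValue x y (4 * k) := by
  rw [vertexValue_zero]
  have h1 : (4 * k + 1) / 4 = k := by omega
  have h2 : Fin.ofNat 4 (4 * k + 1) = 1 := by ext; simp
  rw [vertexValue, h1, h2]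
  simp

lemma vertexValue_two (x y : ℕ → H) (k : ℕ) :
    vertexValue x y (4 * k + 2) = (y k)⁻¹ * (x k)⁻¹ * vertexValue x y (4 * k) := by
  rw [vertexValue_zero]
  have h1 : (4 * k + 2) / 4 = k := by omega
  have h2 : Fin.ofNat 4 (4 * k + 2) = 2 := by ext; simp
  rw [vertexValue, h1, h2]
  simp

lemma vertexValue_three (x y : ℕ → H) (k : ℕ) :
    vertexValue x y (4 * k + 3) = x k * (y k)⁻¹ * (x k)⁻¹ * vertexValue x y (4 * k) := by
  rw [vertexValue_zero]
  have h1 : (4 * k + 3) / 4 = k := by omega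
  have h2 : Fin.ofNat 4 (4 * k + 3) = 3 := by ext; simp
  rw [vertexValue, h1, h2]
  simp

lemma vertexValue_four (x y : ℕ → H) (k : ℕ) :
    vertexValue x y (4 * k + 4) = y k * x k * (y k)⁻¹ * (x k)⁻¹ * vertexValue x y (4 * k) := by
  rw [show 4 * k + 4 = 4 * (k + 1) by ring, vertexValue_zero, vertexValue_zero,
    List.ofFn_succ', List.concat_eq_append, List.prod_append, List.prod_singleton]
  simp [commutatorElement_def, mul_assoc]

variable {d : ℕ}

/-- The relation says that the vertex values return to `1` after `4d` steps, so they extend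
periodically to all integers. -/
lemma exists_isHolonomy (hd : 1 ≤ d) (x y : ℕ → H)
    (h : (List.ofFn fun k : Fin d => ⁅x k, y k⁆).prod = 1) :
    ∃ V : ℤ → H, IsHolonomy d V ∧
      ∀ k : ℕ, k < d → ∀ i : ℕ, i ≤ 4 → V (4 * k + i) = vertexValue x y (4 * k + i) := by
  let V : ℤ → H := fun n => vertexValue x y (n % (4 * d)).toNat
  have hV : ∀ (k : ℤ) (i : ℕ), i ≤ 4 → V (4 * k + i) = vertexValue x y (4 * (k % d).toNat + i) := by
    intro k i hi
    have hd' : (0 : ℤ) < d := by omega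
    have h0 := Int.emod_nonneg k hd'.ne'
    have h1 := Int.emod_lt_of_pos k hd'
    have hk : 4 * k + i = 4 * (k % d) + i + 4 * d * (k / d) := by
      rw [Int.emod_def]; ring
    simp only [V]
    rw [hk, Int.add_mul_emod_self_left]
    -- The range `i ≤ 4` includes the last corner `4d` of the last handle, where the residue wraps
    -- to `0` and the relation is used.
    by_cases hlt : 4 * (k % d) + i < 4 * d
    · rw [Int.emod_eq_of_lt (by omega) hlt]
      congr 1
      omega
    · have e : 4 * (k % d) + i = 4 * d := by omega
      have e' : 4 * (k % d).toNat + i = 4 * d := by omega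
      rw [e, e', Int.emod_self, vertexValue_zero, h]
      exact (vertexValue_zero x y 0).trans (by simp)
  have hV0 : ∀ k : ℤ, V (4 * k) = vertexValue x y (4 * (k % d).toNat) := fun k => by
    simpa using hV k 0 (by norm_num)
  have hV1 : ∀ k : ℤ, V (4 * k + 1) = vertexValue x y (4 * (k % d).toNat + 1) := fun k => by
    simpa using hV k 1 (by norm_num)
  have hV2 : ∀ k : ℤ, V (4 * k + 2) = vertexValue x y (4 * (k % d).toNat + 2) := fun k => by
    simpa using hV k 2 (by norm_num)
  have hV3 : ∀ k : ℤ, V (4 * k + 3) = vertexValue x y (4 * (k % d).toNat + 3) := fun k => by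
    simpa using hV k 3 (by norm_num)
  have hV4 : ∀ k : ℤ, V (4 * k + 4) = vertexValue x y (4 * (k % d).toNat + 4) := fun k => by
    simpa using hV k 4 (by norm_num)
  refine ⟨V, ⟨?_, ?_, ?_⟩, ?_⟩
  · intro n m
    simp only [V]
    rw [mul_comm m, Int.add_mul_emod_self_left]
  · intro k
    rw [hV0, hV1, hV2, hV3, vertexValue_one, vertexValue_two, vertexValue_three]
    group
  · intro k
    rw [hV1, hV2, hV3, hV4, vertexValue_one, vertexValue_two, vertexValue_three, vertexValue_four]
    group
  · intro k hk i hi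
    rw [hV k i hi]
    congr 2
    rw [Int.emod_eq_of_lt (by omega) (by omega)]
    simp

variable {W : Type} [TopologicalSpace W] {P : C(Strip, W)} {x₀ : W}

/-- Homomorphisms from the fundamental group of a surface with prescribed values on the sides. -/
lemma IsPolar.exists_hom (hd : 1 ≤ d) (hP : IsPolar d P) (τ : Tails x₀) (x y : Fin d → H)
    (h : (List.ofFn fun k : Fin d => ⁅x k, y k⁆).prod = 1) :
    ∃ φ : FundamentalGroup W x₀ →* H, ∀ k : Fin d,
      φ (sideA τ P (k : ℕ)) = x k ∧ φ (sideB τ P (k : ℕ)) = y k := by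
  let x' : ℕ → H := fun k => if h : k < d then x ⟨k, h⟩ else 1
  let y' : ℕ → H := fun k => if h : k < d then y ⟨k, h⟩ else 1
  have hx : ∀ k : Fin d, x' k = x k := fun k => by simp [x']
  have hy : ∀ k : Fin d, y' k = y k := fun k => by simp [y']
  obtain ⟨V, hV, hV'⟩ := exists_isHolonomy hd x' y' (by simpa only [hx, hy] using h)
  obtain ⟨φ, hφ⟩ := hP.exists_hom_of_isHolonomy τ hV
  have hV0 : ∀ k : Fin d, V (4 * (k : ℕ)) = vertexValue x' y' (4 * k) := fun k => by
    simpa using hV' k k.2 0 (by norm_num)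
  have hV1 : ∀ k : Fin d, V (4 * (k : ℕ) + 1) = vertexValue x' y' (4 * k + 1) := fun k => by
    simpa using hV' k k.2 1 (by norm_num)
  have hV2 : ∀ k : Fin d, V (4 * (k : ℕ) + 2) = vertexValue x' y' (4 * k + 2) := fun k => by
    simpa using hV' k k.2 2 (by norm_num)
  refine ⟨φ, fun k => ⟨?_, ?_⟩⟩
  · have h1 := hφ (4 * (k : ℕ)) (4 * (k : ℕ) + 1)
    rw [hV0, hV1, vertexValue_one, hx] at h1
    push_cast at h1
    rw [sideA]
    push_cast
    rw [h1]
    group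
  · have h1 := hφ (4 * (k : ℕ) + 1) (4 * (k : ℕ) + 2)
    rw [hV2, hV1, vertexValue_one, vertexValue_two, hx, hy] at h1
    push_cast at h1
    rw [sideB]
    push_cast
    rw [h1]
    group

lemma IsPolar.hom_ext (hd : 1 ≤ d) (hP : IsPolar d P) (τ : Tails x₀)
    {φ ψ : FundamentalGroup W x₀ →* H}
    (hA : ∀ k : Fin d, φ (sideA τ P (k : ℕ)) = ψ (sideA τ P (k : ℕ)))
    (hB : ∀ k : Fin d, φ (sideB τ P (k : ℕ)) = ψ (sideB τ P (k : ℕ))) : φ = ψ := by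
  have h := hP.eq_top_of_sides_mem τ hd (S := φ.eqLocus ψ) hA hB
  ext x
  have hx : x ∈ φ.eqLocus ψ := by rw [h]; trivial
  exact hx

lemma IsPolar.exists_hom_iff (hd : 1 ≤ d) (hP : IsPolar d P) (τ : Tails x₀) (x y : Fin d → H) :
    (∃ φ : FundamentalGroup W x₀ →* H, ∀ k : Fin d,
      φ (sideA τ P (k : ℕ)) = x k ∧ φ (sideB τ P (k : ℕ)) = y k) ↔
      (List.ofFn fun k : Fin d => ⁅x k, y k⁆).prod = 1 := by
  refine ⟨?_, hP.exists_hom hd τ x y⟩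
  rintro ⟨φ, hφ⟩
  have h := congrArg φ (hP.prod_commutator_sides τ)
  rw [map_list_prod, List.map_ofFn, map_one] at h
  have e : (φ ∘ fun k : Fin d => ⁅sideA τ P (k : ℕ), sideB τ P (k : ℕ)⁆) =
      fun k => ⁅x k, y k⁆ := funext fun k => by
    rw [Function.comp_apply, map_commutatorElement, (hφ k).1, (hφ k).2]
  rwa [e] at h

end Presentation

/-! ### A cycle of a surface -/

section Cycle

variable {W : Type} [TopologicalSpace W]

/-- The singular simplex given by a continuous map. -/
def Simp.ofMap {n : ℕ} (f : C(stdSimplex ℝ (Fin (n + 1)), W)) : Simp W n :=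
  (TopCat.toSSetObjEquiv (TopCat.of W) (.op (SimplexCategory.mk n))).symm f

@[simp] lemma Simp.toMap_ofMap {n : ℕ} (f : C(stdSimplex ℝ (Fin (n + 1)), W)) :
    (Simp.ofMap f).toMap = f :=
  Equiv.apply_symm_apply _ _

lemma Simp.δ_ofMap {n : ℕ} (f : C(stdSimplex ℝ (Fin (n + 2)), W)) (i : Fin (n + 2)) :
    (singularSet W).δ i (Simp.ofMap f) =
      Simp.ofMap (f.comp ⟨_, stdSimplex.continuous_map i.succAbove⟩) := by
  refine (TopCat.toSSetObjEquiv (TopCat.of W) (.op (SimplexCategory.mk n))).injective ?_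
  exact (Simp.toMap_δ _ _).trans (by rw [Simp.toMap_ofMap]; exact (Simp.toMap_ofMap _).symm)

/-- A barycentric coordinate as a number in the unit interval. -/
def barycentric {n : ℕ} (i : Fin (n + 1)) (x : stdSimplex ℝ (Fin (n + 1))) : unitInterval :=
  ⟨x i, x.2.1 i, by
    have h := Finset.single_le_sum (fun j _ => x.2.1 j) (Finset.mem_univ i)
    rw [x.2.2] at h
    exact h⟩

lemma continuous_coord {n : ℕ} (i : Fin (n + 1)) :
    Continuous fun x : stdSimplex ℝ (Fin (n + 1)) => x i :=
  (continuous_apply i).comp continuous_subtype_val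

lemma continuous_barycentric {n : ℕ} (i : Fin (n + 1)) :
    Continuous (barycentric (n := n) i) :=
  (continuous_coord i).subtype_mk _

/-- The affine triangle with vertices `(0, a)`, `(1, a)`, `(1, b)` in the strip. -/
def upperTriangle (a b : ℝ) : C(stdSimplex ℝ (Fin 3), Strip) where
  toFun x := (unitInterval.symm (barycentric 0 x), a + x 2 * (b - a))
  continuous_toFun := (unitInterval.continuous_symm.comp (continuous_barycentric 0)).prodMk
    (continuous_const.add ((continuous_coord 2).mul continuous_const))

/-- The affine triangle with vertices `(0, a)`, `(0, b)`, `(1, b)` in the strip. -/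
def lowerTriangle (a b : ℝ) : C(stdSimplex ℝ (Fin 3), Strip) where
  toFun x := (barycentric 2 x, b - x 0 * (b - a))
  continuous_toFun := (continuous_barycentric 2).prodMk
    (continuous_const.sub ((continuous_coord 0).mul continuous_const))

/-- The affine path from `(1, a)` to `(1, b)`. -/
def sideEdge (a b : ℝ) : C(stdSimplex ℝ (Fin 2), Strip) where
  toFun x := (1, a + x 1 * (b - a))
  continuous_toFun := continuous_const.prodMk
    (continuous_const.add ((continuous_coord 1).mul continuous_const))

/-- The affine path from `(0, a)` to `(1, b)`. -/
def spokeEdge (a b : ℝ) : C(stdSimplex ℝ (Fin 2), Strip) where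
  toFun x := (barycentric 1 x, a + x 1 * (b - a))
  continuous_toFun := (continuous_barycentric 1).prodMk
    (continuous_const.add ((continuous_coord 1).mul continuous_const))

/-- The affine path from `(0, a)` to `(0, b)`. -/
def centerEdge (a b : ℝ) : C(stdSimplex ℝ (Fin 2), Strip) where
  toFun x := (0, a + x 1 * (b - a))
  continuous_toFun := continuous_const.prodMk
    (continuous_const.add ((continuous_coord 1).mul continuous_const))

/-- The `i`-th face of the standard triangle. -/
def triangleFace (i : Fin 3) : C(stdSimplex ℝ (Fin 2), stdSimplex ℝ (Fin 3)) :=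
  ⟨_, stdSimplex.continuous_map i.succAbove⟩

lemma triangleFace_apply (i j : Fin 3) (x : stdSimplex ℝ (Fin 2)) :
    triangleFace i x j = ∑ k : Fin 2, if i.succAbove k = j then x k else 0 := by
  change stdSimplex.map i.succAbove x j = _
  rw [stdSimplex.map_coe, FunOnFinite.linearMap_apply_apply, Finset.sum_filter]

lemma edge_sum (x : stdSimplex ℝ (Fin 2)) : x 0 = 1 - x 1 := by
  have h := x.2.2
  rw [Fin.sum_univ_two] at h
  exact eq_sub_of_add_eq h

lemma triangleFace_zero (x : stdSimplex ℝ (Fin 2)) : triangleFace 0 x 0 = 0 ∧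
    triangleFace 0 x 1 = x 0 ∧ triangleFace 0 x 2 = x 1 := by
  simp [triangleFace_apply, Fin.sum_univ_two]

lemma triangleFace_one (x : stdSimplex ℝ (Fin 2)) : triangleFace 1 x 0 = x 0 ∧
    triangleFace 1 x 1 = 0 ∧ triangleFace 1 x 2 = x 1 := by
  have h0 : (1 : Fin 3).succAbove (0 : Fin 2) = 0 := rfl
  have h1 : (1 : Fin 3).succAbove (1 : Fin 2) = 2 := rfl
  simp [triangleFace_apply, Fin.sum_univ_two, h0, h1]

lemma triangleFace_two (x : stdSimplex ℝ (Fin 2)) : triangleFace 2 x 0 = x 0 ∧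
    triangleFace 2 x 1 = x 1 ∧ triangleFace 2 x 2 = 0 := by
  have h0 : (2 : Fin 3).succAbove (0 : Fin 2) = 0 := rfl
  have h1 : (2 : Fin 3).succAbove (1 : Fin 2) = 1 := rfl
  simp [triangleFace_apply, Fin.sum_univ_two, h0, h1]

lemma face_upperTriangle_zero (a b : ℝ) :
    (upperTriangle a b).comp (triangleFace 0) = sideEdge a b := by
  ext x
  · simp [upperTriangle, sideEdge, barycentric, triangleFace_zero x]
  · simp [upperTriangle, sideEdge, triangleFace_zero x]

lemma face_upperTriangle_one (a b : ℝ) :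
    (upperTriangle a b).comp (triangleFace 1) = spokeEdge a b := by
  ext x
  · simp [upperTriangle, spokeEdge, barycentric, triangleFace_one x, edge_sum]
  · simp [upperTriangle, spokeEdge, triangleFace_one x]

lemma face_upperTriangle_two (a b : ℝ) :
    (upperTriangle a b).comp (triangleFace 2) = spokeEdge a a := by
  ext x
  · simp [upperTriangle, spokeEdge, barycentric, triangleFace_two x, edge_sum]
  · simp [upperTriangle, spokeEdge, triangleFace_two x]

lemma face_lowerTriangle_zero (a b : ℝ) :
    (lowerTriangle a b).comp (triangleFace 0) = spokeEdge b b := by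
  ext x
  · simp [lowerTriangle, spokeEdge, barycentric, triangleFace_zero x]
  · simp [lowerTriangle, spokeEdge, triangleFace_zero x]

lemma face_lowerTriangle_one (a b : ℝ) :
    (lowerTriangle a b).comp (triangleFace 1) = spokeEdge a b := by
  ext x
  · simp [lowerTriangle, spokeEdge, barycentric, triangleFace_one x, edge_sum]
  · simp [lowerTriangle, spokeEdge, triangleFace_one x, edge_sum]
    ring

lemma face_lowerTriangle_two (a b : ℝ) :
    (lowerTriangle a b).comp (triangleFace 2) = centerEdge a b := by
  ext x
  · simp [lowerTriangle, centerEdge, barycentric, triangleFace_two x, edge_sum]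
  · simp [lowerTriangle, centerEdge, triangleFace_two x, edge_sum]
    ring

/-- The generator of the singular chains given by a singular simplex of the strip. -/
def stripChain {n : ℕ} (P : C(Strip, W)) (f : C(stdSimplex ℝ (Fin (n + 1)), Strip)) :
    ModuleCat.of ℤ ℤ ⟶ (singularChains W).X n :=
  (singularSet W).ιChainComplex (R := ModuleCat.of ℤ ℤ) (Simp.ofMap (P.comp f))

lemma stripChain_d (P : C(Strip, W)) (f : C(stdSimplex ℝ (Fin 3), Strip)) :
    stripChain P f ≫ (singularChains W).d 2 1 = stripChain P (f.comp (triangleFace 0)) -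
      stripChain P (f.comp (triangleFace 1)) + stripChain P (f.comp (triangleFace 2)) := by
  rw [stripChain, SSet.ιChainComplex_d, Fin.sum_univ_three]
  simp only [Simp.δ_ofMap, stripChain]
  rw [show ((0 : Fin 3) : ℕ) = 0 from rfl, show ((1 : Fin 3) : ℕ) = 1 from rfl,
    show ((2 : Fin 3) : ℕ) = 2 from rfl, pow_zero, pow_one, one_smul, neg_smul, one_smul,
    neg_one_sq, one_smul, ← sub_eq_add_neg]
  rfl

/-- The image of the rectangle between the angular parameters `a` and `b`. -/
def rectangle (P : C(Strip, W)) (a b : ℝ) : ModuleCat.of ℤ ℤ ⟶ (singularChains W).X 2 :=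
  stripChain P (upperTriangle a b) - stripChain P (lowerTriangle a b)

variable {d : ℕ} {P : C(Strip, W)}

/-- The diagonals of the two triangles cancel. The edge at radius `0` is a constant simplex at the
centre, the same for every rectangle, and is kept as one correction term. -/
lemma IsPolar.rectangle_d (hP : IsPolar d P) (a b : ℝ) :
    rectangle P a b ≫ (singularChains W).d 2 1 = stripChain P (sideEdge a b) +
      stripChain P (spokeEdge a a) - stripChain P (spokeEdge b b) -
        stripChain P (centerEdge 0 0) := by
  have h : P.comp (centerEdge a b) = P.comp (centerEdge 0 0) := by
    ext x
    exact hP.eq_of_rel (.center _ _)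
  have h' : stripChain P (centerEdge a b) = stripChain P (centerEdge 0 0) := by
    rw [stripChain, h, stripChain]
  rw [rectangle, Preadditive.sub_comp, stripChain_d, stripChain_d, face_upperTriangle_zero,
    face_upperTriangle_one, face_upperTriangle_two, face_lowerTriangle_zero,
    face_lowerTriangle_one, face_lowerTriangle_two, h']
  abel

/-- The part of the fundamental cycle given by four consecutive sides. -/
def handle (P : C(Strip, W)) (k : ℕ) : ModuleCat.of ℤ ℤ ⟶ (singularChains W).X 2 :=
  rectangle P (4 * k) (4 * k + 1) + rectangle P (4 * k + 1) (4 * k + 2) -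
    rectangle P (4 * k + 3) (4 * k + 2) - rectangle P (4 * k + 4) (4 * k + 3)

/-- The last two rectangles are traversed backwards and subtracted, so glued sides and centre terms
cancel in pairs and only the two extreme spokes survive. These telescope over the handles, and the
first and last spokes agree by a full turn. -/
lemma IsPolar.handle_d (hP : IsPolar d P) (k : ℕ) :
    handle P k ≫ (singularChains W).d 2 1 = stripChain P (spokeEdge (4 * k) (4 * k)) -
      stripChain P (spokeEdge (4 * (k + 1 : ℕ)) (4 * (k + 1 : ℕ))) := by
  have hA : stripChain P (sideEdge (4 * k) (4 * k + 1)) =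
      stripChain P (sideEdge (4 * k + 3) (4 * k + 2)) := by
    rw [stripChain, stripChain]
    congr 2
    ext x
    have := hP.eq_of_rel (.sideA k (x 1) (barycentric 1 x).2)
    simp only [ContinuousMap.comp_apply, sideEdge, ContinuousMap.coe_mk]
    push_cast at this
    convert this using 3 <;> ring
  have hB : stripChain P (sideEdge (4 * k + 1) (4 * k + 2)) =
      stripChain P (sideEdge (4 * k + 4) (4 * k + 3)) := by
    rw [stripChain, stripChain]
    congr 2
    ext x
    have := hP.eq_of_rel (.sideB k (x 1) (barycentric 1 x).2)
    simp only [ContinuousMap.comp_apply, sideEdge, ContinuousMap.coe_mk]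
    push_cast at this
    convert this using 3 <;> ring
  rw [handle, Preadditive.sub_comp, Preadditive.sub_comp, Preadditive.add_comp, hP.rectangle_d,
    hP.rectangle_d, hP.rectangle_d, hP.rectangle_d, hA, hB]
  push_cast
  rw [mul_add, mul_one]
  abel

/-- The cycle given by the polygon. -/
def polygonCycle (P : C(Strip, W)) (d : ℕ) : ModuleCat.of ℤ ℤ ⟶ (singularChains W).X 2 :=
  ∑ k ∈ Finset.range d, handle P k

lemma IsPolar.polygonCycle_d (hP : IsPolar d P) :
    polygonCycle P d ≫ (singularChains W).d 2 1 = 0 := by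
  rw [polygonCycle, Preadditive.sum_comp, Finset.sum_congr rfl fun k _ => hP.handle_d k,
    Finset.sum_range_sub' fun k : ℕ => stripChain P (spokeEdge (4 * k) (4 * k)), sub_eq_zero]
  rw [stripChain, stripChain]
  congr 2
  ext x
  have := hP.eq_of_rel (.turn (barycentric 1 x) 0 1)
  simp only [ContinuousMap.comp_apply, spokeEdge, ContinuousMap.coe_mk]
  convert this using 3 <;> simp

/-- The homology class of the polygon. -/
def IsPolar.homologyClass (hP : IsPolar d P) : singularH2 W :=
  ((singularChains W).liftCycles (polygonCycle P d) 1 (by simp) hP.polygonCycle_d ≫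
    (singularChains W).homologyπ 2).hom (1 : ℤ)

lemma IsPolar.evalCocycle_homologyClass [PathConnectedSpace W] (hP : IsPolar d P) (x₀ : W)
    (c : Z2 (FundamentalGroup W x₀)) : (evalCocycle x₀ c).hom hP.homologyClass =
      (polygonCycle P d ≫ pullCochain x₀ c).hom (1 : ℤ) := by
  have h : ((singularChains W).liftCycles (polygonCycle P d) 1 (by simp) hP.polygonCycle_d ≫
      (singularChains W).homologyπ 2) ≫ evalCocycle x₀ c = polygonCycle P d ≫ pullCochain x₀ c := by
    rw [evalCocycle]
    simp
  rw [← h]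
  rfl

end Cycle

/-! ### Evaluation of cocycles and central extensions -/

section Extension

variable {Q : Type*} [Group Q] {E : Type*} [Group E]

/-- A map `s` from `Q` to a group `E` with a central subgroup `ℂ*` that is multiplicative up to the
2-cocycle `c`. -/
structure IsTwistedHom (c : Z2 Q) (i : ℂˣ →* E) (s : Q → E) : Prop where
  injective : Function.Injective i
  comm : ∀ z e, i z * e = e * i z
  mul : ∀ x y, s x * s y = i (c.1 (x, y)) * s (x * y)

variable {c : Z2 Q} {i : ℂˣ →* E} {s : Q → E}

lemma Z2.one_apply (c : Z2 Q) (x : Q) : c.1 (1, x) = c.1 (1, 1) := by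
  have h := c.2 1 1 x
  rw [one_mul, one_mul] at h
  exact (mul_left_cancel h).symm

lemma IsTwistedHom.apply_one (h : IsTwistedHom c i s) : s 1 = i (c.1 (1, 1)) := by
  have := h.mul 1 1
  rw [one_mul] at this
  exact mul_right_cancel this

lemma IsTwistedHom.map_cocycle (h : IsTwistedHom c i s) (x y : Q) :
    i (c.1 (x, y)) = s x * s y * (s (x * y))⁻¹ := by
  rw [h.mul, mul_inv_cancel_right]

/-- The elements on which a homomorphism agrees with a twisted homomorphism up to scalars. -/
def IsTwistedHom.agreement (h : IsTwistedHom c i s) (φ : Q →* E) : Subgroup Q where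
  carrier := {x | ∃ z, φ x = i z * s x}
  one_mem' := ⟨(c.1 (1, 1))⁻¹, by rw [map_one, h.apply_one, ← map_mul]; simp⟩
  mul_mem' := by
    rintro x y ⟨z, hz⟩ ⟨w, hw⟩
    refine ⟨z * w * c.1 (x, y), ?_⟩
    rw [map_mul, hz, hw, map_mul, map_mul, mul_assoc (i z * i w), ← h.mul, mul_assoc, mul_assoc,
      ← mul_assoc (s x), ← h.comm, mul_assoc]
  inv_mem' := by
    rintro x ⟨z, hz⟩
    refine ⟨z⁻¹ * (c.1 (x, x⁻¹))⁻¹ * (c.1 (1, 1))⁻¹, ?_⟩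
    have h1 := h.mul x x⁻¹
    rw [mul_inv_cancel, h.apply_one] at h1
    rw [map_inv, inv_eq_iff_mul_eq_one, hz, map_mul, map_mul, map_inv, map_inv, map_inv,
      mul_assoc (_ * _) _ (s x⁻¹), h.comm z]
    have h2 : i z * ((i z)⁻¹ * (i (c.1 (x, x⁻¹)))⁻¹ * ((i (c.1 (1, 1)))⁻¹ * s x⁻¹)) =
        (i (c.1 (x, x⁻¹)))⁻¹ * (i (c.1 (1, 1)))⁻¹ * s x⁻¹ := by group
    have h3 : ∀ w, s x * (i w)⁻¹ = (i w)⁻¹ * s x := fun w => by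
      rw [← map_inv, h.comm]
    rw [mul_assoc, h2, ← mul_assoc, ← mul_assoc, h3, mul_assoc _ (s x), h3, ← mul_assoc,
      mul_assoc _ (s x), h1, ← map_inv, ← map_inv, ← map_mul, ← map_mul, ← map_mul]
    rw [show (c.1 (x, x⁻¹))⁻¹ * (c.1 (1, 1))⁻¹ * (c.1 (x, x⁻¹) * c.1 (1, 1)) = 1 by
      rw [← mul_inv, inv_mul_cancel], map_one]

/-- If `φ = l · s` with scalars `l`, multiplicativity of `φ` gives `l(xy) = l(x) l(y) c(x, y)`, so
`c` is the coboundary of `l⁻¹`. -/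
lemma IsTwistedHom.exists_cobound (h : IsTwistedHom c i s) (φ : Q →* E)
    (hφ : h.agreement φ = ⊤) : ∃ l, cobound Q l = c.1 := by
  have h1 : ∀ x, ∃ z, φ x = i z * s x := fun x => by
    have : x ∈ h.agreement φ := by rw [hφ]; trivial
    exact this
  choose l hl using h1
  have h2 : ∀ x y, l (x * y) = l x * l y * c.1 (x, y) := by
    intro x y
    apply h.injective
    have h3 := hl (x * y)
    rw [map_mul, hl, hl] at h3
    rw [← mul_left_inj (s (x * y)), ← h3, map_mul, map_mul, mul_assoc (i (l x) * _), ← h.mul,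
      mul_assoc, mul_assoc, ← mul_assoc (s x), ← h.comm, mul_assoc]
  refine ⟨fun x => (l x)⁻¹, ?_⟩
  funext p
  change (l p.2)⁻¹ * ((l (p.1 * p.2))⁻¹)⁻¹ * (l p.1)⁻¹ = c.1 p
  rw [h2, inv_inv, mul_comm (l p.1), mul_assoc (l p.2), inv_mul_cancel_left, mul_comm (l p.1),
    mul_inv_cancel_right]

end Extension

/-! ### Evaluating a cocycle on the polygon -/

section Evaluation

open scoped commutatorElement

variable {W : Type} [TopologicalSpace W] [PathConnectedSpace W] {d : ℕ} {P : C(Strip, W)} {x₀ : W}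
  (c : Z2 (FundamentalGroup W x₀))

/-- The value of the pull-back of a cocycle on a chain. -/
def chainValue (z : ModuleCat.of ℤ ℤ ⟶ (singularChains W).X 2) : ℂˣ :=
  Additive.toMul (α := ℂˣ) ((z ≫ pullCochain x₀ c).hom (1 : ℤ))

lemma chainValue_add (z z' : ModuleCat.of ℤ ℤ ⟶ (singularChains W).X 2) :
    chainValue c (z + z') = chainValue c z * chainValue c z' := by
  rw [chainValue, Preadditive.add_comp]
  rfl

lemma chainValue_sub (z z' : ModuleCat.of ℤ ℤ ⟶ (singularChains W).X 2) :
    chainValue c (z - z') = chainValue c z * (chainValue c z')⁻¹ := by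
  rw [eq_mul_inv_iff_mul_eq, ← chainValue_add, sub_add_cancel]

lemma chainValue_sum (z : ℕ → (ModuleCat.of ℤ ℤ ⟶ (singularChains W).X 2)) (n : ℕ) :
    chainValue c (∑ k ∈ Finset.range n, z k) = ∏ k ∈ Finset.range n, chainValue c (z k) := by
  induction n with
  | zero =>
    rw [Finset.sum_range_zero, Finset.prod_range_zero, chainValue, zero_comp]
    rfl
  | succ n ih => rw [Finset.sum_range_succ, chainValue_add, ih, Finset.prod_range_succ]

lemma chainValue_stripChain (f : C(stdSimplex ℝ (Fin 3), Strip)) :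
    chainValue c (stripChain P f) =
      c.1 (pathLoop (tail x₀) P (f (stdSimplex.vertex 0)) (f (stdSimplex.vertex 1)),
        pathLoop (tail x₀) P (f (stdSimplex.vertex 1)) (f (stdSimplex.vertex 2))) := by
  have h : ∀ j k : Fin 3, (Simp.ofMap (P.comp f)).loop x₀ j k =
      pathLoop (tail x₀) P (f (stdSimplex.vertex j)) (f (stdSimplex.vertex k)) := by
    intro j k
    rw [Simp.loop, Simp.toMap_ofMap, loop_eq_pathLoop, pathLoop_comp]
  rw [chainValue, stripChain, pullCochain, ι_cochain, h, h]
  simp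

/-- The lower triangle has a trivial first edge and contributes only `c(1, 1)`, the defect of
normalization. These factors cancel within a handle. -/
lemma IsPolar.chainValue_rectangle (hP : IsPolar d P) (a b : ℝ) :
    chainValue c (rectangle P a b) =
      c.1 (pathLoop (tail x₀) P (0, a) (1, a), pathLoop (tail x₀) P (1, a) (1, b)) *
        (c.1 (1, 1))⁻¹ := by
  have u0 : upperTriangle a b (stdSimplex.vertex 0) = (0, a) := by
    ext <;> simp [upperTriangle, barycentric]
  have u1 : upperTriangle a b (stdSimplex.vertex 1) = (1, a) := by
    ext <;> simp [upperTriangle, barycentric]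
  have u2 : upperTriangle a b (stdSimplex.vertex 2) = (1, b) := by
    ext <;> simp [upperTriangle, barycentric]
  have l0 : lowerTriangle a b (stdSimplex.vertex 0) = (0, a) := by
    ext <;> simp [lowerTriangle, barycentric]
  have l1 : lowerTriangle a b (stdSimplex.vertex 1) = (0, b) := by
    ext <;> simp [lowerTriangle, barycentric]
  rw [rectangle, chainValue_sub, chainValue_stripChain, chainValue_stripChain, u0, u1, u2, l0, l1,
    hP.pathLoop_center, Z2.one_apply]

variable {E : Type*} [Group E] {c} {i : ℂˣ →* E} {s : FundamentalGroup W x₀ → E}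

/-- In the extension `c(x, y)` becomes `s(x) s(y) s(xy)⁻¹`. With `x` a spoke and `y` a side, the
inner spokes telescope and leave a commutator between the two outer spokes. -/
lemma IsPolar.map_chainValue_handle (hP : IsPolar d P) (h : IsTwistedHom c i s) (k : ℕ) :
    i (chainValue c (handle P k)) = s (pathLoop (tail x₀) P (0, 4 * k) (1, 4 * k)) *
      ⁅s (sideA (tail x₀) P k), s (sideB (tail x₀) P k)⁆ *
      (s (pathLoop (tail x₀) P (0, 4 * (k + 1 : ℕ)) (1, 4 * (k + 1 : ℕ))))⁻¹ := by
  have key : ∀ a b : ℝ,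
      i (c.1 (pathLoop (tail x₀) P (0, a) (1, a), pathLoop (tail x₀) P (1, a) (1, b))) =
        s (pathLoop (tail x₀) P (0, a) (1, a)) * s (pathLoop (tail x₀) P (1, a) (1, b)) *
          (s (pathLoop (tail x₀) P (0, b) (1, b)))⁻¹ := by
    intro a b
    have e : pathLoop (tail x₀) P (0, a) (1, b) = pathLoop (tail x₀) P (0, b) (1, b) := by
      rw [← pathLoop_mul _ P (0, a) (0, b) (1, b), hP.pathLoop_center, one_mul]
    rw [h.map_cocycle, pathLoop_mul, e]
  have hA := hP.sideA_eq (tail x₀) k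
  have hB := hP.sideB_eq (tail x₀) k
  have h1 : ∀ a b c d e : ℂˣ, a * e⁻¹ * (b * e⁻¹) * (c * e⁻¹)⁻¹ * (d * e⁻¹)⁻¹ =
      a * b * c⁻¹ * d⁻¹ := fun a b c d e => by
    rw [_root_.mul_inv_rev, _root_.mul_inv_rev, inv_inv, mul_mul_mul_comm a, mul_comm (a * b),
      mul_comm e, mul_comm e, mul_comm _ (a * b)]
    rw [show a * b * (e⁻¹ * e⁻¹) * (c⁻¹ * e) * (d⁻¹ * e) =
      a * b * c⁻¹ * d⁻¹ * (e⁻¹ * e) * (e⁻¹ * e) by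
        simp only [mul_assoc, mul_left_comm, mul_comm]]
    simp
  rw [handle, chainValue_sub, chainValue_sub, chainValue_add, hP.chainValue_rectangle,
    hP.chainValue_rectangle, hP.chainValue_rectangle, hP.chainValue_rectangle, h1, map_mul, map_mul,
    map_mul, map_inv, map_inv, key, key, key, key]
  push_cast at hA hB
  rw [hA, hB, commutatorElement_def, sideA, sideB]
  push_cast
  rw [mul_add, mul_one]
  group

lemma IsPolar.map_chainValue_polygonCycle (hP : IsPolar d P) (h : IsTwistedHom c i s) :
    i (chainValue c (polygonCycle P d)) = (List.ofFn fun k : Fin d =>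
      ⁅s (sideA (tail x₀) P (k : ℕ)), s (sideB (tail x₀) P (k : ℕ))⁆).prod := by
  rw [prod_ofFn_telescope
    (fun k : ℕ => ⁅s (sideA (tail x₀) P k), s (sideB (tail x₀) P k)⁆)
    (fun k : ℕ => (s (pathLoop (tail x₀) P (0, 4 * k) (1, 4 * k)))⁻¹ *
      (i (∏ j ∈ Finset.range k, chainValue c (handle P j)))⁻¹) ?_ d]
  · have h1 := hP.pathLoop_turn (tail x₀) (0, 0) (1, 0) 1
    simp only [Int.cast_one, one_mul, zero_add] at h1
    rw [h1, polygonCycle, chainValue_sum]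
    simp only [Nat.cast_zero, mul_zero, Finset.range_zero, Finset.prod_empty, map_one, inv_one,
      mul_one, _root_.mul_inv_rev, inv_inv]
    rw [h.comm, inv_mul_cancel_left]
  · intro k
    rw [Finset.prod_range_succ, map_mul, hP.map_chainValue_handle h]
    group

/-- A class of the fundamental group of a surface is trivial on the fundamental class if and only
if the relation between the sides of the polygon holds in the corresponding extension. -/
lemma IsPolar.evaluate_eq_one_iff (hd : 1 ≤ d) (hP : IsPolar d P) (h : IsTwistedHom c i s)
    {fund : singularH2 W} (hfund : IsFundamentalClass W fund) :
    evaluate x₀ fund (QuotientGroup.mk c : H2 (FundamentalGroup W x₀)) = 1 ↔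
      (List.ofFn fun k : Fin d =>
        ⁅s (sideA (tail x₀) P (k : ℕ)), s (sideB (tail x₀) P (k : ℕ))⁆).prod = 1 := by
  have he : evaluate x₀ fund (QuotientGroup.mk c : H2 (FundamentalGroup W x₀)) =
      Additive.toMul (α := ℂˣ) ((evalCocycle x₀ c).hom fund) := rfl
  rw [he, ← hP.map_chainValue_polygonCycle h]
  constructor
  · intro h1
    have h2 : (evalCocycle x₀ c).hom fund = 0 := h1
    -- Only this much is needed of the polygon: its class is some multiple of the fundamental class.
    obtain ⟨m, hm⟩ := hfund hP.homologyClass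
    have h3 : chainValue c (polygonCycle P d) =
        Additive.toMul (α := ℂˣ) ((evalCocycle x₀ c).hom hP.homologyClass) := by
      rw [hP.evalCocycle_homologyClass]
      rfl
    rw [h3, hm, map_zsmul, h2, smul_zero]
    exact map_one i
  · intro h1
    -- The relation in the extension gives a homomorphism agreeing with `s` on the sides, hence up
    -- to scalars everywhere; so the cocycle is a coboundary.
    obtain ⟨φ, hφ⟩ := hP.exists_hom hd (tail x₀)
      (fun k : Fin d => s (sideA (tail x₀) P (k : ℕ)))
      (fun k : Fin d => s (sideB (tail x₀) P (k : ℕ)))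
      (by rw [← hP.map_chainValue_polygonCycle h, h1])
    have htop : h.agreement φ = ⊤ := hP.eq_top_of_sides_mem (tail x₀) hd
      (fun k => ⟨1, by rw [map_one, one_mul, (hφ k).1]⟩)
      (fun k => ⟨1, by rw [map_one, one_mul, (hφ k).2]⟩)
    obtain ⟨l, hl⟩ := h.exists_cobound φ htop
    rw [evalCocycle_cobound x₀ c l hl]
    rfl

end Evaluation

/-! ### Schur's lemma and averages over a finite group -/

section Averages

variable {G : Type u} {G' : Type v} [Group G] [Group G'] {q : G' →* G} {m n : ℕ}
  {ρ : q.ker →* GL (Fin m) ℂ} {σ : q.ker →* GL (Fin n) ℂ}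

lemma IsIrreducible.eq_zero_or_bijective (hρ : IsIrreducible ρ) (hσ : IsIrreducible σ)
    (S : Matrix (Fin m) (Fin n) ℂ)
    (hS : ∀ h, (ρ h : Matrix (Fin m) (Fin m) ℂ) * S = S * (σ h : Matrix (Fin n) (Fin n) ℂ)) :
    S = 0 ∨ Function.Bijective (Matrix.toLin' S) := by
  rcases hσ.2 (LinearMap.ker (Matrix.toLin' S)) (fun h x hx => by
    rw [LinearMap.mem_ker, Matrix.toLin'_apply] at hx ⊢
    rw [Matrix.mulVec_mulVec, ← hS, ← Matrix.mulVec_mulVec, hx, Matrix.mulVec_zero]) with h1 | h1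
  · rcases hρ.2 (LinearMap.range (Matrix.toLin' S)) (fun h x hx => by
      obtain ⟨y, rfl⟩ := hx
      refine ⟨(σ h : Matrix (Fin n) (Fin n) ℂ) *ᵥ y, ?_⟩
      rw [Matrix.toLin'_apply, Matrix.toLin'_apply, Matrix.mulVec_mulVec, Matrix.mulVec_mulVec,
        hS]) with h2 | h2
    · left
      rw [LinearMap.range_eq_bot] at h2
      exact Matrix.toLin'.map_eq_zero_iff.1 h2
    · right
      exact ⟨LinearMap.ker_eq_bot.1 h1, LinearMap.range_eq_top.1 h2⟩
  · left
    rw [LinearMap.ker_eq_top] at h1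
    exact Matrix.toLin'.map_eq_zero_iff.1 h1

lemma isUnit_of_bijective_toLin' (S : Matrix (Fin n) (Fin n) ℂ)
    (hS : Function.Bijective (Matrix.toLin' S)) : IsUnit S := by
  have h := (Module.End.isUnit_iff (Matrix.toLin' S)).2 hS
  exact (MulEquiv.isUnit_map (Matrix.toLinAlgEquiv' : Matrix (Fin n) (Fin n) ℂ ≃ₐ[ℂ] _)).1 h

lemma IsIrreducible.eq_zero_or_isUnit {ρ σ : q.ker →* GL (Fin n) ℂ} (hρ : IsIrreducible ρ)
    (hσ : IsIrreducible σ) (S : Matrix (Fin n) (Fin n) ℂ)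
    (hS : ∀ h, (ρ h : Matrix (Fin n) (Fin n) ℂ) * S = S * (σ h : Matrix (Fin n) (Fin n) ℂ)) :
    S = 0 ∨ IsUnit S :=
  (hρ.eq_zero_or_bijective hσ S hS).imp_right (isUnit_of_bijective_toLin' S)

lemma IsIrreducible.trace_eq_of_ne_zero (hρ : IsIrreducible ρ) (hσ : IsIrreducible σ)
    (S : Matrix (Fin m) (Fin n) ℂ)
    (hS : ∀ h, (ρ h : Matrix (Fin m) (Fin m) ℂ) * S = S * (σ h : Matrix (Fin n) (Fin n) ℂ))
    (h0 : S ≠ 0) :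
    m = n ∧ ∀ h, (ρ h : Matrix (Fin m) (Fin m) ℂ).trace =
      (σ h : Matrix (Fin n) (Fin n) ℂ).trace := by
  have hb := (hρ.eq_zero_or_bijective hσ S hS).resolve_left h0
  have hmn : m = n := by
    have := (LinearEquiv.ofBijective _ hb).finrank_eq
    simpa using this.symm
  subst hmn
  obtain ⟨U, rfl⟩ := isUnit_of_bijective_toLin' S hb
  refine ⟨rfl, fun h => ?_⟩
  have h1 : (ρ h : Matrix (Fin m) (Fin m) ℂ) =
      U * ((σ h : Matrix (Fin m) (Fin m) ℂ) * (U⁻¹ : GL (Fin m) ℂ)) := by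
    rw [← mul_assoc, ← hS, mul_assoc, Units.mul_inv, mul_one]
  rw [h1, Matrix.trace_mul_comm, mul_assoc, Units.inv_mul, mul_one]

variable [Fintype q.ker]

lemma average_intertwines (ρ : q.ker →* GL (Fin m) ℂ) (σ : q.ker →* GL (Fin n) ℂ)
    (M : Matrix (Fin m) (Fin n) ℂ) (l : q.ker) :
    (ρ l : Matrix (Fin m) (Fin m) ℂ) * ∑ h, (ρ h : Matrix (Fin m) (Fin m) ℂ) * M *
      (σ h⁻¹ : Matrix (Fin n) (Fin n) ℂ) = (∑ h, (ρ h : Matrix (Fin m) (Fin m) ℂ) * M *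
      (σ h⁻¹ : Matrix (Fin n) (Fin n) ℂ)) * (σ l : Matrix (Fin n) (Fin n) ℂ) := by
  rw [Matrix.mul_sum, Matrix.sum_mul, ← Equiv.sum_comp (Equiv.mulLeft l)
    (fun h => (ρ h : Matrix (Fin m) (Fin m) ℂ) * M * (σ h⁻¹ : Matrix (Fin n) (Fin n) ℂ) *
      (σ l : Matrix (Fin n) (Fin n) ℂ))]
  refine Finset.sum_congr rfl fun h _ => ?_
  have h1 : (σ (l * h)⁻¹ : Matrix (Fin n) (Fin n) ℂ) * (σ l : Matrix (Fin n) (Fin n) ℂ) =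
      (σ h⁻¹ : Matrix (Fin n) (Fin n) ℂ) := by
    rw [← Units.val_mul, ← map_mul]
    congr 2
    group
  rw [Equiv.coe_mulLeft, Matrix.mul_assoc (_ * M), h1, map_mul, Units.val_mul]
  simp only [Matrix.mul_assoc]

/-- The average commutes with `σ`, so it is a scalar by Schur's lemma; the trace determines which.
-/
lemma IsIrreducible.average (hσ : IsIrreducible σ) (M : Matrix (Fin n) (Fin n) ℂ) :
    ∑ h, (σ h : Matrix (Fin n) (Fin n) ℂ) * M * (σ h⁻¹ : GL (Fin n) ℂ) =
      ((Fintype.card q.ker : ℂ) / n * M.trace) • (1 : Matrix (Fin n) (Fin n) ℂ) := by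
  set S := ∑ h, (σ h : Matrix (Fin n) (Fin n) ℂ) * M * (σ h⁻¹ : GL (Fin n) ℂ) with hSdef
  have hS : ∃ z : ℂ, S = z • (1 : Matrix (Fin n) (Fin n) ℂ) := by
    rcases hσ.eq_zero_or_isUnit hσ S (average_intertwines σ σ M) with h | ⟨U, hU⟩
    · exact ⟨0, by rw [h, zero_smul]⟩
    · obtain ⟨z, hz⟩ := schur hσ U fun h => Units.ext (by
        rw [Units.val_mul, Units.val_mul, hU]
        exact (average_intertwines σ σ M h).symm)
      refine ⟨z, ?_⟩
      rw [← hU, ← hz, ← Algebra.algebraMap_eq_smul_one]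
      rfl
  obtain ⟨z, hz⟩ := hS
  have htr : S.trace = Fintype.card q.ker * M.trace := by
    rw [hSdef, Matrix.trace_sum, Finset.sum_congr rfl (g := fun _ => M.trace)]
    · rw [Finset.sum_const, Finset.card_univ, nsmul_eq_mul]
    · intro h _
      rw [Matrix.trace_mul_comm, ← mul_assoc, ← Units.val_mul, ← map_mul, inv_mul_cancel, map_one,
        Units.val_one, one_mul]
  have hn : (n : ℂ) ≠ 0 := Nat.cast_ne_zero.2 hσ.1.ne'
  rw [hz, Matrix.trace_smul, Matrix.trace_one, Fintype.card_fin, smul_eq_mul] at htr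
  rw [hz]
  congr 1
  field_simp
  exact htr

/-- Averaging matrix units gives the orthogonality relations of matrix entries (`hE`), from which
the sum is read off entrywise. -/
lemma IsIrreducible.sum_trace_smul (hσ : IsIrreducible σ) (B : Matrix (Fin n) (Fin n) ℂ) :
    ∑ h, ((σ h : Matrix (Fin n) (Fin n) ℂ) * B).trace •
      (σ h⁻¹ : Matrix (Fin n) (Fin n) ℂ) = ((Fintype.card q.ker : ℂ) / n) • B := by
  have hE : ∀ a b c e : Fin n, ∑ h, (σ h : Matrix (Fin n) (Fin n) ℂ) a b *
      (σ h⁻¹ : Matrix (Fin n) (Fin n) ℂ) c e =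
        (Fintype.card q.ker : ℂ) / n * ((if b = c then 1 else 0) * if a = e then 1 else 0) := by
    intro a b c e
    have := congrFun (congrFun (hσ.average (Matrix.single b c 1)) a) e
    rw [Matrix.sum_apply, Matrix.smul_apply, Matrix.one_apply] at this
    have ht : (Matrix.single b c (1 : ℂ)).trace = if b = c then 1 else 0 := by
      split_ifs with h
      · subst h; exact Matrix.trace_single_eq_same _ _
      · exact Matrix.trace_single_eq_of_ne _ _ _ h
    rw [ht, smul_eq_mul, mul_assoc] at this
    rw [← this]
    refine Finset.sum_congr rfl fun h _ => ?_
    rw [Matrix.mul_apply, Finset.sum_eq_single c]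
    · rw [Matrix.mul_single_apply_same, mul_one]
    · intro j _ hj
      rw [Matrix.mul_single_apply_of_ne _ _ _ _ _ hj, zero_mul]
    · simp
  ext c e
  rw [Matrix.sum_apply, Matrix.smul_apply]
  have : ∀ h, (((σ h : Matrix (Fin n) (Fin n) ℂ) * B).trace •
      (σ h⁻¹ : Matrix (Fin n) (Fin n) ℂ)) c e = ∑ a, ∑ b, B b a *
        ((σ h : Matrix (Fin n) (Fin n) ℂ) a b * (σ h⁻¹ : Matrix (Fin n) (Fin n) ℂ) c e) := by
    intro h
    rw [Matrix.smul_apply, smul_eq_mul, Matrix.trace, Finset.sum_mul]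
    refine Finset.sum_congr rfl fun a _ => ?_
    rw [Matrix.diag_apply, Matrix.mul_apply, Finset.sum_mul]
    exact Finset.sum_congr rfl fun b _ => by ring
  rw [Finset.sum_congr rfl fun h _ => this h, Finset.sum_comm]
  rw [Finset.sum_congr rfl fun a _ => Finset.sum_comm]
  simp only [← Finset.mul_sum, hE]
  rw [Finset.sum_eq_single e]
  · rw [Finset.sum_eq_single c]
    · simp [mul_comm]
    · intro b _ hb
      simp [hb]
    · simp
  · intro a _ ha
    simp [ha]
  · simp

open scoped commutatorElement

/-- For fixed second entry the inner sum averages a conjugate of `σ(l) B` to its trace; the outer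
sum then inverts the trace and returns `B`, which cancels `B⁻¹`. The result no longer depends on `A`
and `B`. -/
lemma IsIrreducible.sum_commutator (hσ : IsIrreducible σ) (A B : GL (Fin n) ℂ) :
    ∑ x : q.ker × q.ker, ((⁅σ x.1 * A, σ x.2 * B⁆ : GL (Fin n) ℂ) : Matrix (Fin n) (Fin n) ℂ) =
      ((Fintype.card q.ker : ℂ) / n) ^ 2 • (1 : Matrix (Fin n) (Fin n) ℂ) := by
  rw [Fintype.sum_prod_type_right]
  have h1 : ∀ l, ∑ h, ((⁅σ h * A, σ l * B⁆ : GL (Fin n) ℂ) : Matrix (Fin n) (Fin n) ℂ) =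
      ((Fintype.card q.ker : ℂ) / n) • ((B⁻¹ : GL (Fin n) ℂ) : Matrix (Fin n) (Fin n) ℂ) *
        (((σ l : Matrix (Fin n) (Fin n) ℂ) * B).trace • (σ l⁻¹ : GL (Fin n) ℂ)) := by
    intro l
    have h2 : ∀ h, ((⁅σ h * A, σ l * B⁆ : GL (Fin n) ℂ) : Matrix (Fin n) (Fin n) ℂ) =
        (σ h : Matrix (Fin n) (Fin n) ℂ) * ((A * (σ l * B) * A⁻¹ : GL (Fin n) ℂ) :
          Matrix (Fin n) (Fin n) ℂ) * (σ h⁻¹ : GL (Fin n) ℂ) *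
          ((B⁻¹ * σ l⁻¹ : GL (Fin n) ℂ) : Matrix (Fin n) (Fin n) ℂ) := by
      intro h
      rw [← Units.val_mul, ← Units.val_mul, ← Units.val_mul, commutatorElement_def, map_inv, map_inv]
      congr 1
      group
    rw [Finset.sum_congr rfl fun h _ => h2 h, ← Finset.sum_mul, hσ.average, Units.val_mul,
      Matrix.trace_mul_comm, ← Units.val_mul, inv_mul_cancel_left]
    simp only [Units.val_mul, smul_mul_assoc, one_mul, mul_smul_comm, smul_smul]
    rw [mul_comm (Matrix.trace _)]
  rw [Finset.sum_congr rfl fun l _ => h1 l, ← Finset.mul_sum, hσ.sum_trace_smul, smul_mul_smul_comm,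
    ← Units.val_mul, inv_mul_cancel, Units.val_one, sq]

end Averages

/-! ### Products of commutators -/

section CommProd

open scoped commutatorElement

variable {H : Type*} [Group H] {K : Type*} [Group K] {d : ℕ}

/-- The product of commutators `⁅a₁, b₁⁆ ⋯ ⁅a_d, b_d⁆`. -/
def commProd (a b : Fin d → H) : H := (List.ofFn fun k => ⁅a k, b k⁆).prod

lemma map_commProd (φ : H →* K) (a b : Fin d → H) :
    φ (commProd a b) = commProd (fun k => φ (a k)) (fun k => φ (b k)) := by
  rw [commProd, commProd, map_list_prod, List.map_ofFn]
  congr 2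
  funext k
  exact map_commutatorElement φ _ _

/-- Isolates the `k`-th commutator. The prefix `p` involves only earlier entries, which is what the
induction over `k` for stabilizer membership requires. -/
lemma exists_commProd_update (a b : Fin d → H) (k : Fin d) :
    ∃ p r : H, (∀ x y, commProd (Function.update a k x) (Function.update b k y) = p * ⁅x, y⁆ * r) ∧
      ∀ S : Subgroup H, (∀ j < k, a j ∈ S ∧ b j ∈ S) → p ∈ S := by
  refine ⟨((List.ofFn fun k => ⁅a k, b k⁆).take k).prod,
    ((List.ofFn fun k => ⁅a k, b k⁆).drop (k + 1)).prod, fun x y => ?_, fun S hS => ?_⟩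
  · have h : (List.ofFn fun j => ⁅Function.update a k x j, Function.update b k y j⁆) =
        (List.ofFn fun j => ⁅a j, b j⁆).set k ⁅x, y⁆ := by
      refine List.ext_getElem (by simp) fun i hi hi' => ?_
      rw [List.getElem_set]
      simp only [List.getElem_ofFn]
      split_ifs with hik
      · have : (⟨i, by simpa using hi⟩ : Fin d) = k := Fin.ext hik.symm
        rw [this, Function.update_self, Function.update_self]
      · have : (⟨i, by simpa using hi⟩ : Fin d) ≠ k := fun h => hik (by rw [← h])
        rw [Function.update_of_ne this, Function.update_of_ne this]
    rw [commProd, h, List.prod_set, if_pos (by simp)]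
  · refine Subgroup.list_prod_mem _ fun z hz => ?_
    obtain ⟨i, hi, rfl⟩ := List.getElem_of_mem hz
    rw [List.getElem_take, List.getElem_ofFn]
    rw [List.length_take, List.length_ofFn] at hi
    obtain ⟨h1, h2⟩ := hS ⟨i, by omega⟩ (by rw [Fin.lt_def]; simp; omega)
    rw [commutatorElement_def]
    exact S.mul_mem (S.mul_mem (S.mul_mem h1 h2) (S.inv_mem h1)) (S.inv_mem h2)

lemma sum_prod_ofFn {R : Type*} [Semiring R] {X : Type*} [Fintype X] (d : ℕ)
    (F : Fin d → X → R) :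
    ∑ f : Fin d → X, (List.ofFn fun k => F k (f k)).prod =
      (List.ofFn fun k => ∑ x, F k x).prod := by
  induction d with
  | zero => simp
  | succ d ih =>
    rw [← Equiv.sum_comp (Fin.consEquiv fun _ => X), Fintype.sum_prod_type, List.ofFn_succ,
      List.prod_cons, ← ih fun k => F k.succ, Finset.sum_mul_sum]
    refine Finset.sum_congr rfl fun x _ => Finset.sum_congr rfl fun f _ => ?_
    rw [List.ofFn_succ, List.prod_cons]
    simp [Fin.consEquiv]

lemma sum_eq_zero_of_translates {X : Type*} [Group X] [Fintype X] {T : Type*} [Fintype T]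
    [Nonempty T] (c : T → X) (F : X → ℂ) (hF : ∀ f, ∑ t, F (c t * f) = 0) : ∑ f, F f = 0 := by
  have h1 : ∑ t : T, ∑ f, F (c t * f) = Fintype.card T * ∑ f, F f := by
    have h2 : ∀ t : T, ∑ f, F (c t * f) = ∑ f, F f := fun t =>
      Equiv.sum_comp (Equiv.mulLeft (c t)) F
    rw [Finset.sum_congr rfl fun t _ => h2 t, Finset.sum_const, Finset.card_univ, nsmul_eq_mul]
  rw [Finset.sum_comm, Finset.sum_congr rfl fun f _ => hF f, Finset.sum_const_zero] at h1
  exact (mul_eq_zero.1 h1.symm).resolve_left (Nat.cast_ne_zero.2 Fintype.card_ne_zero)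

end CommProd

/-! ### Sums of characters over products of commutators -/

section SurfaceSum

open scoped commutatorElement

variable {G : Type u} {G' : Type v} [Group G] [Group G'] {q : G' →* G} {n d : ℕ}

open Classical in
/-- The extension by zero of a representation of `Γ = ker q` to `G'`. -/
def extendRep (ρ : q.ker →* GL (Fin n) ℂ) (x : G') : Matrix (Fin n) (Fin n) ℂ :=
  if hx : x ∈ q.ker then ρ ⟨x, hx⟩ else 0

lemma extendRep_coe (ρ : q.ker →* GL (Fin n) ℂ) (x : q.ker) :
    extendRep ρ (x : G') = (ρ x : Matrix (Fin n) (Fin n) ℂ) := by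
  rw [extendRep, dif_pos x.2]

/-- The tuple of elements `h_k α_k`, for a tuple of elements `h_k` of `ker q`. -/
def translate (h : Fin d → q.ker) (α : Fin d → G') (k : Fin d) : G' := h k * α k

/-- The product of the commutators of the elements `h_k α_k` and `l_k β_k`. -/
def word (α β : Fin d → G') (f : Fin d → q.ker × q.ker) : G' :=
  commProd (translate (fun k => (f k).1) α) (translate (fun k => (f k).2) β)

lemma word_mem_ker {α β : Fin d → G'} (hw : commProd α β ∈ q.ker) (f : Fin d → q.ker × q.ker) :
    word α β f ∈ q.ker := by
  rw [MonoidHom.mem_ker, map_commProd] at hw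
  rw [word, MonoidHom.mem_ker, map_commProd, ← hw]
  have h : ∀ x : q.ker, q x = 1 := fun x => x.2
  congr 1 <;> funext k <;> rw [translate, map_mul, h, one_mul]

lemma IsIrreducible.comp_mulEquiv {ρ : q.ker →* GL (Fin n) ℂ} (hρ : IsIrreducible ρ)
    (e : MulAut q.ker) : IsIrreducible (ρ.comp e.toMonoidHom) :=
  ⟨hρ.1, fun V hV => hρ.2 V fun h x hx => by
    have := hV (e.symm h) x hx
    rwa [MonoidHom.comp_apply, MulEquiv.coe_toMonoidHom, MulEquiv.apply_symm_apply] at this⟩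

lemma translate_mulSingle_mul (k : Fin d) (h : q.ker) (f : Fin d → q.ker) (α : Fin d → G') :
    translate (Pi.mulSingle k h * f) α = Function.update (translate f α) k (h * translate f α k) := by
  funext j
  by_cases hj : j = k
  · subst hj
    simp [translate, mul_assoc]
  · simp [translate, hj]

variable [Fintype q.ker]

/-- The sum of the values of the character of `ρ` on all products of commutators of the elements
`h_k α_k` and `l_k β_k` with `h_k, l_k ∈ ker q`. -/
def surfaceSum (ρ : q.ker →* GL (Fin n) ℂ) (α β : Fin d → G') : ℂ :=
  ∑ f : Fin d → q.ker × q.ker, (extendRep ρ (word α β f)).trace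

/-- Changing the lifts translates the summation variables in `ker q`. -/
lemma surfaceSum_congr (ρ : q.ker →* GL (Fin n) ℂ) {α β α' β' : Fin d → G'}
    (hα : ∀ k, q (α k) = q (α' k)) (hβ : ∀ k, q (β k) = q (β' k)) :
    surfaceSum ρ α β = surfaceSum ρ α' β' := by
  let t : Fin d → q.ker × q.ker := fun k =>
    (⟨α' k * (α k)⁻¹, by rw [MonoidHom.mem_ker, map_mul, map_inv, hα, mul_inv_cancel]⟩,
      ⟨β' k * (β k)⁻¹, by rw [MonoidHom.mem_ker, map_mul, map_inv, hβ, mul_inv_cancel]⟩)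
  rw [surfaceSum, surfaceSum, ← Equiv.sum_comp (Equiv.mulRight t)]
  refine Finset.sum_congr rfl fun f _ => ?_
  congr 2
  rw [word, word]
  congr 1 <;> funext k <;> simp [translate, t, mul_assoc]

/-- Since `p h x h⁻¹ r = (p h p⁻¹)(p x r)(r⁻¹ h⁻¹ r)`, the sum intertwines the conjugates of `ρ` by
`p` and by `r⁻¹`. If it were nonzero it would be invertible, and `p r` would lie over the
stabilizer. -/
lemma IsIrreducible.sum_extendRep_eq_zero {ρ : q.ker →* GL (Fin n) ℂ} (hρ : IsIrreducible ρ)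
    (p x r : G') (hw : p * x * r ∈ q.ker) (hpr : q (p * r) ∉ stabilizer q ρ) :
    ∑ h : q.ker, extendRep ρ (p * (h * x * (h : G')⁻¹) * r) = 0 := by
  have h1 : ∀ h : q.ker, extendRep ρ (p * (h * x * (h : G')⁻¹) * r) =
      ((ρ.comp (MulAut.conjNormal p).toMonoidHom) h : Matrix (Fin n) (Fin n) ℂ) *
        (ρ ⟨_, hw⟩ : Matrix (Fin n) (Fin n) ℂ) *
        ((ρ.comp (MulAut.conjNormal r⁻¹).toMonoidHom) h⁻¹ : Matrix (Fin n) (Fin n) ℂ) := by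
    intro h
    rw [MonoidHom.comp_apply, MonoidHom.comp_apply, ← Units.val_mul, ← Units.val_mul, ← map_mul,
      ← map_mul, ← extendRep_coe]
    congr 1
    simp only [Subgroup.coe_mul, MulEquiv.coe_toMonoidHom, MulAut.conjNormal_apply,
      Subgroup.coe_inv]
    group
  rw [Finset.sum_congr rfl fun h _ => h1 h]
  have h2 := average_intertwines (ρ.comp (MulAut.conjNormal p).toMonoidHom)
    (ρ.comp (MulAut.conjNormal r⁻¹).toMonoidHom) (ρ ⟨_, hw⟩ : Matrix (Fin n) (Fin n) ℂ)
  refine ((hρ.comp_mulEquiv _).eq_zero_or_isUnit (hρ.comp_mulEquiv _) _ h2).resolve_right ?_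
  rintro ⟨U, hU⟩
  refine hpr ⟨p * r, rfl, U, fun h => ?_⟩
  have h3 := h2 (MulAut.conjNormal p⁻¹ h)
  rw [← hU, ← Units.val_mul, ← Units.val_mul, Units.val_inj] at h3
  simp only [MonoidHom.comp_apply, MulEquiv.coe_toMonoidHom, ← MulAut.mul_apply, ← map_mul,
    mul_inv_cancel, map_one, MulAut.one_apply] at h3
  rw [_root_.mul_inv_rev, mul_assoc, h3, inv_mul_cancel_left]

/-- Induction on `k`: if the earlier entries lie over the stabilizer, varying a single factor in the
`k`-th pair makes partial sums vanish unless a specific conjugate lies in it. -/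
lemma IsIrreducible.mem_stabilizer_of_surfaceSum_ne_zero {ρ : q.ker →* GL (Fin n) ℂ}
    (hρ : IsIrreducible ρ) {α β : Fin d → G'} (hw : commProd α β ∈ q.ker)
    (hne : surfaceSum ρ α β ≠ 0) (k : Fin d) :
    q (α k) ∈ stabilizer q ρ ∧ q (β k) ∈ stabilizer q ρ := by
  have hq : ∀ x : q.ker, q x = 1 := fun x => x.2
  induction k using WellFoundedLT.induction with
  | ind k ih =>
  have h0 : ∀ f : Fin d → q.ker × q.ker, ∃ a b p r : G', q a = q (α k) ∧ q b = q (β k) ∧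
      q p ∈ stabilizer q ρ ∧ p * ⁅a, b⁆ * r ∈ q.ker ∧
      (∀ h : q.ker, word α β (Pi.mulSingle k (h, 1) * f) = p * ⁅h * a, b⁆ * r) ∧
      ∀ h : q.ker, word α β (Pi.mulSingle k (1, h) * f) = p * ⁅a, h * b⁆ * r := by
    intro f
    obtain ⟨p, r, hpr, hp⟩ := exists_commProd_update (translate (fun k => (f k).1) α)
      (translate (fun k => (f k).2) β) k
    have hu : ∀ h l : q.ker, word α β (Pi.mulSingle k (h, l) * f) =
        p * ⁅h * translate (fun k => (f k).1) α k, l * translate (fun k => (f k).2) β k⁆ * r := by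
      intro h l
      rw [← hpr, ← translate_mulSingle_mul, ← translate_mulSingle_mul, word]
      congr 2 <;> funext j <;> by_cases hj : j = k
      · subst hj; simp
      · simp [hj]
      · subst hj; simp
      · simp [hj]
    refine ⟨translate (fun k => (f k).1) α k, translate (fun k => (f k).2) β k, p, r, ?_, ?_, hp ((stabilizer q ρ).comap q) fun j hj => ?_, ?_,
      fun h => ?_, fun h => ?_⟩
    · rw [translate, map_mul, hq, one_mul]
    · rw [translate, map_mul, hq, one_mul]
    · rw [Subgroup.mem_comap, Subgroup.mem_comap, translate, translate, map_mul, hq, one_mul,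
        map_mul, hq, one_mul]
      exact ih j hj
    · have := hu 1 1
      rw [Subgroup.coe_one, one_mul, one_mul] at this
      rw [← this]
      exact word_mem_ker hw _
    · rw [hu, Subgroup.coe_one, one_mul]
    · rw [hu, Subgroup.coe_one, one_mul]
  have hr : ∀ a b p r : G', p * ⁅a, b⁆ * r ∈ q.ker → q r = (q p * ⁅q a, q b⁆)⁻¹ := by
    intro a b p r h
    rw [MonoidHom.mem_ker, map_mul, map_mul, map_commutatorElement] at h
    exact eq_inv_of_mul_eq_one_right h
  -- Varying `h_k` tests `p b⁻¹ r`, whose image is that of `p (a b⁻¹ a⁻¹) p⁻¹`, because the whole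
  -- word lies in the kernel.
  have h1 : q (α k) * q (β k) * (q (α k))⁻¹ ∈ stabilizer q ρ := by
    by_contra hc
    refine hne (sum_eq_zero_of_translates (fun h : q.ker => Pi.mulSingle k (h, 1)) _ fun f => ?_)
    obtain ⟨a, b, p, r, ha, hb, hp, hker, hf, -⟩ := h0 f
    have h2 : ∀ h : q.ker, word α β (Pi.mulSingle k (h, 1) * f) =
        p * (h * (a * b * a⁻¹) * (h : G')⁻¹) * (b⁻¹ * r) := by
      intro h
      rw [hf, commutatorElement_def]
      group
    rw [Finset.sum_congr rfl fun h _ => by rw [h2 h], ← Matrix.trace_sum,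
      hρ.sum_extendRep_eq_zero, Matrix.trace_zero]
    · convert hker using 1
      rw [commutatorElement_def]
      group
    · intro h3
      rw [map_mul, map_mul, hr a b p r hker, map_inv, ha, hb] at h3
      refine hc ?_
      have h4 := (stabilizer q ρ).inv_mem
        ((stabilizer q ρ).mul_mem ((stabilizer q ρ).mul_mem ((stabilizer q ρ).inv_mem hp) h3) hp)
      convert h4 using 1
      rw [commutatorElement_def]
      group
  -- Varying `l_k` tests `p a r`, with the image of `p (a b a b⁻¹ a⁻¹) p⁻¹`; conjugation by `a b
  -- a⁻¹`, already known to lie over the stabilizer, leaves `a`.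
  have h2 : q (α k) ∈ stabilizer q ρ := by
    by_contra hc
    refine hne (sum_eq_zero_of_translates (fun h : q.ker => Pi.mulSingle k (1, h)) _ fun f => ?_)
    obtain ⟨a, b, p, r, ha, hb, hp, hker, -, hf⟩ := h0 f
    have h2 : ∀ h : q.ker, word α β (Pi.mulSingle k (1, h) * f) =
        p * a * (h * (b * a⁻¹ * b⁻¹) * (h : G')⁻¹) * r := by
      intro h
      rw [hf, commutatorElement_def]
      group
    rw [Finset.sum_congr rfl fun h _ => by rw [h2 h], ← Matrix.trace_sum,
      hρ.sum_extendRep_eq_zero, Matrix.trace_zero]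
    · convert hker using 1
      rw [commutatorElement_def]
      group
    · intro h3
      rw [map_mul, map_mul, hr a b p r hker, ha, hb] at h3
      refine hc ?_
      have h4 := (stabilizer q ρ).mul_mem ((stabilizer q ρ).mul_mem ((stabilizer q ρ).inv_mem h1)
        ((stabilizer q ρ).mul_mem ((stabilizer q ρ).mul_mem ((stabilizer q ρ).inv_mem hp) h3) hp)) h1
      convert h4 using 1
      rw [commutatorElement_def]
      group
  refine ⟨h2, ?_⟩
  have h3 := (stabilizer q ρ).mul_mem ((stabilizer q ρ).mul_mem ((stabilizer q ρ).inv_mem h2) h1) h2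
  convert h3 using 1
  group

end SurfaceSum

open scoped commutatorElement in
lemma commProd_eq_one {H : Type*} [CommGroup H] {d : ℕ} (a b : Fin d → H) : commProd a b = 1 := by
  have h : ∀ x y : H, ⁅x, y⁆ = 1 := fun x y =>
    commutatorElement_eq_one_iff_mul_comm.2 (mul_comm x y)
  simp only [commProd, h, List.ofFn_const, List.prod_replicate, one_pow]

/-! ### The central extension attached to an irreducible representation -/

section Intertwiners

open scoped commutatorElement

variable {G : Type u} {G' : Type v} [Group G] [Group G'] {q : G' →* G} {n d : ℕ}
  (ρ : q.ker →* GL (Fin n) ℂ)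

/-- The group of pairs of an element `a` of `G'` and a matrix that intertwines `ρ` and the
conjugate of `ρ` by `a`. -/
def intertwiners : Subgroup (G' × GL (Fin n) ℂ) where
  carrier := {p | ∀ h : q.ker, ρ (MulAut.conjNormal p.1⁻¹ h) = p.2⁻¹ * ρ h * p.2}
  one_mem' h := by simp
  mul_mem' := by
    rintro ⟨a, M⟩ ⟨b, N⟩ hM hN h
    simp only [Set.mem_ofPred_eq] at hM hN
    simp only [Prod.mk_mul_mk]
    rw [_root_.mul_inv_rev, map_mul, MulAut.mul_apply, hN, hM]
    group
  inv_mem' := by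
    rintro ⟨a, M⟩ hM h
    have := hM (MulAut.conjNormal a h)
    simp only [← MulAut.mul_apply, ← map_mul, inv_mul_cancel, map_one, MulAut.one_apply] at this
    simp only [Prod.inv_mk, inv_inv, this]
    group

/-- The embedding of `ker q` into the group of intertwiners. -/
def graphHom : q.ker →* intertwiners ρ where
  toFun x := ⟨((x : G'), ρ x), fun h => by
    have : MulAut.conjNormal (x : G')⁻¹ h = x⁻¹ * h * x := by
      ext
      rw [MulAut.conjNormal_apply, inv_inv]
      rfl
    rw [this, map_mul, map_mul, map_inv]⟩
  map_one' := Subtype.ext (Prod.ext rfl (map_one ρ))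
  map_mul' x y := Subtype.ext (Prod.ext rfl (map_mul ρ x y))

lemma coe_graphHom (x : q.ker) : (graphHom ρ x : G' × GL (Fin n) ℂ) = ((x : G'), ρ x) := rfl

/-- The embedding of `ℂ*` into the group of intertwiners. -/
def scalarHom : ℂˣ →* intertwiners ρ where
  toFun z := ⟨((1 : G'), scalarGL n z), fun h => by
    rw [inv_one, map_one, MulAut.one_apply, mul_assoc, scalarGL_comm, inv_mul_cancel_left]⟩
  map_one' := Subtype.ext (Prod.ext rfl (map_one (scalarGL n)))
  map_mul' x y := Subtype.ext (Prod.ext (one_mul 1).symm (map_mul (scalarGL n) x y))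

lemma coe_scalarHom (z : ℂˣ) : (scalarHom ρ z : G' × GL (Fin n) ℂ) = (1, scalarGL n z) := rfl

instance : (graphHom ρ).range.Normal where
  conj_mem := by
    rintro _ ⟨x, rfl⟩ ⟨⟨a, M⟩, hM⟩
    refine ⟨MulAut.conjNormal a x, Subtype.ext (Prod.ext ?_ ?_)⟩
    · simp [coe_graphHom]
    · have := hM (MulAut.conjNormal a x)
      simp only [← MulAut.mul_apply, ← map_mul, inv_mul_cancel, map_one, MulAut.one_apply] at this
      simp only [coe_graphHom, Subgroup.coe_mul,
        Subgroup.coe_inv, Prod.snd_mul, Prod.snd_inv, this]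
      group

/-- The central extension of the stabilizer of `ρ` by `ℂ*`. -/
abbrev StabilizerExtension : Type v := intertwiners ρ ⧸ (graphHom ρ).range

/-- The embedding of `ℂ*` as a central subgroup of the extension. -/
def extensionScalar : ℂˣ →* StabilizerExtension ρ :=
  (QuotientGroup.mk' _).comp (scalarHom ρ)

lemma extensionScalar_comm (z : ℂˣ) (e : StabilizerExtension ρ) :
    extensionScalar ρ z * e = e * extensionScalar ρ z := by
  obtain ⟨⟨⟨a, M⟩, hM⟩, rfl⟩ := QuotientGroup.mk_surjective e
  refine congrArg (QuotientGroup.mk : intertwiners ρ → StabilizerExtension ρ)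
    (Subtype.ext (Prod.ext ?_ ?_))
  · simp [coe_scalarHom]
  · simp [coe_scalarHom, scalarGL_comm]

variable {ρ}

lemma graphHom_mul_scalarHom (z : ℂˣ) (x : q.ker) :
    ((graphHom ρ x * scalarHom ρ z : intertwiners ρ) : G' × GL (Fin n) ℂ) =
      ((x : G'), ρ x * scalarGL n z) := by
  simp [coe_graphHom, coe_scalarHom]

lemma extensionScalar_injective (hρ : IsIrreducible ρ) :
    Function.Injective (extensionScalar ρ) := by
  rw [injective_iff_map_eq_one]
  intro z hz
  obtain ⟨x, hx⟩ := (QuotientGroup.eq_one_iff _).1 hz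
  have h1 : ((x : G'), ρ x) = (1, scalarGL n z) := congrArg Subtype.val hx
  rw [Prod.mk.injEq] at h1
  have hx1 : x = 1 := Subtype.ext h1.1
  apply scalarGL_injective hρ.1
  rw [← h1.2, hx1, map_one, map_one]

/-- Over an element `x` of the kernel, `ρ(x)` is already an intertwiner, and any other differs from
it by a scalar according to Schur's lemma. -/
lemma IsIrreducible.exists_graphHom_mul_scalarHom (hρ : IsIrreducible ρ) (p : intertwiners ρ)
    (hp : p.1.1 ∈ q.ker) : ∃ z, p = graphHom ρ ⟨p.1.1, hp⟩ * scalarHom ρ z := by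
  obtain ⟨z, hz⟩ := schur hρ ((ρ ⟨p.1.1, hp⟩)⁻¹ * p.1.2) fun h => by
    have h1 := p.2 (⟨p.1.1, hp⟩ * h * ⟨p.1.1, hp⟩⁻¹)
    have h2 : MulAut.conjNormal p.1.1⁻¹ (⟨p.1.1, hp⟩ * h * ⟨p.1.1, hp⟩⁻¹ : q.ker) = h := by
      ext
      simp [mul_assoc]
    rw [h2, map_mul, map_mul, map_inv] at h1
    rw [eq_comm, mul_assoc, inv_mul_eq_iff_eq_mul, mul_assoc, mul_assoc] at h1
    rw [mul_assoc, ← h1]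
    group
  refine ⟨z, Subtype.ext ?_⟩
  rw [graphHom_mul_scalarHom, hz, mul_inv_cancel_left]

lemma mk_graphHom (x : q.ker) : (QuotientGroup.mk (graphHom ρ x) : StabilizerExtension ρ) = 1 :=
  (QuotientGroup.eq_one_iff _).2 ⟨x, rfl⟩

lemma mk_graphHom_mul (x : q.ker) (p : intertwiners ρ) :
    (QuotientGroup.mk (graphHom ρ x * p) : StabilizerExtension ρ) = QuotientGroup.mk p := by
  rw [QuotientGroup.mk_mul, mk_graphHom, one_mul]

variable (ρ) in
/-- The section of the extension given by the chosen lifts and matrices. -/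
def stabilizerSection (α : stabilizer q ρ) : StabilizerExtension ρ :=
  QuotientGroup.mk ⟨(lift q ρ α, mat q ρ α), mat_spec q ρ α⟩

lemma IsIrreducible.stabilizerSection_mul (hρ : IsIrreducible ρ) (α β : stabilizer q ρ) :
    stabilizerSection ρ α * stabilizerSection ρ β =
      (extensionScalar ρ (zeta hρ (α, β)))⁻¹ * stabilizerSection ρ (α * β) := by
  rw [eq_inv_mul_iff_mul_eq, ← mul_one (stabilizerSection ρ (α * β)),
    ← mk_graphHom (defect q ρ α β)]
  refine congrArg (QuotientGroup.mk : intertwiners ρ → StabilizerExtension ρ)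
    (Subtype.ext (Prod.ext ?_ ?_))
  · simp [coe_scalarHom, coe_graphHom, defect, mul_assoc]
  · simpa [coe_scalarHom, coe_graphHom, mul_assoc] using zeta_spec hρ α β

/-- The section multiplies up to `ζ⁻¹`, so the scalars are embedded through inversion to make `ζ`
itself the cocycle. -/
lemma IsIrreducible.isTwistedHom {Q : Type*} [Group Q] (hρ : IsIrreducible ρ)
    (f : Q →* stabilizer q ρ) :
    IsTwistedHom (Z2.pullback f ⟨zeta hρ, zeta_cocycle hρ⟩)
      ((extensionScalar ρ).comp (MulEquiv.inv ℂˣ).toMonoidHom)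
      (fun x => stabilizerSection ρ (f x)) where
  injective := (extensionScalar_injective hρ).comp (MulEquiv.inv ℂˣ).injective
  comm z e := extensionScalar_comm ρ z⁻¹ e
  mul x y := by
    rw [hρ.stabilizerSection_mul, map_mul, ← map_inv]
    rfl

lemma commProd_mem_ker_of_eq {α β α' β' : Fin d → G'} (hw : commProd α β ∈ q.ker)
    (hα : ∀ k, q (α' k) = q (α k)) (hβ : ∀ k, q (β' k) = q (β k)) : commProd α' β' ∈ q.ker := by
  rw [MonoidHom.mem_ker, map_commProd] at hw ⊢
  simpa only [hα, hβ] using hw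

lemma exists_intertwiner {a : G'} (ha : q a ∈ stabilizer q ρ) :
    ∃ p : intertwiners ρ, q p.1.1 = q a := by
  refine ⟨⟨(lift q ρ ⟨_, ha⟩, mat q ρ ⟨_, ha⟩), mat_spec q ρ _⟩, q_lift q ρ ⟨_, ha⟩⟩

variable [Fintype q.ker]

/-- As `Γ` is finite, `det ρ(x)` is a root of unity, so `zⁿ` and hence `z` are roots of unity too.
-/
lemma norm_eq_one_of_det {z : ℂˣ} (hn : 0 < n) (x : q.ker)
    (h : (ρ x * scalarGL n z).det = 1) : ‖(z : ℂ)‖ = 1 := by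
  have h1 : (ρ x).det ^ Fintype.card q.ker = 1 := by
    rw [← map_pow, ← map_pow, pow_card_eq_one, map_one, map_one]
  have h2 : (Matrix.GeneralLinearGroup.det (scalarGL n z) : ℂˣ) = z ^ n := by
    ext
    simp [scalarGL, Algebra.algebraMap_eq_smul_one]
  rw [map_mul, h2] at h
  have h3 : z ^ (n * Fintype.card q.ker) = 1 := by
    rw [pow_mul, eq_inv_of_mul_eq_one_right h, inv_pow, h1, inv_one]
  have h4 : (z : ℂ) ^ (n * Fintype.card q.ker) = 1 := by
    rw [← Units.val_pow_eq_pow_val, h3, Units.val_one]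
  exact Complex.norm_eq_one_of_pow_eq_one h4 (Nat.mul_pos hn Fintype.card_pos).ne'

/-- The value of the character sum if all elements lie over the stabilizer. -/
lemma IsIrreducible.exists_surfaceSum_eq (hρ : IsIrreducible ρ) (a b : Fin d → intertwiners ρ)
    (hw : commProd (fun k => (a k).1.1) (fun k => (b k).1.1) ∈ q.ker) :
    ∃ z : ℂˣ, ‖(z : ℂ)‖ = 1 ∧
      commProd (fun k => (QuotientGroup.mk (a k) : StabilizerExtension ρ))
        (fun k => QuotientGroup.mk (b k)) = extensionScalar ρ z ∧
      surfaceSum ρ (fun k => (a k).1.1) (fun k => (b k).1.1) =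
        (z : ℂ)⁻¹ * (n * ((Fintype.card q.ker : ℂ) / n) ^ (2 * d)) := by
  have hfst : ∀ a b : Fin d → intertwiners ρ, (commProd a b).1.1 =
      commProd (fun k => (a k).1.1) (fun k => (b k).1.1) := fun a b =>
    map_commProd ((MonoidHom.fst _ _).comp (intertwiners ρ).subtype) a b
  have hsnd : ∀ a b : Fin d → intertwiners ρ, (commProd a b).1.2 =
      commProd (fun k => (a k).1.2) (fun k => (b k).1.2) := fun a b =>
    map_commProd ((MonoidHom.snd _ _).comp (intertwiners ρ).subtype) a b
  have hmk : ∀ a b : Fin d → intertwiners ρ,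
      (QuotientGroup.mk (commProd a b) : StabilizerExtension ρ) =
      commProd (fun k => QuotientGroup.mk (a k)) (fun k => QuotientGroup.mk (b k)) := fun a b =>
    map_commProd (QuotientGroup.mk' _) a b
  rw [← hfst] at hw
  obtain ⟨z, hz⟩ := hρ.exists_graphHom_mul_scalarHom (commProd a b) hw
  have hz' : commProd (fun k => (QuotientGroup.mk (a k) : StabilizerExtension ρ))
      (fun k => QuotientGroup.mk (b k)) = extensionScalar ρ z := by
    rw [← hmk, hz, mk_graphHom_mul]
    rfl
  refine ⟨z, ?_, hz', ?_⟩
  · refine norm_eq_one_of_det (ρ := ρ) hρ.1 ⟨_, hw⟩ ?_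
    have h1 := congrArg (fun p : intertwiners ρ => Matrix.GeneralLinearGroup.det p.1.2) hz
    rw [graphHom_mul_scalarHom] at h1
    rw [← h1, hsnd, map_commProd]
    exact commProd_eq_one _ _
  · have hword : ∀ f : Fin d → q.ker × q.ker,
        extendRep ρ (word (fun k => (a k).1.1) (fun k => (b k).1.1) f) = (z : ℂ)⁻¹ •
          (List.ofFn fun k => ((⁅ρ (f k).1 * (a k).1.2, ρ (f k).2 * (b k).1.2⁆ : GL (Fin n) ℂ) :
            Matrix (Fin n) (Fin n) ℂ)).prod := by
      intro f
      -- Elements of `ker q` die in the extension, so every word, for every `f`, gives the same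
      -- scalar `z` there.
      have h1 := hmk (fun k => graphHom ρ (f k).1 * a k) (fun k => graphHom ρ (f k).2 * b k)
      simp only [mk_graphHom_mul] at h1
      rw [hz'] at h1
      have h2 : word (fun k => (a k).1.1) (fun k => (b k).1.1) f =
          (commProd (fun k => graphHom ρ (f k).1 * a k) (fun k => graphHom ρ (f k).2 * b k)).1.1 := by
        rw [hfst]
        rfl
      have hker : (commProd (fun k => graphHom ρ (f k).1 * a k)
          (fun k => graphHom ρ (f k).2 * b k)).1.1 ∈ q.ker := by
        rw [← h2]
        exact word_mem_ker (by rwa [← hfst]) f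
      obtain ⟨z', hz1⟩ := hρ.exists_graphHom_mul_scalarHom _ hker
      rw [hz1, mk_graphHom_mul] at h1
      have h3 : z' = z := extensionScalar_injective hρ h1
      subst h3
      have h4 := congrArg (fun p : intertwiners ρ => p.1.2) hz1
      rw [graphHom_mul_scalarHom] at h4
      simp only [hsnd] at h4
      have h5 := congrArg (fun M : GL (Fin n) ℂ => (M : Matrix (Fin n) (Fin n) ℂ)) h4
      simp only [Units.val_mul] at h5
      have h6 : ((scalarGL n z' : GL (Fin n) ℂ) : Matrix (Fin n) (Fin n) ℂ) = (z' : ℂ) • 1 :=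
        Algebra.algebraMap_eq_smul_one _
      rw [h6, mul_smul_comm, mul_one] at h5
      have h7 : (List.ofFn fun k => ((⁅ρ (f k).1 * (a k).1.2, ρ (f k).2 * (b k).1.2⁆ :
          GL (Fin n) ℂ) : Matrix (Fin n) (Fin n) ℂ)).prod = (z' : ℂ) •
          (ρ ⟨_, hker⟩ : Matrix (Fin n) (Fin n) ℂ) := by
        rw [← h5, commProd, ← Units.coeHom_apply, map_list_prod, List.map_ofFn]
        rfl
      rw [h7, smul_smul, inv_mul_cancel₀ z'.ne_zero, one_smul, h2]
      exact extendRep_coe ρ ⟨_, hker⟩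
    rw [surfaceSum, Finset.sum_congr rfl fun f _ => by rw [hword f], ← Matrix.trace_sum,
      ← Finset.smul_sum, sum_prod_ofFn d fun k (x : q.ker × q.ker) =>
        ((⁅ρ x.1 * (a k).1.2, ρ x.2 * (b k).1.2⁆ : GL (Fin n) ℂ) : Matrix (Fin n) (Fin n) ℂ)]
    have h1 : (fun k : Fin d => ∑ x : q.ker × q.ker,
        ((⁅ρ x.1 * (a k).1.2, ρ x.2 * (b k).1.2⁆ : GL (Fin n) ℂ) : Matrix (Fin n) (Fin n) ℂ)) =
        fun _ => ((Fintype.card q.ker : ℂ) / n) ^ 2 • (1 : Matrix (Fin n) (Fin n) ℂ) :=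
      funext fun k => hρ.sum_commutator _ _
    rw [h1, List.ofFn_const, List.prod_replicate, smul_pow, one_pow, Matrix.trace_smul,
      Matrix.trace_smul, Matrix.trace_one, Fintype.card_fin, smul_eq_mul, smul_eq_mul, pow_mul,
      mul_comm (n : ℂ)]

lemma IsIrreducible.norm_surfaceSum_le (hρ : IsIrreducible ρ) {α β : Fin d → G'}
    (hw : commProd α β ∈ q.ker) :
    ‖surfaceSum ρ α β‖ ≤ n * ((Fintype.card q.ker : ℝ) / n) ^ (2 * d) := by
  by_cases h0 : surfaceSum ρ α β = 0
  · rw [h0, norm_zero]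
    positivity
  · have hs := hρ.mem_stabilizer_of_surfaceSum_ne_zero hw h0
    choose a ha using fun k => exists_intertwiner (hs k).1
    choose b hb using fun k => exists_intertwiner (hs k).2
    obtain ⟨z, hz, -, hsum⟩ := hρ.exists_surfaceSum_eq a b (commProd_mem_ker_of_eq hw ha hb)
    rw [surfaceSum_congr ρ (fun k => (ha k).symm) (fun k => (hb k).symm), hsum, norm_mul, norm_inv,
      hz]
    simp

lemma IsIrreducible.surfaceSum_one (hρ : IsIrreducible ρ) :
    surfaceSum ρ (1 : Fin d → G') 1 = n * ((Fintype.card q.ker : ℂ) / n) ^ (2 * d) := by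
  have h1 : ∀ {H : Type v} [Group H], commProd (fun _ : Fin d => (1 : H)) (fun _ => 1) = 1 := by
    intro H _
    simp [commProd]
  obtain ⟨z, -, hz, hsum⟩ := hρ.exists_surfaceSum_eq (fun _ : Fin d => 1) (fun _ => 1)
    (by
      have : commProd (fun _ : Fin d => (1 : G')) (fun _ => 1) ∈ q.ker := by
        rw [h1]; exact q.ker.one_mem
      exact this)
  have h2 : z = 1 := by
    refine extensionScalar_injective hρ ?_
    rw [← hz, map_one]
    exact h1
  rw [h2, Units.val_one, inv_one, one_mul] at hsum
  exact hsum

end Intertwiners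

/-! ### The irreducible representations of a finite group -/

section Wedderburn

lemma isIrreducible_of_span {Γ : Type v} [Group Γ] {n : ℕ} (hn : 0 < n) (ρ : Γ →* GL (Fin n) ℂ)
    (hρ : ∀ (V : Submodule ℂ (Fin n → ℂ)),
      (∀ h : Γ, ∀ x ∈ V, (ρ h : Matrix (Fin n) (Fin n) ℂ) *ᵥ x ∈ V) →
        ∀ M : Matrix (Fin n) (Fin n) ℂ, ∀ x ∈ V, M *ᵥ x ∈ V) : IsIrreducible ρ := by
  refine ⟨hn, fun V hV => or_iff_not_imp_left.2 fun h0 => ?_⟩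
  obtain ⟨x, hx, hx0⟩ := V.ne_bot_iff.1 h0
  obtain ⟨j, hj⟩ := Function.ne_iff.1 hx0
  rw [eq_top_iff]
  intro y _
  -- A rank-one matrix carries any nonzero `x` to any `y`.
  have h1 : Matrix.vecMulVec y (Pi.single j (x j)⁻¹) *ᵥ x = y := by
    rw [Matrix.vecMulVec_mulVec, single_dotProduct, inv_mul_cancel₀ hj]
    simp
  rw [← h1]
  exact hρ V hV _ x hx

lemma trace_mulLeft_eq_sum {A : Type*} [Ring A] [Algebra ℂ A] {ι : Type*} [Fintype ι]
    (b : Module.Basis ι ℂ A) (a : A) :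
    LinearMap.trace ℂ A (LinearMap.mulLeft ℂ a) = ∑ i, b.repr (a * b i) i := by
  classical
  rw [LinearMap.trace_eq_matrix_trace ℂ b, Matrix.trace]
  refine Finset.sum_congr rfl fun i _ => ?_
  rw [Matrix.diag_apply, LinearMap.toMatrix_apply, LinearMap.mulLeft_apply]

lemma trace_mulLeft_single {Γ : Type v} [Group Γ] [Fintype Γ] [DecidableEq Γ] (x : Γ) :
    LinearMap.trace ℂ (MonoidAlgebra ℂ Γ) (LinearMap.mulLeft ℂ (MonoidAlgebra.single x 1)) =
      if x = 1 then (Fintype.card Γ : ℂ) else 0 := by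
  rw [trace_mulLeft_eq_sum (MonoidAlgebra.basis Γ ℂ)]
  have h : ∀ y : Γ, (MonoidAlgebra.basis Γ ℂ).repr
      (MonoidAlgebra.single x 1 * MonoidAlgebra.basis Γ ℂ y) y = if x = 1 then 1 else 0 := by
    intro y
    simp [MonoidAlgebra.basis, MonoidAlgebra.single_mul_single, Finsupp.single_apply]
  rw [Finset.sum_congr rfl fun y _ => h y]
  split_ifs <;> simp

lemma trace_mulLeft_pi_matrix {r : ℕ} (m : Fin r → ℕ)
    (M : ∀ i, Matrix (Fin (m i)) (Fin (m i)) ℂ) :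
    LinearMap.trace ℂ (∀ i, Matrix (Fin (m i)) (Fin (m i)) ℂ) (LinearMap.mulLeft ℂ M) =
      ∑ i, (m i : ℂ) * (M i).trace := by
  rw [trace_mulLeft_eq_sum (Pi.basis fun i => Matrix.stdBasis ℂ (Fin (m i)) (Fin (m i))),
    Fintype.sum_sigma]
  refine Finset.sum_congr rfl fun i _ => ?_
  have h : ∀ a b : Fin (m i), (Pi.basis fun i => Matrix.stdBasis ℂ (Fin (m i)) (Fin (m i))).repr
      (M * (Pi.basis fun i => Matrix.stdBasis ℂ (Fin (m i)) (Fin (m i))) ⟨i, (a, b)⟩)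
        ⟨i, (a, b)⟩ = M i a a := by
    intro a b
    rw [Pi.basis_repr, Pi.basis_apply, Pi.mul_apply, Pi.single_eq_same, Matrix.stdBasis_eq_single]
    change (M i * Matrix.single a b 1 : Matrix (Fin (m i)) (Fin (m i)) ℂ) a b = M i a a
    rw [Matrix.mul_single_apply_same, mul_one]
  rw [Fintype.sum_prod_type, Finset.sum_congr rfl fun a _ => Finset.sum_congr rfl fun b _ => h a b]
  simp [Matrix.trace, Finset.mul_sum]

/-- A finite group has finitely many irreducible representations such that the character of the
regular representation is the sum of their characters with multiplicities. -/
lemma exists_irreducibles (Γ : Type v) [Group Γ] [Fintype Γ] [DecidableEq Γ] :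
    ∃ (r : ℕ) (m : Fin r → ℕ) (τ : ∀ i, Γ →* GL (Fin (m i)) ℂ), (∀ i, IsIrreducible (τ i)) ∧
      ∀ x, ∑ i, (m i : ℂ) * (τ i x : Matrix (Fin (m i)) (Fin (m i)) ℂ).trace =
        if x = 1 then (Fintype.card Γ : ℂ) else 0 := by
  obtain ⟨r, m, hm, ⟨e⟩⟩ :=
    IsSemisimpleRing.exists_algEquiv_pi_matrix_of_isAlgClosed ℂ (MonoidAlgebra ℂ Γ)
  let f : ∀ i, MonoidAlgebra ℂ Γ →ₐ[ℂ] Matrix (Fin (m i)) (Fin (m i)) ℂ := fun i =>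
    (Pi.evalAlgHom ℂ (fun i => Matrix (Fin (m i)) (Fin (m i)) ℂ) i).comp e.toAlgHom
  let τ : ∀ i, Γ →* GL (Fin (m i)) ℂ := fun i =>
    ((f i).toMonoidHom.comp (MonoidAlgebra.of ℂ Γ)).toHomUnits
  have hτ : ∀ i x, (τ i x : Matrix (Fin (m i)) (Fin (m i)) ℂ) =
      f i (MonoidAlgebra.single x 1) := fun i x => rfl
  refine ⟨r, m, τ, fun i => ?_, fun x => ?_⟩
  · refine isIrreducible_of_span (Nat.pos_of_ne_zero (hm i).out) _ fun V hV M x hx => ?_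
    -- Every matrix of the `i`-th block comes from the group algebra, so a subspace stable under the
    -- group is stable under all matrices.
    obtain ⟨a, ha⟩ := e.surjective (Pi.single i M)
    have h1 : f i a = M := by
      change e a i = M
      rw [ha, Pi.single_eq_same]
    rw [← h1]
    clear ha h1
    induction a using MonoidAlgebra.induction_on with
    | of g =>
      have := hV g x hx
      rwa [hτ] at this
    | add a b ha hb =>
      rw [map_add, Matrix.add_mulVec]
      exact V.add_mem ha hb
    | smul z a ha =>
      rw [map_smul, Matrix.smul_mulVec]
      exact V.smul_mem _ ha
  -- The trace of left multiplication is computed on both sides of the Wedderburn isomorphism.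
  · rw [← trace_mulLeft_single, ← LinearMap.trace_conj' _ e.toLinearEquiv]
    have h1 : e.toLinearEquiv.conj (LinearMap.mulLeft ℂ (MonoidAlgebra.single x 1)) =
        LinearMap.mulLeft ℂ (e (MonoidAlgebra.single x 1)) := by
      refine LinearMap.ext fun y => ?_
      simp [LinearEquiv.conj_apply]
    rw [h1, trace_mulLeft_pi_matrix]
    rfl

variable {G : Type u} {G' : Type v} [Group G] [Group G'] {q : G' →* G} [Fintype q.ker]

/-- Otherwise all averaged intertwiners between `ρ` and the `τ i` vanish, so a diagonal entry of `ρ`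
is orthogonal to the regular character; that pairing is the nonzero group order. -/
lemma IsIrreducible.exists_trace_eq [DecidableEq q.ker] {r : ℕ} {m : Fin r → ℕ}
    {τ : ∀ i, q.ker →* GL (Fin (m i)) ℂ} (hτ : ∀ i, IsIrreducible (τ i))
    (hsum : ∀ x, ∑ i, (m i : ℂ) * (τ i x : Matrix (Fin (m i)) (Fin (m i)) ℂ).trace =
        if x = 1 then (Fintype.card q.ker : ℂ) else 0)
    {n : ℕ} {ρ : q.ker →* GL (Fin n) ℂ} (hρ : IsIrreducible ρ) :
    ∃ i, n = m i ∧ ∀ x, (ρ x : Matrix (Fin n) (Fin n) ℂ).trace =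
      (τ i x : Matrix (Fin (m i)) (Fin (m i)) ℂ).trace := by
  by_contra! hc
  have h0 : ∀ i (M : Matrix (Fin n) (Fin (m i)) ℂ),
      ∑ h, (ρ h : Matrix (Fin n) (Fin n) ℂ) * M *
        (τ i h⁻¹ : Matrix (Fin (m i)) (Fin (m i)) ℂ) = 0 := by
    intro i M
    by_contra h1
    obtain ⟨h2, h3⟩ := hρ.trace_eq_of_ne_zero (hτ i) _ (average_intertwines ρ (τ i) M) h1
    obtain ⟨x, hx⟩ := hc i h2
    exact hx (h3 x)
  have h1 : ∀ i a b, ∑ h, (ρ h : Matrix (Fin n) (Fin n) ℂ) a b *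
      (τ i h⁻¹ : Matrix (Fin (m i)) (Fin (m i)) ℂ).trace = 0 := by
    intro i a b
    simp only [Matrix.trace, Matrix.diag_apply, Finset.mul_sum]
    rw [Finset.sum_comm]
    refine Finset.sum_eq_zero fun c _ => ?_
    have h2 := congrFun (congrFun (h0 i (Matrix.single b c 1)) a) c
    rw [Matrix.sum_apply, Matrix.zero_apply] at h2
    rw [← h2]
    refine Finset.sum_congr rfl fun h _ => ?_
    rw [Matrix.mul_apply, Finset.sum_eq_single c]
    · rw [Matrix.mul_single_apply_same, mul_one]
    · intro j _ hj
      rw [Matrix.mul_single_apply_of_ne _ _ _ _ _ hj, zero_mul]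
    · simp
  let a : Fin n := ⟨0, hρ.1⟩
  have h2 : ∑ h, (ρ h : Matrix (Fin n) (Fin n) ℂ) a a *
      ∑ i, (m i : ℂ) * (τ i h⁻¹ : Matrix (Fin (m i)) (Fin (m i)) ℂ).trace = 0 := by
    simp only [Finset.mul_sum]
    rw [Finset.sum_comm]
    refine Finset.sum_eq_zero fun i _ => ?_
    rw [← mul_zero (m i : ℂ), ← h1 i a a, Finset.mul_sum]
    exact Finset.sum_congr rfl fun h _ => by ring
  simp only [hsum, inv_eq_one, mul_ite, mul_zero, Finset.sum_ite_eq', Finset.mem_univ, if_true,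
    map_one, Units.val_one, Matrix.one_apply_eq, one_mul] at h2
  exact Nat.cast_ne_zero.2 Fintype.card_ne_zero h2

end Wedderburn

/-! ### Counting lifts -/

section Counting

open scoped commutatorElement

/-- The equality case of the triangle inequality: the real parts must all be maximal, which leaves
no room for imaginary parts. -/
lemma eq_of_norm_le_of_sum_eq {ι : Type*} [Fintype ι] (m : ι → ℝ) (s : ι → ℂ) (B : ι → ℝ)
    (hm : ∀ i, 0 < m i) (hs : ∀ i, ‖s i‖ ≤ B i)
    (h : ∑ i, (m i : ℂ) * s i = ∑ i, (m i : ℂ) * (B i : ℂ)) (i : ι) : s i = B i := by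
  have h1 := congrArg Complex.re h
  simp only [Complex.re_sum, Complex.re_ofReal_mul, Complex.ofReal_re] at h1
  have h2 : ∀ i ∈ Finset.univ, m i * (s i).re ≤ m i * B i := fun i _ =>
    mul_le_mul_of_nonneg_left ((Complex.re_le_norm _).trans (hs i)) (hm i).le
  have h3 := (Finset.sum_eq_sum_iff_of_le h2).1 h1 i (Finset.mem_univ i)
  have h4 : (s i).re = B i := mul_left_cancel₀ (hm i).ne' h3
  have h5 : (s i).re = ‖s i‖ := le_antisymm (Complex.re_le_norm _) (by rw [h4]; exact hs i)
  rw [← h4]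
  refine Complex.ext rfl ?_
  rw [Complex.ofReal_im]
  exact Complex.abs_re_eq_norm.1 (by rw [h5, abs_norm])

variable {G : Type u} {G' : Type v} [Group G] [Group G'] {q : G' →* G} {d : ℕ}

variable {W : Type} [TopologicalSpace W] [PathConnectedSpace W] {P : C(Strip, W)} {x₀ : W}
  {g : FundamentalGroup W x₀ →* G} {α β : Fin d → G'}

lemma IsPolar.commProd_mem_ker (hP : IsPolar d P)
    (hα : ∀ k, q (α k) = g (sideA (tail x₀) P (k : ℕ)))
    (hβ : ∀ k, q (β k) = g (sideB (tail x₀) P (k : ℕ))) : commProd α β ∈ q.ker := by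
  rw [MonoidHom.mem_ker, map_commProd]
  simp only [hα, hβ]
  rw [← map_commProd, commProd]
  have := congrArg g (hP.prod_commutator_sides (tail x₀))
  rwa [map_one] at this

/-- The lifts of a homomorphism are in bijection with the solutions of an equation in the kernel. -/
lemma IsPolar.exists_equiv_lifts (hd : 1 ≤ d) (hP : IsPolar d P)
    (hα : ∀ k, q (α k) = g (sideA (tail x₀) P (k : ℕ)))
    (hβ : ∀ k, q (β k) = g (sideB (tail x₀) P (k : ℕ))) :
    Nonempty (Lifts q g ≃ {f : Fin d → q.ker × q.ker // word α β f = 1}) := by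
  have hq : ∀ x : q.ker, q x = 1 := fun x => x.2
  have hl : ∀ (φ : Lifts q g) x, q (φ.1 x) = g x := fun φ x => DFunLike.congr_fun φ.2 x
  let F : Lifts q g → Fin d → q.ker × q.ker := fun φ k =>
    (⟨φ.1 (sideA (tail x₀) P (k : ℕ)) * (α k)⁻¹, by
      rw [MonoidHom.mem_ker, map_mul, map_inv, hl, hα, mul_inv_cancel]⟩,
    ⟨φ.1 (sideB (tail x₀) P (k : ℕ)) * (β k)⁻¹, by
      rw [MonoidHom.mem_ker, map_mul, map_inv, hl, hβ, mul_inv_cancel]⟩)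
  have hF : ∀ φ, word α β (F φ) = 1 := by
    intro φ
    have h := (hP.exists_hom_iff hd (tail x₀) _ _).1 ⟨φ.1, fun k => ⟨rfl, rfl⟩⟩
    rw [← h, word, commProd]
    simp [translate, F]
  refine ⟨Equiv.ofBijective (fun φ => ⟨F φ, hF φ⟩) ⟨fun φ ψ h => Subtype.ext ?_, ?_⟩⟩
  · have h1 : ∀ k, F φ k = F ψ k := fun k => congrFun (congrArg Subtype.val h) k
    refine hP.hom_ext hd (tail x₀) (fun k => ?_) fun k => ?_
    · exact mul_right_cancel (congrArg Subtype.val (congrArg Prod.fst (h1 k)))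
    · exact mul_right_cancel (congrArg Subtype.val (congrArg Prod.snd (h1 k)))
  · rintro ⟨f, hf⟩
    obtain ⟨φ, hφ⟩ := hP.exists_hom hd (tail x₀) _ _ hf
    have hφ' : q.comp φ = g := by
      refine hP.hom_ext hd (tail x₀) (fun k => ?_) fun k => ?_
      · rw [MonoidHom.comp_apply, (hφ k).1, translate, map_mul, hq, one_mul, hα]
      · rw [MonoidHom.comp_apply, (hφ k).2, translate, map_mul, hq, one_mul, hβ]
    refine ⟨⟨φ, hφ'⟩, Subtype.ext (funext fun k => Prod.ext (Subtype.ext ?_) (Subtype.ext ?_))⟩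
    · change φ (sideA (tail x₀) P (k : ℕ)) * (α k)⁻¹ = (f k).1
      rw [(hφ k).1, translate, mul_inv_cancel_right]
    · change φ (sideB (tail x₀) P (k : ℕ)) * (β k)⁻¹ = (f k).2
      rw [(hφ k).2, translate, mul_inv_cancel_right]

variable [Fintype q.ker]

/-- The number of products of commutators equal to `1`, in terms of character sums. -/
lemma card_word_eq_one [DecidableEq q.ker] {r : ℕ} {m : Fin r → ℕ}
    {τ : ∀ i, q.ker →* GL (Fin (m i)) ℂ}
    (hsum : ∀ x, ∑ i, (m i : ℂ) * (τ i x : Matrix (Fin (m i)) (Fin (m i)) ℂ).trace =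
        if x = 1 then (Fintype.card q.ker : ℂ) else 0)
    (hw : commProd α β ∈ q.ker) :
    (Fintype.card q.ker : ℂ) * Nat.card {f : Fin d → q.ker × q.ker // word α β f = 1} =
      ∑ i, (m i : ℂ) * surfaceSum (τ i) α β := by
  classical
  simp only [surfaceSum, Finset.mul_sum]
  rw [Finset.sum_comm]
  have h1 : ∀ f : Fin d → q.ker × q.ker,
      ∑ i, (m i : ℂ) * (extendRep (τ i) (word α β f)).trace =
        if word α β f = 1 then (Fintype.card q.ker : ℂ) else 0 := by
    intro f
    have h2 := hsum ⟨_, word_mem_ker hw f⟩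
    simp only [← extendRep_coe, Subgroup.mk_eq_one] at h2
    exact h2
  rw [Finset.sum_congr rfl fun f _ => h1 f, ← Finset.sum_filter, Finset.sum_const, nsmul_eq_mul,
    Nat.card_eq_fintype_card, Fintype.card_subtype (fun f => word α β f = 1), mul_comm]

/-- The character sum takes its maximal value if and only if the class of the representation
vanishes on the fundamental class. -/
lemma IsPolar.surfaceSum_eq_iff (hd : 1 ≤ d) (hP : IsPolar d P)
    {fund : singularH2 W} (hfund : IsFundamentalClass W fund)
    (hα : ∀ k, q (α k) = g (sideA (tail x₀) P (k : ℕ)))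
    (hβ : ∀ k, q (β k) = g (sideB (tail x₀) P (k : ℕ)))
    {n : ℕ} {ρ : q.ker →* GL (Fin n) ℂ} (hρ : IsIrreducible ρ) :
    surfaceSum ρ α β = n * ((Fintype.card q.ker : ℂ) / n) ^ (2 * d) ↔
      ∃ hg : ∀ x, g x ∈ stabilizer q ρ, evaluate x₀ fund
        (H2.pullback (g.codRestrict (stabilizer q ρ) hg) (zetaClass hρ)) = 1 := by
  have hB : (n : ℂ) * ((Fintype.card q.ker : ℂ) / n) ^ (2 * d) ≠ 0 := by
    have hn : (n : ℂ) ≠ 0 := Nat.cast_ne_zero.2 hρ.1.ne'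
    have hc : (Fintype.card q.ker : ℂ) ≠ 0 := Nat.cast_ne_zero.2 Fintype.card_ne_zero
    exact mul_ne_zero hn (pow_ne_zero _ (div_ne_zero hc hn))
  have hw := hP.commProd_mem_ker hα hβ
  have key : ∀ hg : ∀ x, g x ∈ stabilizer q ρ,
      surfaceSum ρ α β = n * ((Fintype.card q.ker : ℂ) / n) ^ (2 * d) ↔ evaluate x₀ fund
        (H2.pullback (g.codRestrict (stabilizer q ρ) hg) (zetaClass hρ)) = 1 := by
    intro hg
    have h1 := hP.evaluate_eq_one_iff hd
      (hρ.isTwistedHom (g.codRestrict (stabilizer q ρ) hg)) hfund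
    refine Iff.trans ?_ h1.symm
    let t : FundamentalGroup W x₀ → intertwiners ρ := fun x =>
      ⟨(lift q ρ ⟨g x, hg x⟩, mat q ρ ⟨g x, hg x⟩), mat_spec q ρ _⟩
    have ht : ∀ x, q (t x).1.1 = g x := fun x => q_lift q ρ ⟨g x, hg x⟩
    obtain ⟨z, -, hz, hsum⟩ := hρ.exists_surfaceSum_eq
      (fun k : Fin d => t (sideA (tail x₀) P (k : ℕ)))
      (fun k : Fin d => t (sideB (tail x₀) P (k : ℕ)))
      (commProd_mem_ker_of_eq hw (fun k => by rw [ht, hα]) (fun k => by rw [ht, hβ]))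
    rw [surfaceSum_congr ρ (α' := fun k : Fin d => (t (sideA (tail x₀) P (k : ℕ))).1.1)
      (β' := fun k : Fin d => (t (sideB (tail x₀) P (k : ℕ))).1.1) (fun k => by rw [ht, hα])
      (fun k => by rw [ht, hβ]), hsum, mul_eq_right₀ hB, inv_eq_one, Units.val_eq_one]
    -- Both sides now say that the scalar of the surface relation in the extension is `1`.
    rw [← map_eq_one_iff _ (extensionScalar_injective hρ), ← hz]
    rfl
  constructor
  · intro h
    have hs := hρ.mem_stabilizer_of_surfaceSum_ne_zero hw (by rw [h]; exact hB)
    have htop : (stabilizer q ρ).comap g = ⊤ := hP.eq_top_of_sides_mem (tail x₀) hd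
      (fun k => by rw [Subgroup.mem_comap, ← hα]; exact (hs k).1)
      (fun k => by rw [Subgroup.mem_comap, ← hβ]; exact (hs k).2)
    have hg : ∀ x, g x ∈ stabilizer q ρ := fun x => by
      have : x ∈ (stabilizer q ρ).comap g := by rw [htop]; trivial
      exact this
    exact ⟨hg, (key hg).1 h⟩
  · rintro ⟨hg, h⟩
    exact (key hg).2 h

/-- Lifts of the trivial homomorphism are homomorphisms to the kernel. -/
def liftsOneEquiv {G : Type u} {G' : Type v} {Q : Type*} [Group G] [Group G'] [Group Q]
    (q : G' →* G) : Lifts q (1 : Q →* G) ≃ (Q →* q.ker) where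
  toFun φ := φ.1.codRestrict q.ker fun x => DFunLike.congr_fun φ.2 x
  invFun φ := ⟨q.ker.subtype.comp φ, MonoidHom.ext fun x => (φ x).2⟩
  left_inv _ := rfl
  right_inv _ := rfl

lemma surfaceSum_eq_of_trace_eq {m n : ℕ} {ρ : q.ker →* GL (Fin n) ℂ} {σ : q.ker →* GL (Fin m) ℂ}
    (h : ∀ x, (ρ x : Matrix (Fin n) (Fin n) ℂ).trace = (σ x : Matrix (Fin m) (Fin m) ℂ).trace)
    (α β : Fin d → G') : surfaceSum ρ α β = surfaceSum σ α β := by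
  refine Finset.sum_congr rfl fun f _ => ?_
  rw [extendRep, extendRep]
  split_ifs
  · exact h _
  · simp

end Counting

end

end SurfaceLifts

theorem corollary1p3p3 {G : Type*} {G' : Type*} [Group G] [Group G']
    (q : G' →* G) (hq : Function.Surjective q) [Finite q.ker]
    {W : Type} [TopologicalSpace W] [PathConnectedSpace W]
    (d : ℕ) (hd : 1 ≤ d) (hW : SurfaceLifts.IsClosedSurfaceOfGenus W d)
    (fund : SurfaceLifts.singularH2 W) (hfund : SurfaceLifts.IsFundamentalClass W fund)
    (x₀ : W) (g : FundamentalGroup W x₀ →* G) :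
    (SurfaceLifts.Lifts q g).Finite ∧ Finite (FundamentalGroup W x₀ →* q.ker) ∧
    (SurfaceLifts.Lifts q g).ncard ≤ Nat.card (FundamentalGroup W x₀ →* q.ker) ∧
    ((SurfaceLifts.Lifts q g).ncard = Nat.card (FundamentalGroup W x₀ →* q.ker) ↔
      ∀ (n : ℕ) (ρ : q.ker →* GL (Fin n) ℂ) (hρ : SurfaceLifts.IsIrreducible ρ),
        ∃ hg : ∀ x, g x ∈ SurfaceLifts.stabilizer q ρ,
          SurfaceLifts.evaluate x₀ fund
            (SurfaceLifts.H2.pullback (g.codRestrict (SurfaceLifts.stabilizer q ρ) hg)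
              (SurfaceLifts.zetaClass hρ)) = 1) := by
  classical
  have := Fintype.ofFinite q.ker
  obtain ⟨P, hP⟩ := SurfaceLifts.exists_isPolar hd hW
  choose α hα using fun k : Fin d =>
    hq (g (SurfaceLifts.sideA (SurfaceLifts.tail x₀) P (k : ℕ)))
  choose β hβ using fun k : Fin d =>
    hq (g (SurfaceLifts.sideB (SurfaceLifts.tail x₀) P (k : ℕ)))
  obtain ⟨e⟩ := hP.exists_equiv_lifts hd hα hβ
  -- The same count for trivial `g` and trivial lifts gives `|Hom(π, Γ)|`, with every character sum
  -- equal to its bound.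
  obtain ⟨e₁⟩ := hP.exists_equiv_lifts (q := q) (x₀ := x₀) (g := 1) (α := 1) (β := 1) hd
    (fun _ => map_one q) (fun _ => map_one q)
  have hfin : Finite (SurfaceLifts.Lifts q g) := Finite.of_equiv _ e.symm
  have hcard : (SurfaceLifts.Lifts q g).ncard = _ :=
    (Nat.card_coe_set_eq _).symm.trans (Nat.card_congr e)
  have hcard₁ := Nat.card_congr ((SurfaceLifts.liftsOneEquiv q).symm.trans e₁)
  obtain ⟨r, m, τ, hτ, hsum⟩ := SurfaceLifts.exists_irreducibles q.ker
  have hw := hP.commProd_mem_ker hα hβ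
  have h1 := SurfaceLifts.card_word_eq_one hsum hw
  have h2 := SurfaceLifts.card_word_eq_one hsum (α := 1) (β := 1)
    (hP.commProd_mem_ker (x₀ := x₀) (g := 1) (fun _ => map_one q) (fun _ => map_one q))
  rw [← hcard] at h1
  rw [← hcard₁] at h2
  set c := Fintype.card q.ker with hc
  have hc0 : 0 < (c : ℝ) := Nat.cast_pos.2 Fintype.card_pos
  let B : Fin r → ℝ := fun i => m i * ((c : ℝ) / m i) ^ (2 * d)
  have hB : ∀ i, SurfaceLifts.surfaceSum (τ i) (1 : Fin d → G') 1 = (B i : ℂ) := fun i => by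
    rw [(hτ i).surfaceSum_one]
    simp only [B, hc]
    push_cast
    rfl
  simp only [hB] at h2
  have hle : ∀ i, ‖SurfaceLifts.surfaceSum (τ i) α β‖ ≤ B i := fun i =>
    (hτ i).norm_surfaceSum_le hw
  refine ⟨Set.toFinite _, Finite.of_equiv _ ((SurfaceLifts.liftsOneEquiv q).symm.trans e₁).symm,
    ?_, fun h n ρ hρ => ?_, fun h => ?_⟩
  · have h3 : (c : ℝ) * (SurfaceLifts.Lifts q g).ncard ≤
        c * Nat.card (FundamentalGroup W x₀ →* q.ker) := by
      have h4 : (c : ℝ) * (SurfaceLifts.Lifts q g).ncard =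
          ‖(c : ℂ) * (SurfaceLifts.Lifts q g).ncard‖ := by simp
      have h5 : (c : ℝ) * Nat.card (FundamentalGroup W x₀ →* q.ker) = ∑ i, m i * B i := by
        exact_mod_cast h2
      rw [h4, h1, h5]
      refine (norm_sum_le _ _).trans (Finset.sum_le_sum fun i _ => ?_)
      rw [norm_mul, Complex.norm_natCast]
      exact mul_le_mul_of_nonneg_left (hle i) (Nat.cast_nonneg _)
    exact_mod_cast le_of_mul_le_mul_left h3 hc0
  · rw [h, h2] at h1
    -- The character sums see only the character, so an arbitrary `ρ` may be replaced by a member of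
    -- the list.
    obtain ⟨i, rfl, hi⟩ := hρ.exists_trace_eq hτ hsum
    rw [← hP.surfaceSum_eq_iff hd hfund hα hβ hρ, SurfaceLifts.surfaceSum_eq_of_trace_eq hi,
      SurfaceLifts.eq_of_norm_le_of_sum_eq (fun i => (m i : ℝ)) _ B
        (fun i => Nat.cast_pos.2 (hτ i).1) hle (by push_cast; exact h1.symm) i]
    simp only [B, hc]
    push_cast
    rfl
  · have h3 : (c : ℂ) * (SurfaceLifts.Lifts q g).ncard =
        c * Nat.card (FundamentalGroup W x₀ →* q.ker) := by
      rw [h1, h2]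
      refine Finset.sum_congr rfl fun i _ => ?_
      rw [(hP.surfaceSum_eq_iff hd hfund hα hβ (hτ i)).2 (h (m i) (τ i) (hτ i)), ← hB,
        (hτ i).surfaceSum_one]
    have h4 : (c : ℂ) ≠ 0 := by exact_mod_cast hc0.ne'
    exact_mod_cast mul_left_cancel₀ h4 h3
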